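/- All graphs are finite, nonempty, undirected and simple. For a graph $G$, the point set $P(G)$ consists of the vertices of $G$ and of the points $p(u,v,\lambda)$ for $uv\in E(G)$ and $\lambda\in[0,1]$, where $p(u,v,\lambda)=p(v,u,1-\lambda)$, $p(u,v,0)=u$ and $p(u,v,1)=v$ (every edge is a continuum of unit length). A walk is a nonempty finite sequence $p_0,p_1,\dots,p_z$ of points in which any two consecutive points are distinct and lie on the same edge; its length is $\sum_{i=1}^z d(p_{i-1},p_i)$, where $d(p(u,v,\lambda),p(u,v,\mu))=|\lambda-\mu|$. The distance of two arbitrary points is the minimum length of a walk between them, and $\infty$ if there is none. A tour is a walk with $p_0=p_z$; it passes its stopping points $p_0,\dots,p_z$ and all points of the edge segments between consecutive stopping points. For a real $\delta>0$, a $\delta$-tour is a tour such that every point of $P(G)$ has distance at most $\delta$ to the set of points passed by the tour. Theorem. There is an algorithm that, given a graph $G$ on $n$ vertices and reals $\delta\in(0,3/2)$ and $K\ge 0$, decides whether $G$ has a $\delta$-tour of length at most $K$ in time $f(K,\delta)\cdot n^{O(1)}$, for some computable function $f$ with values in the nonnegative integers. Here an algorithm is a program for a random access machine with one array of cells for natural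 numbers and one array of cells for real numbers. Each operation is exact and takes one step: addition, (truncated) subtraction and comparison of natural numbers, addition, subtraction and comparison of real numbers, access to a cell of either array whose address is a given natural number, and control flow; the only constants are natural numbers. The graph is given by its adjacency matrix. Computability of $f$ refers to the same machines. -/

import Mathlib

open scoped ENNReal

noncomputable section

/-! ## The continuous metric space of a graph and its tours -/

namespace GraphTour

variable {V : Type*}

/-- The point `p(u, v, t)` at distance `t` from `u` on the edge `uv`, in barycentric coordinates:
it puts weight `1 - t` on `u` and weight `t` on `v`. Hence `pt u v t = pt v u (1 - t)`, and
`pt u v 0`, `pt u v 1` are the vertices `u`, `v`. -/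
def pt [DecidableEq V] (u v : V) (t : ℝ) : V → ℝ := Pi.single u (1 - t) + Pi.single v t

/-- The point that coincides with the vertex `u`. -/
def vtx [DecidableEq V] (u : V) : V → ℝ := Pi.single u 1

/-- The point set `P(G)`: all vertices, and all points on all edges. -/
def points [DecidableEq V] (G : SimpleGraph V) : Set (V → ℝ) :=
  {x | (∃ u, x = vtx u) ∨ ∃ u v, G.Adj u v ∧ ∃ t ∈ Set.Icc (0 : ℝ) 1, x = pt u v t}

/-- Two points lie on the same edge. -/
def OnCommonEdge [DecidableEq V] (G : SimpleGraph V) (x y : V → ℝ) : Prop :=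
  ∃ u v, G.Adj u v ∧ ∃ s ∈ Set.Icc (0 : ℝ) 1, ∃ t ∈ Set.Icc (0 : ℝ) 1,
    x = pt u v s ∧ y = pt u v t

/-- A walk: a nonempty finite sequence of points of `G` in which any two consecutive points are
distinct and lie on the same edge. -/
def IsWalk [DecidableEq V] (G : SimpleGraph V) (W : List (V → ℝ)) : Prop :=
  W ≠ [] ∧ (∀ x ∈ W, x ∈ points G) ∧ W.IsChain (fun x y => x ≠ y ∧ OnCommonEdge G x y)

/-- The length of a walk: the sum of the distances of consecutive points. On a single edge, the
supremum distance of barycentric coordinates is the distance along the edge, see `dist_pt`. -/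
def walkLength [Fintype V] : List (V → ℝ) → ℝ
  | x :: y :: W => dist x y + walkLength (y :: W)
  | _ => 0

/-- The distance of two points: the infimum of the lengths of all walks from `x` to `y`; it is `∞`
if there is no such walk. -/
def ptDist [Fintype V] [DecidableEq V] (G : SimpleGraph V) (x y : V → ℝ) : ℝ≥0∞ :=
  ⨅ (W : List (V → ℝ)) (_ : IsWalk G W ∧ W.head? = some x ∧ W.getLast? = some y),
    ENNReal.ofReal (walkLength W)

/-- The points passed by a walk: its stopping points, and the edge segments between consecutive
stopping points. In barycentric coordinates an edge segment is a line segment, see `segment_pt`. -/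
def passed (W : List (V → ℝ)) : Set (V → ℝ) :=
  {x | x ∈ W} ∪ {x | ∃ p q, [p, q] <:+: W ∧ x ∈ segment ℝ p q}

/-- A tour: a walk whose first and last points agree. -/
def IsTour [DecidableEq V] (G : SimpleGraph V) (T : List (V → ℝ)) : Prop :=
  IsWalk G T ∧ T.head? = T.getLast?

/-- A `δ`-tour: a tour such that every point of `G` has distance at most `δ` to the set of points
passed by the tour. -/
def IsDeltaTour [Fintype V] [DecidableEq V] (G : SimpleGraph V) (δ : ℝ) (T : List (V → ℝ)) :
    Prop :=
  IsTour G T ∧ ∀ x ∈ points G, (⨅ y ∈ passed T, ptDist G x y) ≤ ENNReal.ofReal δ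

/-- `G` has a `δ`-tour of length at most `K`. -/
def HasDeltaTour [Fintype V] [DecidableEq V] (G : SimpleGraph V) (δ K : ℝ) : Prop :=
  ∃ T : List (V → ℝ), IsDeltaTour G δ T ∧ walkLength T ≤ K

theorem dist_pt [Fintype V] [DecidableEq V] {u v : V} (h : u ≠ v) (s t : ℝ) :
    dist (pt u v s) (pt u v t) = |s - t| := by
  apply le_antisymm
  · refine (dist_pi_le_iff (abs_nonneg _)).2 fun w => ?_
    rw [Real.dist_eq]
    by_cases hu : w = u
    · subst hu
      simp only [pt, Pi.add_apply, Pi.single_eq_same, Pi.single_eq_of_ne h, add_zero]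
      rw [abs_sub_comm s t]
      apply le_of_eq
      congr 1
      ring
    · by_cases hv : w = v
      · subst hv
        simp [pt, hu]
      · simp [pt, hu, hv]
  · have := dist_le_pi_dist (pt u v s) (pt u v t) v
    rw [Real.dist_eq] at this
    simpa [pt, h.symm] using this

theorem segment_pt [DecidableEq V] (u v : V) (s t : ℝ) :
    segment ℝ (pt u v s) (pt u v t) = {x | ∃ r, min s t ≤ r ∧ r ≤ max s t ∧ x = pt u v r} := by
  have key : ∀ a b : ℝ, a + b = 1 → a • pt u v s + b • pt u v t = pt u v (a * s + b * t) := by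
    intro a b hab
    obtain rfl : a = 1 - b := by linarith
    ext w
    simp only [pt, Pi.add_apply, Pi.smul_apply, smul_eq_mul, Pi.single_apply]
    split_ifs <;> ring
  ext x
  constructor
  · rintro ⟨a, b, ha, hb, hab, rfl⟩
    have hm : a * s + b * t ∈ segment ℝ s t := ⟨a, b, ha, hb, hab, rfl⟩
    rw [segment_eq_uIcc] at hm
    exact ⟨_, hm.1, hm.2, key a b hab⟩
  · rintro ⟨r, h1, h2, rfl⟩
    have hm : r ∈ segment ℝ s t := by
      rw [segment_eq_uIcc]
      exact ⟨h1, h2⟩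
    obtain ⟨a, b, ha, hb, hab, rfl⟩ := hm
    exact ⟨a, b, ha, hb, hab, key a b hab⟩

end GraphTour

/-! ## Random access machines over natural numbers and real numbers

The machine has two infinite arrays of memory cells: the cells of the first hold natural numbers,
those of the second hold real numbers. Real numbers can only be added, subtracted and compared, and
the only constants of a program are natural numbers. Natural numbers can be added, subtracted
(truncated at zero), compared, and used as addresses in both arrays. There is no rounding operation
and no multiplication, so that counting one step per operation is a realistic measure of time. -/

namespace RealRAM

/-- The contents of the memory. -/
@[ext]
structure State where
  nat : ℕ → ℕ
  real : ℕ → ℝ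

/-- Expressions of natural number type; `mem a` is the content of the cell with address `a`. -/
inductive NatExpr
  | lit (k : ℕ)
  | mem (a : NatExpr)
  | add (a b : NatExpr)
  | sub (a b : NatExpr)

/-- Expressions of real type; `mem a` is the content of the real cell with address `a`. -/
inductive RealExpr
  | lit (k : ℕ)
  | mem (a : NatExpr)
  | add (x y : RealExpr)
  | sub (x y : RealExpr)

/-- Tests. -/
inductive Test
  | natLe (a b : NatExpr)
  | realLe (x y : RealExpr)
  | not (b : Test)
  | and (b c : Test)

/-- Programs. -/
inductive Prog
  | skip
  | setNat (a : NatExpr) (e : NatExpr)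
  | setReal (a : NatExpr) (e : RealExpr)
  | seq (P Q : Prog)
  | ite (b : Test) (P Q : Prog)
  | loop (b : Test) (P : Prog)

def NatExpr.eval (s : State) : NatExpr → ℕ
  | lit k => k
  | mem a => s.nat (a.eval s)
  | add a b => a.eval s + b.eval s
  | sub a b => a.eval s - b.eval s

def RealExpr.eval (s : State) : RealExpr → ℝ
  | lit k => (k : ℝ)
  | mem a => s.real (a.eval s)
  | add x y => x.eval s + y.eval s
  | sub x y => x.eval s - y.eval s

def Test.Holds (s : State) : Test → Prop
  | natLe a b => a.eval s ≤ b.eval s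
  | realLe x y => x.eval s ≤ y.eval s
  | not b => ¬ b.Holds s
  | and b c => b.Holds s ∧ c.Holds s

/-- The number of steps needed to evaluate an expression: one for each of its nodes. -/
def NatExpr.cost : NatExpr → ℕ
  | lit _ => 1
  | mem a => a.cost + 1
  | add a b => a.cost + b.cost + 1
  | sub a b => a.cost + b.cost + 1

def RealExpr.cost : RealExpr → ℕ
  | lit _ => 1
  | mem a => a.cost + 1
  | add x y => x.cost + y.cost + 1
  | sub x y => x.cost + y.cost + 1

def Test.cost : Test → ℕ
  | natLe a b => a.cost + b.cost + 1
  | realLe x y => x.cost + y.cost + 1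
  | not b => b.cost + 1
  | and b c => b.cost + c.cost + 1

/-- `Exec P s t s'`: started in the state `s`, the program `P` halts after exactly `t` steps, in the
state `s'`. -/
inductive Exec : Prog → State → ℕ → State → Prop
  | skip (s : State) : Exec .skip s 1 s
  | setNat (a e : NatExpr) (s : State) :
      Exec (.setNat a e) s (a.cost + e.cost + 1)
        { s with nat := Function.update s.nat (a.eval s) (e.eval s) }
  | setReal (a : NatExpr) (e : RealExpr) (s : State) :
      Exec (.setReal a e) s (a.cost + e.cost + 1)
        { s with real := Function.update s.real (a.eval s) (e.eval s) }
  | seq {P Q : Prog} {s s' s'' : State} {t t' : ℕ} :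
      Exec P s t s' → Exec Q s' t' s'' → Exec (.seq P Q) s (t + t') s''
  | ite_true {b : Test} {P Q : Prog} {s s' : State} {t : ℕ} :
      b.Holds s → Exec P s t s' → Exec (.ite b P Q) s (b.cost + t) s'
  | ite_false {b : Test} {P Q : Prog} {s s' : State} {t : ℕ} :
      ¬ b.Holds s → Exec Q s t s' → Exec (.ite b P Q) s (b.cost + t) s'
  | loop_true {b : Test} {P : Prog} {s s' s'' : State} {t t' : ℕ} :
      b.Holds s → Exec P s t s' → Exec (.loop b P) s' t' s'' →
        Exec (.loop b P) s (b.cost + t + t') s''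
  | loop_false {b : Test} {P : Prog} {s : State} :
      ¬ b.Holds s → Exec (.loop b P) s b.cost s

/-- Executions are deterministic, in their result and in their number of steps. -/
theorem Exec.deterministic {P : Prog} {s s₁ s₂ : State} {t₁ t₂ : ℕ}
    (h₁ : Exec P s t₁ s₁) (h₂ : Exec P s t₂ s₂) : t₁ = t₂ ∧ s₁ = s₂ := by
  induction h₁ generalizing t₂ s₂ with
  | skip s => cases h₂; exact ⟨rfl, rfl⟩
  | setNat a e s => cases h₂; exact ⟨rfl, rfl⟩
  | setReal a e s => cases h₂; exact ⟨rfl, rfl⟩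
  | seq _ _ ih ih' =>
    cases h₂ with
    | seq h h' =>
      obtain ⟨rfl, rfl⟩ := ih h
      obtain ⟨rfl, rfl⟩ := ih' h'
      exact ⟨rfl, rfl⟩
  | ite_true hb _ ih =>
    cases h₂ with
    | ite_true _ h => obtain ⟨rfl, rfl⟩ := ih h; exact ⟨rfl, rfl⟩
    | ite_false hb' _ => exact absurd hb hb'
  | ite_false hb _ ih =>
    cases h₂ with
    | ite_true hb' _ => exact absurd hb' hb
    | ite_false _ h => obtain ⟨rfl, rfl⟩ := ih h; exact ⟨rfl, rfl⟩
  | loop_true hb _ _ ih ih' =>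
    cases h₂ with
    | loop_true _ h h' =>
      obtain ⟨rfl, rfl⟩ := ih h
      obtain ⟨rfl, rfl⟩ := ih' h'
      exact ⟨rfl, rfl⟩
    | loop_false hb' => exact absurd hb hb'
  | loop_false hb =>
    cases h₂ with
    | loop_true hb' _ _ => exact absurd hb' hb
    | loop_false _ => exact ⟨rfl, rfl⟩

/-- The memory that initially holds the graph `G` on the vertices `0, …, n - 1` and the reals `x`
and `y`: the natural number cells hold `n`, followed by the `n * n` entries of the adjacency matrix
of `G`, row by row; the real cells hold `x`, `y`; and all other cells hold `0`. -/
def graphInput {n : ℕ} (G : SimpleGraph (Fin n)) (x y : ℝ) : State where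
  nat := fun a =>
    open Classical in
    if a = 0 then n
    else if ∃ i j : Fin n, a = 1 + (i * n + j) ∧ G.Adj i j then 1 else 0
  real := fun a => if a = 0 then x else if a = 1 then y else 0

/-- The memory that initially holds the reals `x` and `y`. -/
def realInput (x y : ℝ) : State where
  nat := fun _ => 0
  real := fun a => if a = 0 then x else if a = 1 then y else 0

/-- Started on `s`, the program `P` halts after at most `b` steps, with output `1` (in the natural
number cell `0`) if `A` is true and with output `0` if `A` is false. -/
def DecidesWithin (P : Prog) (s : State) (A : Prop) (b : ℕ) : Prop :=
  ∃ t s', Exec P s t s' ∧ t ≤ b ∧ (A → s'.nat 0 = 1) ∧ (¬ A → s'.nat 0 = 0)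

/-- A function of two real variables with natural numbers as values is computable if some program
computes it (with its output in the natural number cell `0`). -/
def ComputableFun (f : ℝ → ℝ → ℕ) : Prop :=
  ∃ P : Prog, ∀ x y : ℝ, ∃ t s', Exec P (realInput x y) t s' ∧ s'.nat 0 = f x y

end RealRAM

end

/-! A tour matters only through a finite amount of data. Either it visits a vertex, and then it is a
closed walk on vertices together with peeks, that is, excursions from visited vertices into edges
and back; or it stays inside one edge and sweeps a segment of it. Given the walk, the conditions on
the depths `a` of the peeks and on upper bounds `r` for the distances of the vertices to the tour
are linear inequalities, apart from finitely many choices of how each vertex is reached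
(`IsFeasible`). In `hasDeltaTour_iff_sol` these data are shown to be equivalent to a tour: from a
tour, `r` is read off as the true distance (`sol_of_hasDeltaTour`); from a solution, induction along
the choices shows that `r` really bounds the distances, and the inequality of an edge bounds the
distance of its worst point.

The combinatorial core is a kernel. Fix `h` with `IsBound δ K h`. Take an edge none of whose ends is
visited. It has no peek, so its ends satisfy `r u + r v ≤ 2 * δ - 1`; as `δ < 3 / 2`, one of them
has `r < 1`, and is therefore the target of a peek of depth at least `(3 - 2 * δ) / 2`. The length
bound allows few such peeks. Hence the visited vertices and the deeply peeked ones form a vertex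
cover of at most `3 * h + 2` vertices (`Sol.exists_cover`), and outside of it there are at most `2 ^
(3 * h + 2)` classes of twins.

In a large class of twins one vertex can be deleted (`sol_erase_iff`). Deletion preserves solutions,
since an unvisited twin farthest from the tour is dispensable. For the converse, a twin without a
peek can be duplicated; such a twin is produced by the exchange argument
`IsFeasible.exists_no_peek`, which trades the peeks into all twins for slightly deeper peeks into
their common neighbors. Keeping the first `2 * h + 4` vertices of each class thus gives an
equivalent graph, and if this graph is larger than `sizeBound h`, then there is no tour
(`sol_iff_kernel`).

The kernel is decided by brute force. There are finitely many closed walks to try, but the depths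
are real and the machine can only add and compare. By Fourier-Motzkin elimination
(`exists_small_solution`), a solvable system has a solution whose coordinates are combinations of
`1`, `δ`, `K` with bounded integer coefficients over a bounded common denominator, and those can be
enumerated. The search is a formula built from linear inequalities by connectives and bounded
quantifiers; `RealDec` compiles such formulas to programs with primitive recursive running time. The
time for the kernel is therefore a primitive recursive function of `h`, and the least suitable `h`
is found by the machine itself, so that `f` is computable. The kernelization is written as an
explicit program with running time of order `n ^ 5`, after `h` is found. -/

noncomputable section

/-! ## Total correctness with time bounds -/

namespace RealRAM

/-- Started on `s`, the program `P` halts after at most `T` steps, in a state that satisfies `Q`. -/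
def Runs (P : Prog) (s : State) (T : ℕ) (Q : State → Prop) : Prop :=
  ∃ t s', Exec P s t s' ∧ t ≤ T ∧ Q s'

theorem Runs.mono {P : Prog} {s : State} {T T' : ℕ} {Q Q' : State → Prop} (h : Runs P s T Q)
    (hT : T ≤ T') (hQ : ∀ s', Q s' → Q' s') : Runs P s T' Q' := by
  obtain ⟨t, s', h1, h2, h3⟩ := h
  exact ⟨t, s', h1, h2.trans hT, hQ _ h3⟩

theorem Runs.seq {P R : Prog} {s : State} {T T' : ℕ} {Q Q' : State → Prop} (h : Runs P s T Q)
    (h' : ∀ s', Q s' → Runs R s' T' Q') : Runs (.seq P R) s (T + T') Q' := by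
  obtain ⟨t, s', h1, h2, h3⟩ := h
  obtain ⟨t', s'', h4, h5, h6⟩ := h' s' h3
  exact ⟨_, _, .seq h1 h4, by omega, h6⟩

theorem Runs.skip {s : State} {Q : State → Prop} (h : Q s) : Runs .skip s 1 Q :=
  ⟨_, _, .skip s, le_rfl, h⟩

theorem Runs.setNat {a e : NatExpr} {s : State} {Q : State → Prop}
    (h : Q { s with nat := Function.update s.nat (a.eval s) (e.eval s) }) :
    Runs (.setNat a e) s (a.cost + e.cost + 1) Q :=
  ⟨_, _, .setNat a e s, le_rfl, h⟩

theorem Runs.setReal {a : NatExpr} {e : RealExpr} {s : State} {Q : State → Prop}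
    (h : Q { s with real := Function.update s.real (a.eval s) (e.eval s) }) :
    Runs (.setReal a e) s (a.cost + e.cost + 1) Q :=
  ⟨_, _, .setReal a e s, le_rfl, h⟩

theorem Runs.ite {b : Test} {P R : Prog} {s : State} {T : ℕ} {Q : State → Prop}
    (h : b.Holds s → Runs P s T Q) (h' : ¬ b.Holds s → Runs R s T Q) :
    Runs (.ite b P R) s (b.cost + T) Q := by
  by_cases hb : b.Holds s
  · obtain ⟨t, s', h1, h2, h3⟩ := h hb
    exact ⟨_, _, .ite_true hb h1, by omega, h3⟩
  · obtain ⟨t, s', h1, h2, h3⟩ := h' hb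
    exact ⟨_, _, .ite_false hb h1, by omega, h3⟩

/-- The invariant `I k` carries the number `k` of completed passes, so it also decides the test and
thereby the exact number of passes. The cost of a pass may depend on `k`; this is needed for
primitive recursion. -/
theorem Runs.loop {b : Test} {P : Prog} {I : ℕ → State → Prop} {c : ℕ → ℕ} {N : ℕ} {s : State}
    (h0 : I 0 s) (hstep : ∀ k < N, ∀ s, I k s → b.Holds s ∧ Runs P s (c k) (I (k + 1)))
    (hend : ∀ s, I N s → ¬ b.Holds s) :
    Runs (.loop b P) s (∑ k ∈ Finset.range N, (b.cost + c k) + b.cost) (I N) := by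
  have key : ∀ j k s, k + j = N → I k s →
      Runs (.loop b P) s (∑ i ∈ Finset.range j, (b.cost + c (k + i)) + b.cost) (I N) := by
    intro j
    induction j with
    | zero =>
      intro k s hk hI
      obtain rfl : k = N := by omega
      exact ⟨_, _, .loop_false (hend s hI), by simp, hI⟩
    | succ j ih =>
      intro k s hk hI
      obtain ⟨hb, t, s', h1, h2, h3⟩ := hstep k (by omega) s hI
      obtain ⟨t', s'', h4, h5, h6⟩ := ih (k + 1) s' (by omega) h3
      refine ⟨_, _, .loop_true hb h1 h4, ?_, h6⟩
      rw [Finset.sum_range_succ']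
      have : ∀ i, k + 1 + i = k + (i + 1) := fun i => by omega
      simp only [this] at h5
      simp only [add_zero]
      omega
  simpa using key N 0 s (by omega) h0

theorem Runs.loop_const {b : Test} {P : Prog} {I : ℕ → State → Prop} {c : ℕ} {N : ℕ} {s : State}
    (h0 : I 0 s) (hstep : ∀ k < N, ∀ s, I k s → b.Holds s ∧ Runs P s c (I (k + 1)))
    (hend : ∀ s, I N s → ¬ b.Holds s) :
    Runs (.loop b P) s (N * (b.cost + c) + b.cost) (I N) := by
  simpa using Runs.loop (c := fun _ => c) h0 hstep hend

/-- The cells for natural numbers below `d` and the cells for reals are unchanged. -/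
def Keeps (d : ℕ) (s s' : State) : Prop := (∀ c < d, s'.nat c = s.nat c) ∧ s'.real = s.real

theorem Keeps.trans {d e : ℕ} {s s' s'' : State} (h : Keeps d s s') (h' : Keeps e s' s'')
    (hde : d ≤ e) : Keeps d s s'' :=
  ⟨fun c hc => (h'.1 c (hc.trans_le hde)).trans (h.1 c hc), h'.2.trans h.2⟩

theorem Keeps.mono {d e : ℕ} {s s' : State} (h : Keeps e s s') (hde : d ≤ e) : Keeps d s s' :=
  ⟨fun c hc => h.1 c (hc.trans_le hde), h.2⟩

theorem Keeps.update {d e x : ℕ} {s s' : State} (h : Keeps d s s') (hde : d ≤ e) :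
    Keeps d s { s' with nat := Function.update s'.nat e x } :=
  ⟨fun c hc => by simp [Function.update_of_ne (show c ≠ e by omega), h.1 c hc], h.2⟩

theorem Keeps.refl (d : ℕ) (s : State) : Keeps d s s := ⟨fun _ _ => rfl, rfl⟩

theorem exists_copy (k src dst : ℕ) (h : src + k ≤ dst) : ∃ P, ∀ s, Runs P s (4 * k + 1)
    (fun s' => (∀ i < k, s'.nat (dst + i) = s.nat (src + i)) ∧ Keeps dst s s') := by
  induction k with
  | zero => exact ⟨.skip, fun s => Runs.skip ⟨by simp, .refl _ _⟩⟩
  | succ k ih =>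
    obtain ⟨P, hP⟩ := ih (by omega)
    refine ⟨.seq P (.setNat (.lit (dst + k)) (.mem (.lit (src + k)))), fun s => ?_⟩
    refine ((hP s).seq (T' := 4) (Q' := fun s' =>
      (∀ i < k + 1, s'.nat (dst + i) = s.nat (src + i)) ∧ Keeps dst s s')
      fun s' hs' => Runs.setNat ⟨fun i hi => ?_, hs'.2.update (by simp [NatExpr.eval])⟩).mono
      (by omega) fun _ h => h
    rcases Nat.lt_succ_iff_lt_or_eq.1 hi with hi | rfl
    · simp [NatExpr.eval, Function.update_of_ne (show dst + i ≠ dst + k by omega), hs'.1 i hi]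
    · simp [NatExpr.eval, hs'.2.1 (src + i) (by omega)]

/-! ## Primitive recursive functions are computable in primitive recursive time -/

/-- There are programs that compute the `k` functions `g i` of `n` variables; the variables are
in the cells `a, …, a + n - 1`, and the values are written to the cells from `d` on. -/
def CompilesVec {n k : ℕ} (g : Fin k → List.Vector ℕ n → ℕ) : Prop :=
  ∃ T : List.Vector ℕ n → ℕ, Primrec T ∧ ∀ a d, a + n ≤ d → ∃ P, ∀ s v,
    (∀ i : Fin n, s.nat (a + i) = v.get i) →
      Runs P s (T v) fun s' => (∀ i : Fin k, s'.nat (d + i) = g i v) ∧ Keeps d s s'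

/-- There are programs that compute a function of `n` variables. -/
def Compiles {n : ℕ} (f : List.Vector ℕ n → ℕ) : Prop :=
  ∃ T : List.Vector ℕ n → ℕ, Primrec T ∧ ∀ a d, a + n ≤ d → ∃ P, ∀ s v,
    (∀ i : Fin n, s.nat (a + i) = v.get i) →
      Runs P s (T v) fun s' => s'.nat d = f v ∧ Keeps d s s'

theorem compilesVec {n k : ℕ} {g : Fin k → List.Vector ℕ n → ℕ} (h : ∀ i, Compiles (g i)) :
    CompilesVec g := by
  induction k with
  | zero => exact ⟨fun _ => 1, .const 1, fun a d _ => ⟨.skip, fun s v _ =>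
      Runs.skip ⟨fun i => i.elim0, .refl _ _⟩⟩⟩
  | succ k ih =>
    obtain ⟨T, hT, hP⟩ := ih (g := fun i => g i.castSucc) fun i => h _
    obtain ⟨T', hT', hP'⟩ := h (Fin.last k)
    refine ⟨fun v => T v + T' v, Primrec.nat_add.comp hT hT', fun a d had => ?_⟩
    obtain ⟨P, hP⟩ := hP a d had
    obtain ⟨P', hP'⟩ := hP' a (d + k) (by omega)
    refine ⟨.seq P P', fun s v hv => (hP s v hv).seq fun s' hs' => ?_⟩
    refine (hP' s' v fun i => ?_).mono le_rfl fun s'' hs'' => ⟨fun i => ?_, ?_⟩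
    · rw [← hv i]
      exact hs'.2.1 _ (by omega)
    · refine Fin.lastCases ?_ (fun i => ?_) i
      · simpa using hs''.1
      · exact (hs''.2.1 _ (by simp)).trans (hs'.1 i)
    · exact hs'.2.trans hs''.2 (by omega)

/-- The values of the inner functions, written from the cell `d` on, are themselves the argument
block of `f`. Its result is then copied down to `d`. -/
theorem compiles_comp {m n : ℕ} {f : List.Vector ℕ m → ℕ} {g : Fin m → List.Vector ℕ n → ℕ}
    (hf : Compiles f) (hg : ∀ i, Compiles (g i)) (hg' : ∀ i, Primrec (g i)) :
    Compiles fun v => f (List.Vector.ofFn fun i => g i v) := by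
  obtain ⟨T, hT, hP⟩ := compilesVec hg
  obtain ⟨T', hT', hP'⟩ := hf
  refine ⟨fun v => T v + (T' (List.Vector.ofFn fun i => g i v) + 4), Primrec.nat_add.comp hT
    (Primrec.nat_add.comp (hT'.comp (Primrec.vector_ofFn hg')) (.const 4)), fun a d had => ?_⟩
  obtain ⟨P, hP⟩ := hP a d had
  obtain ⟨P', hP'⟩ := hP' d (d + m) le_rfl
  refine ⟨.seq P (.seq P' (.setNat (.lit d) (.mem (.lit (d + m))))), fun s v hv =>
    (hP s v hv).seq fun s' hs' => Runs.seq (hP' s' _ fun i => by simpa using hs'.1 i)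
      fun s'' hs'' => Runs.setNat ⟨?_, ?_⟩⟩
  · simp [NatExpr.eval, hs''.1]
  · exact (hs'.2.trans hs''.2 (by omega)).update le_rfl

theorem sum_range_eq_rec (f : ℕ → ℕ) (n : ℕ) :
    ∑ i ∈ Finset.range n, f i = n.rec 0 fun y IH => IH + f y := by
  induction n with
  | zero => rfl
  | succ n ih => rw [Finset.sum_range_succ, ih]

theorem _root_.Primrec.sum_range {α : Type*} [Primcodable α] {b : α → ℕ} {f : α → ℕ → ℕ}
    (hb : Primrec b) (hf : Primrec₂ f) : Primrec fun a => ∑ i ∈ Finset.range (b a), f a i := by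
  refine (Primrec.nat_rec' (f := b) (g := fun _ => 0) (h := fun a p => p.2 + f a p.1) hb
    (.const 0) ?_).of_eq fun a => (sum_range_eq_rec _ _).symm
  exact Primrec.nat_add.comp (Primrec.snd.comp .snd) (hf.comp .fst (Primrec.fst.comp .snd))

/-- The counter is kept in the cell `d`, the current value in `d + 1` and a copy of the parameters
from `d + 2` on, so that these cells always form the argument block of `g`. The total time is a sum
over the passes; it is primitive recursive because the intermediate values `R y` are. -/
theorem compiles_prec {n : ℕ} {f : List.Vector ℕ n → ℕ} {g : List.Vector ℕ (n + 2) → ℕ}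
    (hf : Compiles f) (hg : Compiles g) (hf' : Primrec f) (hg' : Primrec g) :
    Compiles fun v : List.Vector ℕ (n + 1) =>
      v.head.rec (f v.tail) fun y IH => g (y ::ᵥ IH ::ᵥ v.tail) := by
  obtain ⟨T, hT, hP⟩ := hf
  obtain ⟨T', hT', hP'⟩ := hg
  set R : ℕ → List.Vector ℕ n → ℕ :=
    fun k t => k.rec (f t) fun y IH => g (y ::ᵥ IH ::ᵥ t) with hR
  have hRp : Primrec₂ R := by
    refine Primrec.nat_rec' (f := fun p : ℕ × List.Vector ℕ n => p.1) (g := fun p => f p.2)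
      (h := fun p q => g (q.1 ::ᵥ q.2 ::ᵥ p.2)) .fst (hf'.comp .snd) (hg'.comp ?_)
    exact Primrec.vector_cons.comp (Primrec.fst.comp .snd)
      (Primrec.vector_cons.comp (Primrec.snd.comp .snd) (Primrec.snd.comp .fst))
  refine ⟨fun v => (4 * n + 1) + (T v.tail + (4 + (3 +
    (∑ y ∈ Finset.range v.head, (7 + (T' (y ::ᵥ R y v.tail ::ᵥ v.tail) + (4 + 6))) + 7 + 4)))),
    ?_, fun a d had => ?_⟩
  · refine Primrec.nat_add.comp (.const _) (Primrec.nat_add.comp (hT.comp .vector_tail)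
      (Primrec.nat_add.comp (.const _) (Primrec.nat_add.comp (.const _)
      (Primrec.nat_add.comp (Primrec.nat_add.comp (Primrec.sum_range .vector_head ?_) (.const _))
      (.const _)))))
    refine Primrec.nat_add.comp (.const _) (Primrec.nat_add.comp (hT'.comp ?_) (.const _))
    have ht : Primrec fun p : List.Vector ℕ (n + 1) × ℕ => p.1.tail :=
      Primrec.vector_tail.comp .fst
    exact Primrec.vector_cons.comp .snd (Primrec.vector_cons.comp (hRp.comp .snd ht) ht)
  obtain ⟨C, hC⟩ := exists_copy n (a + 1) (d + 2) (by omega)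
  obtain ⟨P, hP⟩ := hP (a + 1) (d + n + 2) (by omega)
  obtain ⟨P', hP'⟩ := hP' d (d + n + 2) (by omega)
  refine ⟨.seq C (.seq P (.seq (.setNat (.lit (d + 1)) (.mem (.lit (d + n + 2))))
    (.seq (.setNat (.lit d) (.lit 0)) (.seq
      (.loop (.natLe (.add (.mem (.lit d)) (.lit 1)) (.mem (.lit a)))
        (.seq P' (.seq (.setNat (.lit (d + 1)) (.mem (.lit (d + n + 2))))
          (.setNat (.lit d) (.add (.mem (.lit d)) (.lit 1))))))
      (.setNat (.lit d) (.mem (.lit (d + 1)))))))), fun s v hv => ?_⟩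
  have hhead : s.nat a = v.head := by simpa using hv 0
  have htail : ∀ i : Fin n, s.nat (a + 1 + i) = v.tail.get i := fun i => by
    have := hv i.succ
    rw [List.Vector.get_tail]
    refine Eq.trans (congrArg s.nat ?_) this
    simp only [Fin.val_succ]
    omega
  refine (hC s).seq fun s1 h1 => ?_
  refine Runs.seq (hP s1 v.tail fun i => ?_) fun s2 h2 => ?_
  · rw [h1.2.1 _ (by omega), htail]
  refine Runs.seq (Runs.setNat (Q := fun s3 => s3.nat (d + 1) = f v.tail ∧
    (∀ i : Fin n, s3.nat (d + 2 + i) = v.tail.get i) ∧ Keeps d s s3) ⟨?_, fun i => ?_, ?_⟩)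
    fun s3 h3 => ?_
  · simp [NatExpr.eval, h2.1]
  · rw [← htail i, ← h1.1 i i.2, ← h2.2.1 (d + 2 + i) (by omega)]
    simp [NatExpr.eval, Function.update_of_ne (show d + 2 + (i : ℕ) ≠ d + 1 by omega)]
  · exact ((h1.2.mono (by omega)).trans h2.2 (by omega)).update (by simp [NatExpr.eval])
  refine Runs.seq (Runs.setNat (Q := fun s3 => s3.nat d = 0 ∧ s3.nat (d + 1) = f v.tail ∧
    (∀ i : Fin n, s3.nat (d + 2 + i) = v.tail.get i) ∧ Keeps d s s3) ⟨?_, ?_, fun i => ?_, ?_⟩)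
    fun s4 h4 => ?_
  · simp [NatExpr.eval]
  · simp [NatExpr.eval, h3.1]
  · rw [← h3.2.1 i]
    simp [NatExpr.eval, Function.update_of_ne (show d + 2 + (i : ℕ) ≠ d by omega)]
  · exact h3.2.2.update le_rfl
  refine Runs.seq (Q := fun s5 => s5.nat (d + 1) = R v.head v.tail ∧ Keeps d s s5)
    (T := (∑ y ∈ Finset.range v.head, (7 + (T' (y ::ᵥ R y v.tail ::ᵥ v.tail) + (4 + 6))) + 7))
    (T' := 4) ?_ fun s5 h5 => Runs.setNat ⟨?_, ?_⟩
  · refine (Runs.loop (I := fun k s4 => s4.nat d = k ∧ s4.nat (d + 1) = R k v.tail ∧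
      (∀ i : Fin n, s4.nat (d + 2 + i) = v.tail.get i) ∧ Keeps d s s4)
      (c := fun y => T' (y ::ᵥ R y v.tail ::ᵥ v.tail) + (4 + 6)) (N := v.head) h4
      (fun k hk s5 h5 => ⟨?_, ?_⟩) fun s5 h5 => ?_).mono ?_ fun s' h' => ⟨h'.2.1, h'.2.2.2⟩
    · simp only [Test.Holds, NatExpr.eval, h5.1, h5.2.2.2.1 a (by omega), hhead]
      omega
    · refine Runs.seq (hP' s5 (k ::ᵥ R k v.tail ::ᵥ v.tail) ?_) fun s6 h6 => ?_
      · refine Fin.cases ?_ (Fin.cases ?_ fun i => ?_)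
        · simp [h5.1]
        · exact h5.2.1
        · simp [← h5.2.2.1 i]
          congr 1
          omega
      refine Runs.seq (Runs.setNat (Q := fun s3 => s3.nat d = k ∧
        s3.nat (d + 1) = R (k + 1) v.tail ∧
        (∀ i : Fin n, s3.nat (d + 2 + i) = v.tail.get i) ∧ Keeps d s s3) ⟨?_, ?_, fun i => ?_, ?_⟩)
        fun s7 h7 => Runs.setNat ⟨?_, ?_, fun i => ?_, ?_⟩
      · simp [NatExpr.eval, ← h5.1, h6.2.1 d (by omega)]
      · simp [NatExpr.eval, h6.1, hR]
      · rw [← h5.2.2.1 i, ← h6.2.1 (d + 2 + i) (by omega)]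
        simp [NatExpr.eval, Function.update_of_ne (show d + 2 + (i : ℕ) ≠ d + 1 by omega)]
      · exact (h5.2.2.2.trans h6.2 (by omega)).update (by simp [NatExpr.eval])
      · simp [NatExpr.eval, h7.1]
      · simp [NatExpr.eval, h7.2.1]
      · rw [← h7.2.2.1 i]
        simp [NatExpr.eval, Function.update_of_ne (show d + 2 + (i : ℕ) ≠ d by omega)]
      · exact h7.2.2.2.update (by simp [NatExpr.eval])
    · simp only [Test.Holds, NatExpr.eval, h5.1, h5.2.2.2.1 a (by omega), hhead]
      omega
    · simp [Test.cost, NatExpr.cost]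
  · simp [NatExpr.eval, h5.1, hR]
  · exact h5.2.update (by simp [NatExpr.eval])

theorem compiles_of_primrec' {n : ℕ} {f : List.Vector ℕ n → ℕ} (hf : Nat.Primrec' f) :
    Compiles f := by
  induction hf with
  | zero => exact ⟨fun _ => 3, .const 3, fun a d _ => ⟨.setNat (.lit d) (.lit 0), fun s v _ =>
      Runs.setNat ⟨by simp [NatExpr.eval], (Keeps.refl _ _).update le_rfl⟩⟩⟩
  | succ =>
    refine ⟨fun _ => 6, .const 6, fun a d _ => ⟨.setNat (.lit d) (.add (.mem (.lit a)) (.lit 1)),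
      fun s v hv => Runs.setNat ⟨?_, (Keeps.refl _ _).update le_rfl⟩⟩⟩
    have := hv 0
    simp_all [NatExpr.eval]
  | get i =>
    refine ⟨fun _ => 4, .const 4, fun a d _ => ⟨.setNat (.lit d) (.mem (.lit (a + i))),
      fun s v hv => Runs.setNat ⟨?_, (Keeps.refl _ _).update le_rfl⟩⟩⟩
    simp [NatExpr.eval, hv i]
  | comp g hf hg ihf ihg => exact compiles_comp ihf ihg fun i => (hg i).to_prim
  | prec hf hg ihf ihg => exact compiles_prec ihf ihg hf.to_prim hg.to_prim

variable {α β : Type*} [Primcodable α] [Primcodable β]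

/-- The function is precomposed with decoding to make it a function of numbers. The default value
`0` for numbers that are not codes is never met, since the input cell contains a code. -/
theorem exists_prog_of_primrec {f : α → ℕ} (hf : Primrec f) : ∃ T : α → ℕ, Primrec T ∧
    ∀ a d, a < d → ∃ P, ∀ s x, s.nat a = Encodable.encode x →
      Runs P s (T x) fun s' => s'.nat d = f x ∧ Keeps d s s' := by
  obtain ⟨T, hT, hP⟩ := compiles_of_primrec' (n := 1) (Nat.Primrec'.of_prim
    (f := fun v : List.Vector ℕ 1 => ((Encodable.decode (α := α) v.head).map f).getD 0)
    (Primrec.option_getD.comp (Primrec.option_map (Primrec.decode.comp .vector_head)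
      (hf.comp .snd)) (.const 0)))
  refine ⟨fun x => T (Encodable.encode x ::ᵥ .nil), hT.comp (Primrec.vector_cons.comp .encode
    (.const _)), fun a d had => ?_⟩
  obtain ⟨P, hP⟩ := hP a d had
  refine ⟨P, fun s x hx => (hP s (Encodable.encode x ::ᵥ .nil) fun i => ?_).mono le_rfl
    fun s' h => ?_⟩
  · obtain rfl : i = 0 := Subsingleton.elim _ _
    simpa using hx
  · simpa using h

theorem exists_prog_pair : ∃ T : ℕ → ℕ → ℕ, Primrec₂ T ∧
    ∀ a d, a + 2 ≤ d → ∃ P, ∀ s x y, s.nat a = x → s.nat (a + 1) = y →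
      Runs P s (T x y) fun s' => s'.nat d = Nat.pair x y ∧ Keeps d s s' := by
  obtain ⟨T, hT, hP⟩ := compiles_of_primrec' Nat.Primrec'.natPair
  refine ⟨fun x y => T (x ::ᵥ y ::ᵥ .nil), hT.comp (Primrec.vector_cons.comp .fst
    (Primrec.vector_cons.comp .snd (.const _))), fun a d had => ?_⟩
  obtain ⟨P, hP⟩ := hP a d had
  refine ⟨P, fun s x y hx hy => (hP s (x ::ᵥ y ::ᵥ .nil) fun i => ?_).mono le_rfl
    fun s' h => ?_⟩
  · refine Fin.cases ?_ (fun i => ?_) i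
    · simpa using hx
    · obtain rfl : i = 0 := Subsingleton.elim _ _
      exact hy
  · simpa using h

end RealRAM

/-! ## Bounded formulas with linear inequalities are decidable in primitive recursive time -/

namespace RealRAM

variable {α β : Type*} [Primcodable α] [Primcodable β]

/-- The real number `p + q * x + r * y`. -/
def lin (x y : ℝ) (t : ℕ × ℕ × ℕ) : ℝ := t.1 + t.2.1 * x + t.2.2 * y

/-! ### Evaluation of linear forms in the two real inputs. -/

/-- Adds the real number `e` to the real cell `r`, as often as the cell `c` says. -/
def addTimes (e : RealExpr) (r c : ℕ) : Prog :=
  .loop (.natLe (.lit 1) (.mem (.lit c)))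
    (.seq (.setReal (.lit r) (.add (.mem (.lit r)) e))
      (.setNat (.lit c) (.sub (.mem (.lit c)) (.lit 1))))

/-- The cells for natural numbers below `d` and all real cells but `r` are unchanged. -/
def KeepsBut (d r : ℕ) (s s' : State) : Prop :=
  (∀ c < d, s'.nat c = s.nat c) ∧ ∀ c ≠ r, s'.real c = s.real c

theorem runs_addTimes {e : RealExpr} {r d : ℕ} {s : State} {x : ℝ}
    (he : ∀ s', KeepsBut d r s s' → e.eval s' = x) :
    Runs (addTimes e r d) s (s.nat d * (e.cost + 15) + 4)
      fun s' => s'.real r = s.real r + s.nat d * x ∧ KeepsBut d r s s' := by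
  refine (Runs.loop_const (N := s.nat d) (c := e.cost + 11) (I := fun k s' =>
    s'.nat d = s.nat d - k ∧ s'.real r = s.real r + k * x ∧ KeepsBut d r s s')
    ⟨by simp, by simp, fun _ _ => rfl, fun _ _ => rfl⟩ (fun k hk s1 h1 => ⟨?_, ?_⟩)
    fun s1 h1 => ?_).mono ?_ fun s' h => h.2
  · simp only [Test.Holds, NatExpr.eval, h1.1]
    omega
  · refine (Runs.seq (Runs.setReal (Q := fun s' => s'.nat d = s.nat d - k ∧
      s'.real r = s.real r + (k + 1 : ℕ) * x ∧ KeepsBut d r s s') ⟨h1.1, ?_, h1.2.2.1, ?_⟩)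
      fun s2 h2 => Runs.setNat ⟨?_, h2.2.1, ?_, h2.2.2.2⟩).mono ?_ fun _ h => h
    · simp only [NatExpr.eval, Function.update_self, RealExpr.eval, h1.2.1, he _ h1.2.2]
      push_cast
      ring
    · intro c hc
      simp [NatExpr.eval, Function.update_of_ne hc, h1.2.2.2 c hc]
    · simp [NatExpr.cost, RealExpr.cost]
      omega
    · simp [NatExpr.eval, h2.1]
      omega
    · intro c hc
      simp [NatExpr.eval, Function.update_of_ne hc.ne, h2.2.2.1 c hc]
  · simp only [Test.Holds, NatExpr.eval, h1.1]
    omega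
  · simp [Test.cost, NatExpr.cost]
    apply le_of_eq
    ring

omit [Primcodable α] in
theorem runs_compute_addTimes {f : α → ℕ} {P : Prog} {T : α → ℕ} {d r : ℕ} {e : RealExpr}
    {s s0 : State} {x : α} {y z : ℝ} (hr : s0.real r = y)
    (hs : KeepsBut d r s s0)
    (hP : Runs P s0 (T x) fun s' => s'.nat d = f x ∧ Keeps d s0 s')
    (he : ∀ s', KeepsBut d r s s' → e.eval s' = z) :
    Runs (.seq P (addTimes e r d)) s0 (T x + (f x * (e.cost + 15) + 4)) fun s' =>
      s'.real r = y + f x * z ∧ KeepsBut d r s s' := by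
  refine hP.seq fun s1 h1 => ?_
  have h2 : KeepsBut d r s s1 :=
    ⟨fun c hc => (h1.2.1 c hc).trans (hs.1 c hc), fun c hc => by rw [h1.2.2, hs.2 c hc]⟩
  have h3 : ∀ s', KeepsBut d r s1 s' → KeepsBut d r s s' := fun s' hs' =>
    ⟨fun c hc => (hs'.1 c hc).trans (h2.1 c hc), fun c hc => (hs'.2 c hc).trans (h2.2 c hc)⟩
  rw [← h1.1]
  refine (runs_addTimes fun s' hs' => he s' (h3 s' hs')).mono le_rfl fun s' h => ⟨?_, h3 _ h.2⟩
  rw [h.1, h1.2.2, hr]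

/-- Without multiplication, `q * x` is obtained by `q` additions. This is affordable, as the
coefficients, being primitive recursive in the argument, may enter the time bound. -/
theorem exists_prog_lin {f : α → ℕ × ℕ × ℕ} (hf : Primrec f) : ∃ T : α → ℕ, Primrec T ∧
    ∀ a d r, a < d → 2 ≤ r → ∃ P, ∀ s x, s.nat a = Encodable.encode x → Runs P s (T x) fun s' =>
      s'.real r = lin (s.real 0) (s.real 1) (f x) ∧ KeepsBut d r s s' := by
  have hf1 : Primrec fun x => (f x).1 := Primrec.fst.comp hf
  have hf2 : Primrec fun x => (f x).2.1 := Primrec.fst.comp (Primrec.snd.comp hf)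
  have hf3 : Primrec fun x => (f x).2.2 := Primrec.snd.comp (Primrec.snd.comp hf)
  obtain ⟨T1, hT1, h1⟩ := exists_prog_of_primrec hf1
  obtain ⟨T2, hT2, h2⟩ := exists_prog_of_primrec hf2
  obtain ⟨T3, hT3, h3⟩ := exists_prog_of_primrec hf3
  refine ⟨fun x => 3 + ((T1 x + ((f x).1 * 16 + 4)) + ((T2 x + ((f x).2.1 * 17 + 4)) +
    (T3 x + ((f x).2.2 * 17 + 4)))), ?_, fun a d r had hr => ?_⟩
  · have key : ∀ {T g : α → ℕ} (c : ℕ), Primrec T → Primrec g →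
        Primrec fun x => T x + (g x * c + 4) := fun c hT hg =>
      Primrec.nat_add.comp hT (Primrec.nat_add.comp (Primrec.nat_mul.comp hg (.const _)) (.const _))
    exact Primrec.nat_add.comp (.const _) (Primrec.nat_add.comp (key _ hT1 hf1)
      (Primrec.nat_add.comp (key _ hT2 hf2) (key _ hT3 hf3)))
  obtain ⟨P1, h1⟩ := h1 a d had
  obtain ⟨P2, h2⟩ := h2 a d had
  obtain ⟨P3, h3⟩ := h3 a d had
  refine ⟨.seq (.setReal (.lit r) (.lit 0)) (.seq (.seq P1 (addTimes (.lit 1) r d))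
    (.seq (.seq P2 (addTimes (.mem (.lit 0)) r d)) (.seq P3 (addTimes (.mem (.lit 1)) r d)))),
    fun s x hx => ?_⟩
  refine (Runs.setReal (Q := fun s' => s'.real r = 0 ∧ KeepsBut d r s s') ⟨?_, ?_, ?_⟩).seq
    fun s1 hs1 => ?_
  · simp [NatExpr.eval, RealExpr.eval]
  · exact fun _ _ => rfl
  · intro c hc
    simp [NatExpr.eval, Function.update_of_ne hc]
  have henc : ∀ {s'}, KeepsBut d r s s' → s'.nat a = Encodable.encode x := fun h =>
    (h.1 a had).trans hx
  refine Runs.seq (runs_compute_addTimes (z := 1) (f := fun x => (f x).1) (T := T1) hs1.1 hs1.2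
    (h1 _ _ (henc hs1.2)) fun s' _ => by simp [RealExpr.eval]) fun s2 hs2 => ?_
  refine Runs.seq (runs_compute_addTimes (z := s.real 0) (f := fun x => (f x).2.1) (T := T2)
    hs2.1 hs2.2 (h2 _ _ (henc hs2.2)) fun s' hs' => by
      simp [RealExpr.eval, NatExpr.eval, hs'.2 0 (by omega)]) fun s3 hs3 => ?_
  refine Runs.mono (runs_compute_addTimes (z := s.real 1) (f := fun x => (f x).2.2) (T := T3)
    hs3.1 hs3.2 (h3 _ _ (henc hs3.2)) fun s' hs' => by
      simp [RealExpr.eval, NatExpr.eval, hs'.2 1 (by omega)]) le_rfl fun s4 hs4 => ⟨?_, hs4.2⟩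
  rw [hs4.1]
  simp [lin]

/-! ### Closure of decidable formulas under connectives and bounded quantifiers. -/

/-- The cells for natural numbers below `d` and the first two real cells are unchanged. -/
def KeepsInput (d : ℕ) (s s' : State) : Prop :=
  (∀ c < d, s'.nat c = s.nat c) ∧ ∀ c < 2, s'.real c = s.real c

theorem Keeps.keepsInput {d : ℕ} {s s' : State} (h : Keeps d s s') : KeepsInput d s s' :=
  ⟨h.1, fun _ _ => by rw [h.2]⟩

theorem KeepsInput.trans {d e : ℕ} {s s' s'' : State} (h : KeepsInput d s s')
    (h' : KeepsInput e s' s'') (hde : d ≤ e) : KeepsInput d s s'' :=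
  ⟨fun c hc => (h'.1 c (hc.trans_le hde)).trans (h.1 c hc),
    fun c hc => (h'.2 c hc).trans (h.2 c hc)⟩

theorem KeepsInput.update {d e x : ℕ} {s s' : State} (h : KeepsInput d s s') (hde : d ≤ e) :
    KeepsInput d s { s' with nat := Function.update s'.nat e x } :=
  ⟨fun c hc => by simp [Function.update_of_ne (show c ≠ e by omega), h.1 c hc], h.2⟩

theorem KeepsInput.refl (d : ℕ) (s : State) : KeepsInput d s s := ⟨fun _ _ => rfl, fun _ _ => rfl⟩

open Classical in
/-- There are programs that decide `φ x y a` in a time which is a primitive recursive function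
of `a`, when the first two real cells contain `x` and `y`. -/
def RealDec (φ : ℝ → ℝ → α → Prop) : Prop :=
  ∃ T : α → ℕ, Primrec T ∧ ∀ d, ∃ P, ∀ s a, s.nat d = Encodable.encode a →
    Runs P s (T a) fun s' => s'.nat (d + 1) = (if φ (s.real 0) (s.real 1) a then 1 else 0) ∧
      KeepsInput (d + 1) s s'

theorem RealDec.of_eq {φ ψ : ℝ → ℝ → α → Prop} (h : RealDec φ) (H : ∀ x y a, φ x y a ↔ ψ x y a) :
    RealDec ψ := by
  obtain rfl : φ = ψ := by
    funext x y a
    exact propext (H x y a)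
  exact h

theorem RealDec.le {f g : α → ℕ × ℕ × ℕ} (hf : Primrec f) (hg : Primrec g) :
    RealDec fun x y a => lin x y (f a) ≤ lin x y (g a) := by
  classical
  obtain ⟨T, hT, hP⟩ := exists_prog_lin hf
  obtain ⟨T', hT', hP'⟩ := exists_prog_lin hg
  refine ⟨fun a => T a + (T' a + (5 + 3)), Primrec.nat_add.comp hT (Primrec.nat_add.comp hT'
    (.const _)), fun d => ?_⟩
  obtain ⟨P, hP⟩ := hP d (d + 1) 2 (by omega) le_rfl
  obtain ⟨P', hP'⟩ := hP' d (d + 1) 3 (by omega) (by omega)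
  refine ⟨.seq P (.seq P' (.ite (.realLe (.mem (.lit 2)) (.mem (.lit 3)))
    (.setNat (.lit (d + 1)) (.lit 1)) (.setNat (.lit (d + 1)) (.lit 0)))), fun s a ha => ?_⟩
  refine (hP s a ha).seq fun s1 h1 => Runs.seq (hP' s1 a ((h1.2.1 d (by omega)).trans ha))
    fun s2 h2 => ?_
  have e0 := h1.2.2 0 (by omega)
  have e1 := h1.2.2 1 (by omega)
  have e2 := h2.2.2 2 (by omega)
  rw [e0, e1] at h2
  rw [h1.1] at e2
  have hk : KeepsInput (d + 1) s s2 := ⟨fun c hc => (h2.2.1 c hc).trans (h1.2.1 c hc),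
    fun c hc => (h2.2.2 c (by omega)).trans (h1.2.2 c (by omega))⟩
  refine Runs.ite (fun hb => Runs.setNat ⟨?_, hk.update le_rfl⟩)
    fun hb => Runs.setNat ⟨?_, hk.update le_rfl⟩
  all_goals
    simp only [Test.Holds, RealExpr.eval, NatExpr.eval, e2, h2.1] at hb
    simp [NatExpr.eval, hb]

theorem RealDec.not {φ : ℝ → ℝ → α → Prop} (h : RealDec φ) : RealDec fun x y a => ¬ φ x y a := by
  classical
  obtain ⟨T, hT, hP⟩ := h
  refine ⟨fun a => T a + 6, Primrec.nat_add.comp hT (.const _), fun d => ?_⟩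
  obtain ⟨P, hP⟩ := hP d
  refine ⟨.seq P (.setNat (.lit (d + 1)) (.sub (.lit 1) (.mem (.lit (d + 1))))), fun s a ha =>
    (hP s a ha).seq fun s1 h1 => Runs.setNat ⟨?_, h1.2.update le_rfl⟩⟩
  simp only [NatExpr.eval, Function.update_self, h1.1]
  split_ifs <;> rfl

theorem RealDec.and {φ ψ : ℝ → ℝ → α → Prop} (h : RealDec φ) (h' : RealDec ψ) :
    RealDec fun x y a => φ x y a ∧ ψ x y a := by
  classical
  obtain ⟨T, hT, hP⟩ := h
  obtain ⟨T', hT', hP'⟩ := h'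
  refine ⟨fun a => T a + (4 + (T' a + (9 + 3))), Primrec.nat_add.comp hT (Primrec.nat_add.comp
    (.const _) (Primrec.nat_add.comp hT' (.const _))), fun d => ?_⟩
  obtain ⟨P, hP⟩ := hP d
  obtain ⟨P', hP'⟩ := hP' (d + 2)
  refine ⟨.seq P (.seq (.setNat (.lit (d + 2)) (.mem (.lit d))) (.seq P'
    (.ite (.and (.natLe (.lit 1) (.mem (.lit (d + 1)))) (.natLe (.lit 1) (.mem (.lit (d + 3)))))
    (.setNat (.lit (d + 1)) (.lit 1)) (.setNat (.lit (d + 1)) (.lit 0))))), fun s a ha => ?_⟩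
  refine (hP s a ha).seq fun s1 h1 => ?_
  refine Runs.seq (Runs.setNat (Q := fun s2 => s2.nat (d + 2) = Encodable.encode a ∧
    s2.nat (d + 1) = s1.nat (d + 1) ∧ KeepsInput (d + 1) s s2) ⟨?_, ?_, ?_⟩) fun s2 h2 => ?_
  · simp [NatExpr.eval, h1.2.1 d (by omega), ha]
  · simp [NatExpr.eval]
  · exact h1.2.update (by simp [NatExpr.eval])
  refine Runs.seq (hP' s2 a h2.1) fun s3 h3 => ?_
  have e1 := h3.2.1 (d + 1) (by omega)
  rw [h2.2.1, h1.1] at e1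
  have e2 := h3.1
  rw [h2.2.2.2 0 (by omega), h2.2.2.2 1 (by omega)] at e2
  have hk : KeepsInput (d + 1) s s3 := h2.2.2.trans h3.2 (by omega)
  refine Runs.ite (fun hb => Runs.setNat ⟨?_, hk.update le_rfl⟩)
    fun hb => Runs.setNat ⟨?_, hk.update le_rfl⟩
  all_goals
    simp only [Test.Holds, NatExpr.eval, e1, e2] at hb
    simp only [NatExpr.eval, Function.update_self]
    split_ifs at hb ⊢ <;> simp_all

theorem RealDec.or {φ ψ : ℝ → ℝ → α → Prop} (h : RealDec φ) (h' : RealDec ψ) :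
    RealDec fun x y a => φ x y a ∨ ψ x y a :=
  (h.not.and h'.not).not.of_eq fun x y a => by tauto

theorem RealDec.imp {φ ψ : ℝ → ℝ → α → Prop} (h : RealDec φ) (h' : RealDec ψ) :
    RealDec fun x y a => φ x y a → ψ x y a :=
  (h.and h'.not).not.of_eq fun x y a => by tauto

theorem RealDec.comp {φ : ℝ → ℝ → α → Prop} (h : RealDec φ) {f : β → α} (hf : Primrec f) :
    RealDec fun x y b => φ x y (f b) := by
  classical
  obtain ⟨T, hT, hP⟩ := h
  obtain ⟨T', hT', hP'⟩ := exists_prog_of_primrec (Primrec.encode.comp hf)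
  refine ⟨fun b => T' b + (T (f b) + 4), Primrec.nat_add.comp hT' (Primrec.nat_add.comp
    (hT.comp hf) (.const _)), fun d => ?_⟩
  obtain ⟨P, hP⟩ := hP (d + 2)
  obtain ⟨P', hP'⟩ := hP' d (d + 2) (by omega)
  refine ⟨.seq P' (.seq P (.setNat (.lit (d + 1)) (.mem (.lit (d + 3))))), fun s b hb =>
    (hP' s b hb).seq fun s1 h1 => Runs.seq (hP s1 (f b) h1.1) fun s2 h2 =>
    Runs.setNat ⟨?_, (KeepsInput.trans ⟨fun c hc => h1.2.1 c (by omega), fun c hc => by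
      rw [h1.2.2]⟩ h2.2 (by omega)).update le_rfl⟩⟩
  simp only [NatExpr.eval, Function.update_self, h2.1, h1.2.2]

/-- All candidates are tried in a loop without early exit, and the time is a sum over them. The
cells are: `d + 1` for the answer, `d + 2` for the bound, `d + 3` for the counter, `d + 4` and `d +
5` for the components of the pair, `d + 6` for its code and `d + 7` for the answer at the current
candidate. -/
theorem RealDec.ex {φ : ℝ → ℝ → α × ℕ → Prop} (h : RealDec φ) {f : α → ℕ} (hf : Primrec f) :
    RealDec fun x y a => ∃ k < f a, φ x y (a, k) := by
  classical
  obtain ⟨T, hT, hP⟩ := h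
  obtain ⟨T1, hT1, hP1⟩ := exists_prog_of_primrec hf
  obtain ⟨T2, hT2, hP2⟩ := exists_prog_pair
  refine ⟨fun a => 3 + (T1 a + (3 + (∑ k ∈ Finset.range (f a), (7 + (4 + (4 +
    (T2 (Encodable.encode a) k + (T (a, k) + ((4 + 3) + 6)))))) + 7))), ?_, fun d => ?_⟩
  · refine Primrec.nat_add.comp (.const _) (Primrec.nat_add.comp hT1 (Primrec.nat_add.comp
      (.const _) (Primrec.nat_add.comp (Primrec.sum_range hf ?_) (.const _))))
    exact Primrec.nat_add.comp (.const _) (Primrec.nat_add.comp (.const _) (Primrec.nat_add.comp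
      (.const _) (Primrec.nat_add.comp (hT2.comp (Primrec.encode.comp .fst) .snd)
      (Primrec.nat_add.comp hT (.const _)))))
  obtain ⟨P, hP⟩ := hP (d + 6)
  obtain ⟨P1, hP1⟩ := hP1 d (d + 2) (by omega)
  obtain ⟨P2, hP2⟩ := hP2 (d + 4) (d + 6) (by omega)
  refine ⟨.seq (.setNat (.lit (d + 1)) (.lit 0)) (.seq P1 (.seq (.setNat (.lit (d + 3)) (.lit 0))
    (.loop (.natLe (.add (.mem (.lit (d + 3))) (.lit 1)) (.mem (.lit (d + 2))))
      (.seq (.setNat (.lit (d + 4)) (.mem (.lit d)))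
      (.seq (.setNat (.lit (d + 5)) (.mem (.lit (d + 3))))
      (.seq P2 (.seq P (.seq
        (.ite (.natLe (.lit 1) (.mem (.lit (d + 7)))) (.setNat (.lit (d + 1)) (.lit 1)) .skip)
        (.setNat (.lit (d + 3)) (.add (.mem (.lit (d + 3))) (.lit 1))))))))))),
    fun s a ha => ?_⟩
  refine (Runs.setNat (Q := fun s' => s'.nat (d + 1) = 0 ∧ KeepsInput (d + 1) s s')
    ⟨by simp [NatExpr.eval], (KeepsInput.refl _ _).update le_rfl⟩).seq fun s1 h1 => ?_
  refine Runs.seq (hP1 s1 a ((h1.2.1 d (by omega)).trans ha)) fun s2 h2 => ?_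
  refine Runs.seq (Runs.setNat (Q := fun s' => s'.nat (d + 3) = 0 ∧ s'.nat (d + 2) = f a ∧
    s'.nat (d + 1) = 0 ∧ KeepsInput (d + 1) s s') ⟨?_, ?_, ?_, ?_⟩) fun s3 h3 => ?_
  · simp [NatExpr.eval]
  · simp [NatExpr.eval, h2.1]
  · simp [NatExpr.eval, h2.2.1, h1.1]
  · exact (h1.2.trans h2.2.keepsInput (by omega)).update (by simp [NatExpr.eval])
  set D : ℕ → ℕ := fun k => if ∃ i < k, φ (s.real 0) (s.real 1) (a, i) then 1 else 0 with hD
  refine (Runs.loop (N := f a) (c := fun k => 4 + (4 +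
    (T2 (Encodable.encode a) k + (T (a, k) + ((4 + 3) + 6))))) (I := fun k s' =>
      s'.nat (d + 3) = k ∧ s'.nat (d + 2) = f a ∧ s'.nat (d + 1) = D k ∧ KeepsInput (d + 1) s s')
    ⟨h3.1, h3.2.1, by simp [hD, h3.2.2.1], h3.2.2.2⟩ (fun k hk s4 h4 => ⟨?_, ?_⟩)
    fun s4 h4 => ?_).mono ?_ fun s' h =>
      ⟨h.2.2.1.trans (by simp only [hD]; congr), h.2.2.2⟩
  · simp only [Test.Holds, NatExpr.eval, h4.1, h4.2.1]
    omega
  · refine Runs.seq (Runs.setNat (Q := fun s' => s'.nat (d + 4) = Encodable.encode a ∧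
      s'.nat (d + 3) = k ∧ s'.nat (d + 2) = f a ∧ s'.nat (d + 1) = D k ∧
      KeepsInput (d + 1) s s') ⟨?_, ?_, ?_, ?_, ?_⟩) fun s5 h5 => ?_
    · simp [NatExpr.eval, h4.2.2.2.1 d (by omega), ha]
    · simp [NatExpr.eval, h4.1]
    · simp [NatExpr.eval, h4.2.1]
    · simp [NatExpr.eval, h4.2.2.1]
    · exact h4.2.2.2.update (by simp [NatExpr.eval])
    refine Runs.seq (Runs.setNat (Q := fun s' => s'.nat (d + 5) = k ∧
      s'.nat (d + 4) = Encodable.encode a ∧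
      s'.nat (d + 3) = k ∧ s'.nat (d + 2) = f a ∧ s'.nat (d + 1) = D k ∧
      KeepsInput (d + 1) s s') ⟨?_, ?_, ?_, ?_, ?_, ?_⟩) fun s6 h6 => ?_
    · simp [NatExpr.eval, h5.2.1]
    · simp [NatExpr.eval, h5.1]
    · simp [NatExpr.eval, h5.2.1]
    · simp [NatExpr.eval, h5.2.2.1]
    · simp [NatExpr.eval, h5.2.2.2.1]
    · exact h5.2.2.2.2.update (by simp [NatExpr.eval])
    refine Runs.seq (hP2 s6 _ k h6.2.1 h6.1) fun s7 h7 => ?_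
    refine Runs.seq (hP s7 (a, k) (by simpa using h7.1)) fun s8 h8 => ?_
    have hk7 : KeepsInput (d + 4) s6 s8 :=
      KeepsInput.trans ⟨fun c hc => h7.2.1 c (by omega), fun c hc => by rw [h7.2.2]⟩ h8.2
        (by omega)
    have hk8 : KeepsInput (d + 1) s s8 := h6.2.2.2.2.2.trans hk7 (by omega)
    have e8 := h8.1
    rw [h7.2.2, h6.2.2.2.2.2.2 0 (by omega), h6.2.2.2.2.2.2 1 (by omega)] at e8
    have eD : ∀ b : Prop, (b ↔ φ (s.real 0) (s.real 1) (a, k)) →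
        (if b then 1 else D k) = D (k + 1) := by
      intro b hb
      simp only [hD, Nat.lt_succ_iff_lt_or_eq]
      by_cases hb' : b
      · have : ∃ i, (i < k ∨ i = k) ∧ φ (s.real 0) (s.real 1) (a, i) := ⟨k, .inr rfl, hb.1 hb'⟩
        simp [hb', this]
      · have : (∃ i, (i < k ∨ i = k) ∧ φ (s.real 0) (s.real 1) (a, i)) ↔
            ∃ i < k, φ (s.real 0) (s.real 1) (a, i) := by
          constructor
          · rintro ⟨i, hi | rfl, hi'⟩
            · exact ⟨i, hi, hi'⟩
            · exact absurd (hb.2 hi') hb'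
          · rintro ⟨i, hi, hi'⟩
            exact ⟨i, .inl hi, hi'⟩
        simp [hb', this]
    refine Runs.seq (Runs.ite (T := 3) (Q := fun s' => s'.nat (d + 3) = k ∧ s'.nat (d + 2) = f a ∧
      s'.nat (d + 1) = D (k + 1) ∧ KeepsInput (d + 1) s s')
      (fun hb => Runs.setNat ⟨?_, ?_, ?_, hk8.update (by simp [NatExpr.eval])⟩)
      fun hb => (Runs.skip ⟨?_, ?_, ?_, hk8⟩).mono (by omega) fun _ h => h) fun s9 h9 =>
        Runs.setNat ⟨?_, ?_, ?_, ?_⟩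
    · simp [NatExpr.eval, hk7.1, h6]
    · simp [NatExpr.eval, hk7.1, h6]
    · rw [← eD _ Iff.rfl]
      simp only [Test.Holds, NatExpr.eval, e8] at hb ⊢
      split_ifs at hb ⊢ <;> simp_all
    · simp [NatExpr.eval, h9]
    · simp [NatExpr.eval, h9]
    · simp [NatExpr.eval, h9]
    · exact h9.2.2.2.update (by simp [NatExpr.eval])
    · simp [hk7.1, h6]
    · simp [hk7.1, h6]
    · rw [← eD _ Iff.rfl]
      simp only [Test.Holds, NatExpr.eval, e8] at hb ⊢
      split_ifs at hb ⊢ <;> simp_all [hk7.1 (d + 1) (by omega)]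
  · simp only [Test.Holds, NatExpr.eval, h4.1, h4.2.1]
    omega
  · simp [Test.cost, NatExpr.cost]

theorem RealDec.all {φ : ℝ → ℝ → α × ℕ → Prop} (h : RealDec φ) {f : α → ℕ} (hf : Primrec f) :
    RealDec fun x y a => ∀ k < f a, φ x y (a, k) :=
  (h.not.ex hf).not.of_eq fun x y a => by
    push Not
    rfl

end RealRAM

/-! ## A combinatorial description of tours -/

namespace GraphTour

variable {V W : Type*}

/-- A solution consists of the depths `a u v` of the peeks of the tour into the edge `uv` from `u`,
and upper bounds `r` for the distances of the vertices to the tour. Here `S` is the set of vertices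
visited by the tour, `L` the set of pairs at which a peek is allowed, and `X` the set of edges that
are covered anyway. -/
structure IsFeasible (adj : V → V → Prop) (A : Finset V) (S : V → Prop) (L X : V → V → Prop)
    (δ β : ℝ) (a : V → V → ℝ) (r : V → ℝ) : Prop where
  a_nonneg : ∀ u v, 0 ≤ a u v
  a_le_one : ∀ u v, a u v ≤ 1
  a_zero : ∀ u v, ¬ L u v → a u v = 0
  r_nonneg : ∀ u, 0 ≤ r u
  r_le : ∀ u ∈ A, r u ≤ δ
  witness : ∀ w ∈ A, S w ∨ (∃ v ∈ A, L v w ∧ 1 - a v w ≤ r w) ∨ ∃ x ∈ A, adj x w ∧ r x + 1 ≤ r w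
  edge : ∀ u ∈ A, ∀ v ∈ A, adj u v → X u v ∨ 1 + r u + r v - a u v - a v u ≤ 2 * δ
  cost : 2 * ∑ u ∈ A, ∑ v ∈ A, a u v ≤ β

def Feasible (adj : V → V → Prop) (A : Finset V) (S : V → Prop) (L X : V → V → Prop)
    (δ β : ℝ) : Prop := ∃ a r, IsFeasible adj A S L X δ β a r

/-- `w 0, …, w m` is a closed walk of `m` steps between vertices in `A`. -/
def IsClosedWalk (adj : V → V → Prop) (A : Finset V) (m : ℕ) (w : ℕ → V) : Prop :=
  (∀ i ≤ m, w i ∈ A) ∧ (∀ i < m, adj (w i) (w (i + 1))) ∧ w m = w 0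

def Visits (m : ℕ) (w : ℕ → V) (v : V) : Prop := ∃ i ≤ m, w i = v

def Traverses (m : ℕ) (w : ℕ → V) (u v : V) : Prop :=
  ∃ i < m, (w i = u ∧ w (i + 1) = v) ∨ (w i = v ∧ w (i + 1) = u)

/-- The edges from a visited vertex. -/
def Peek (adj : V → V → Prop) (A : Finset V) (m : ℕ) (w : ℕ → V) (u v : V) : Prop :=
  Visits m w u ∧ v ∈ A ∧ adj u v

def IsPair (u v p q : V) : Prop := (p = u ∧ q = v) ∨ (p = v ∧ q = u)

/-- There is a tour that visits a vertex. -/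
def VertexSol (adj : V → V → Prop) (A : Finset V) (δ K : ℝ) : Prop :=
  ∃ m w, IsClosedWalk adj A m w ∧
    Feasible adj A (Visits m w) (Peek adj A m w) (Traverses m w) δ (K - m)

/-- There is a tour that stays within an edge. The tour is described as if it consisted of a peek
into this edge from either side. -/
def EdgeSol (adj : V → V → Prop) (A : Finset V) (δ K : ℝ) : Prop :=
  ∃ u ∈ A, ∃ v ∈ A, adj u v ∧ Feasible adj A (fun _ => False) (IsPair u v) (IsPair u v) δ (K + 2)

def Sol (adj : V → V → Prop) (A : Finset V) (δ K : ℝ) : Prop :=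
  VertexSol adj A δ K ∨ EdgeSol adj A δ K

/-! ### Invariance under isomorphism -/

section transfer

variable {adj : V → V → Prop} {adj' : W → W → Prop} {A : Finset V} {B : Finset W} {ψ : V → W}
  {φ : W → V} {δ K β : ℝ}

theorem Feasible.transfer {S : V → Prop} {S' : W → Prop} {L X : V → V → Prop}
    {L' X' : W → W → Prop} (hψ : ∀ u ∈ A, ψ u ∈ B) (hφ : ∀ x ∈ B, φ x ∈ A)
    (hl : ∀ u ∈ A, φ (ψ u) = u) (hr : ∀ x ∈ B, ψ (φ x) = x)
    (hadj : ∀ u ∈ A, ∀ v ∈ A, (adj u v ↔ adj' (ψ u) (ψ v))) (hS : ∀ u ∈ A, S u → S' (ψ u))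
    (hL : ∀ u ∈ A, ∀ v ∈ A, L u v → L' (ψ u) (ψ v))
    (hX : ∀ u ∈ A, ∀ v ∈ A, X u v → X' (ψ u) (ψ v)) (h : Feasible adj A S L X δ β) :
    Feasible adj' B S' L' X' δ β := by
  classical
  obtain ⟨a, r, h⟩ := h
  refine ⟨fun x y => if x ∈ B ∧ y ∈ B then a (φ x) (φ y) else 0, fun x => r (φ x), ?_⟩
  constructor
  · intro u v
    split_ifs
    exacts [h.a_nonneg _ _, le_rfl]
  · intro u v
    split_ifs
    exacts [h.a_le_one _ _, zero_le_one]
  · intro u v huv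
    split_ifs with hB
    · refine h.a_zero _ _ fun hL' => huv ?_
      have := hL _ (hφ u hB.1) _ (hφ v hB.2) hL'
      rwa [hr u hB.1, hr v hB.2] at this
    · rfl
  · exact fun u => h.r_nonneg _
  · exact fun u hu => h.r_le _ (hφ u hu)
  · intro w hw
    rcases h.witness _ (hφ w hw) with h1 | ⟨v, hv, h1, h2⟩ | ⟨x, hx, h1, h2⟩
    · left
      have := hS _ (hφ w hw) h1
      rwa [hr w hw] at this
    · refine .inr (.inl ⟨ψ v, hψ v hv, ?_, ?_⟩)
      · have := hL _ hv _ (hφ w hw) h1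
        rwa [hr w hw] at this
      · simpa [hψ v hv, hw, hl v hv] using h2
    · refine .inr (.inr ⟨ψ x, hψ x hx, ?_, ?_⟩)
      · have := (hadj _ hx _ (hφ w hw)).1 h1
        rwa [hr w hw] at this
      · rwa [hl x hx]
  · intro u hu v hv huv
    have huv' : adj (φ u) (φ v) := (hadj _ (hφ u hu) _ (hφ v hv)).2 (by rwa [hr u hu, hr v hv])
    refine (h.edge _ (hφ u hu) _ (hφ v hv) huv').imp (fun h1 => ?_) fun h1 => ?_
    · have := hX _ (hφ u hu) _ (hφ v hv) h1
      rwa [hr u hu, hr v hv] at this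
    · simpa [hu, hv] using h1
  · refine le_trans (le_of_eq ?_) h.cost
    congr 1
    refine Finset.sum_nbij' φ ψ hφ hψ hr hl fun x hx => ?_
    refine Finset.sum_nbij' φ ψ hφ hψ hr hl fun y hy => ?_
    simp [hx, hy]

/-- This serves two purposes: exchanging two twins, and renumbering the vertices of the kernel. -/
theorem Sol.transfer (hψ : ∀ u ∈ A, ψ u ∈ B) (hφ : ∀ x ∈ B, φ x ∈ A)
    (hl : ∀ u ∈ A, φ (ψ u) = u) (hr : ∀ x ∈ B, ψ (φ x) = x)
    (hadj : ∀ u ∈ A, ∀ v ∈ A, (adj u v ↔ adj' (ψ u) (ψ v))) (h : Sol adj A δ K) :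
    Sol adj' B δ K := by
  rcases h with ⟨m, w, ⟨hw1, hw2, hw3⟩, h⟩ | ⟨u, hu, v, hv, huv, h⟩
  · refine .inl ⟨m, fun i => ψ (w i), ⟨fun i hi => hψ _ (hw1 i hi), fun i hi =>
      (hadj _ (hw1 i hi.le) _ (hw1 _ hi)).1 (hw2 i hi), congrArg ψ hw3⟩,
      h.transfer hψ hφ hl hr hadj ?_ ?_ ?_⟩
    · rintro u - ⟨i, hi, rfl⟩
      exact ⟨i, hi, rfl⟩
    · rintro u hu v hv ⟨⟨i, hi, rfl⟩, h2, h3⟩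
      exact ⟨⟨i, hi, rfl⟩, hψ _ hv, (hadj _ hu _ hv).1 h3⟩
    · rintro u - v - ⟨i, hi, ⟨rfl, rfl⟩ | ⟨rfl, rfl⟩⟩
      · exact ⟨i, hi, .inl ⟨rfl, rfl⟩⟩
      · exact ⟨i, hi, .inr ⟨rfl, rfl⟩⟩
  · refine .inr ⟨ψ u, hψ u hu, ψ v, hψ v hv, (hadj _ hu _ hv).1 huv,
      h.transfer hψ hφ hl hr hadj (fun _ _ h => h) ?_ ?_⟩ <;>
    · rintro p - q - (⟨rfl, rfl⟩ | ⟨rfl, rfl⟩)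
      exacts [.inl ⟨rfl, rfl⟩, .inr ⟨rfl, rfl⟩]

theorem sol_iff_of_bij (hψ : ∀ u ∈ A, ψ u ∈ B) (hφ : ∀ x ∈ B, φ x ∈ A)
    (hl : ∀ u ∈ A, φ (ψ u) = u) (hr : ∀ x ∈ B, ψ (φ x) = x)
    (hadj : ∀ u ∈ A, ∀ v ∈ A, (adj u v ↔ adj' (ψ u) (ψ v))) :
    Sol adj A δ K ↔ Sol adj' B δ K := by
  refine ⟨Sol.transfer hψ hφ hl hr hadj, Sol.transfer hφ hψ hr hl fun x hx y hy => ?_⟩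
  rw [hadj _ (hφ x hx) _ (hφ y hy), hr x hx, hr y hy]

end transfer

/-! ### Deletion of twins -/

section twins

variable [DecidableEq V] {adj : V → V → Prop} {A : Finset V} {S : V → Prop} {L L' X : V → V → Prop}
  {δ β K : ℝ} {a : V → V → ℝ} {r : V → ℝ} {h m : ℕ} {w : ℕ → V}

omit [DecidableEq V] in
theorem IsFeasible.sum_nonneg (hf : IsFeasible adj A S L X δ β a r) :
    0 ≤ ∑ u ∈ A, ∑ v ∈ A, a u v :=
  Finset.sum_nonneg fun u _ => Finset.sum_nonneg fun v _ => hf.a_nonneg u v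

omit [DecidableEq V] in
/-- The weight of a feasible solution bounds the number of deep peeks. -/
theorem IsFeasible.card_mul_le (hf : IsFeasible adj A S L X δ β a r) {T : Finset V} (hT : T ⊆ A)
    {η : ℝ} (hη : ∀ t ∈ T, ∃ v ∈ A, η ≤ a v t) : 2 * (T.card * η) ≤ β := by
  refine le_trans ?_ hf.cost
  rw [Finset.sum_comm]
  have h1 : ∑ t ∈ T, η ≤ ∑ t ∈ T, ∑ v ∈ A, a v t := Finset.sum_le_sum fun t ht => by
    obtain ⟨v, hv, h⟩ := hη t ht
    exact h.trans (Finset.single_le_sum (f := fun v => a v t) (fun v _ => hf.a_nonneg v t) hv)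
  have h2 : ∑ t ∈ T, ∑ v ∈ A, a v t ≤ ∑ t ∈ A, ∑ v ∈ A, a v t :=
    Finset.sum_le_sum_of_subset_of_nonneg hT fun t _ _ => Finset.sum_nonneg fun v _ =>
      hf.a_nonneg v t
  simp only [Finset.sum_const, nsmul_eq_mul] at h1
  linarith

theorem card_visits_le {T : Finset V} (hT : ∀ v ∈ T, Visits m w v) : T.card ≤ m + 1 := by
  refine (Finset.card_le_card (t := (Finset.range (m + 1)).image w) fun v hv => ?_).trans
    (Finset.card_image_le.trans (by simp))
  obtain ⟨i, hi, rfl⟩ := hT v hv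
  exact Finset.mem_image_of_mem _ (Finset.mem_range.2 (by omega))

/-- The peeks into `x` are dropped. A vertex reached through `x` can be reached through `y` instead,
because `y` has the neighbors of `x` and is no farther from the tour. No peek starts at `x`, so
nothing else depends on it. -/
theorem IsFeasible.erase (hf : IsFeasible adj A S L X δ β a r) {x y : V} (hy : y ∈ A) (hxy : x ≠ y)
    (htw : ∀ z ∈ A, (adj x z → adj y z)) (hL : ∀ z, ¬ L x z)
    (hL' : ∀ u v, v ≠ x → L u v → L' u v) (hr : r y ≤ r x) :
    Feasible adj (A.erase x) S L' X δ β := by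
  refine ⟨fun u v => if v = x then 0 else a u v, r, ?_⟩
  have hle : ∀ u v, (if v = x then 0 else a u v) ≤ a u v := fun u v => by
    split_ifs
    exacts [hf.a_nonneg u v, le_rfl]
  constructor
  · intro u v
    split_ifs
    exacts [le_rfl, hf.a_nonneg _ _]
  · exact fun u v => (hle u v).trans (hf.a_le_one u v)
  · intro u v huv
    split_ifs with hv
    · rfl
    · exact hf.a_zero _ _ fun h => huv (hL' _ _ hv h)
  · exact hf.r_nonneg
  · exact fun u hu => hf.r_le u (Finset.mem_of_mem_erase hu)
  · intro z hz
    have hzx := (Finset.mem_erase.1 hz).1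
    rcases hf.witness z (Finset.mem_of_mem_erase hz) with h1 | ⟨v, hv, h1, h2⟩ | ⟨v, hv, h1, h2⟩
    · exact .inl h1
    · refine .inr (.inl ⟨v, Finset.mem_erase.2 ⟨?_, hv⟩, hL' _ _ hzx h1, by simpa [hzx] using h2⟩)
      rintro rfl
      exact hL _ h1
    · by_cases hvx : v = x
      · subst hvx
        exact .inr (.inr ⟨y, Finset.mem_erase.2 ⟨hxy.symm, hy⟩, htw z (Finset.mem_of_mem_erase hz) h1, by linarith⟩)
      · exact .inr (.inr ⟨v, Finset.mem_erase.2 ⟨hvx, hv⟩, h1, h2⟩)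
  · intro u hu v hv huv
    obtain ⟨hux, hu⟩ := Finset.mem_erase.1 hu
    obtain ⟨hvx, hv⟩ := Finset.mem_erase.1 hv
    simpa [hux, hvx] using hf.edge u hu v hv huv
  · refine le_trans ?_ hf.cost
    have h1 : ∑ u ∈ A.erase x, ∑ v ∈ A.erase x, (if v = x then 0 else a u v) ≤
        ∑ u ∈ A, ∑ v ∈ A, a u v := by
      refine (Finset.sum_le_sum_of_subset_of_nonneg (Finset.erase_subset x A) fun u _ _ => ?_).trans
        (Finset.sum_le_sum fun u _ => (Finset.sum_le_sum_of_subset_of_nonneg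
          (Finset.erase_subset x A) fun v _ _ => ?_).trans (Finset.sum_le_sum fun v _ => hle u v))
      · refine Finset.sum_nonneg fun v _ => ?_
        split_ifs
        exacts [le_rfl, hf.a_nonneg _ _]
      · split_ifs
        exacts [le_rfl, hf.a_nonneg _ _]
    linarith

/-- The new vertex `x` inherits the value `r y` of its twin. As there is neither a visit of `y` nor
a peek at it, each condition at `x` is a copy of a condition at `y`, and the cost does not change.
-/
theorem IsFeasible.insert (hsymm : ∀ u v, adj u v → adj v u) (hirr : ∀ u, ¬ adj u u)
    {x y : V} (hf : IsFeasible adj (A.erase x) S L X δ β a r) (hx : x ∈ A) (hy : y ∈ A)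
    (hxy : x ≠ y) (htw : ∀ z ∈ A, (adj x z ↔ adj y z)) (hLx : ∀ z, ¬ L x z ∧ ¬ L z x)
    (hL' : ∀ u v, L u v → L' u v) (hL'x : ∀ u, L u y → L' u x) (hSy : ¬ S y)
    (hX : ∀ z, ¬ X y z ∧ ¬ X z y) (hay : ∀ z, a z y = 0 ∧ a y z = 0) :
    Feasible adj A S L' X δ β := by
  have hax : ∀ z, a z x = 0 ∧ a x z = 0 := fun z =>
    ⟨hf.a_zero _ _ (hLx z).2, hf.a_zero _ _ (hLx z).1⟩
  have hyA : y ∈ A.erase x := Finset.mem_erase.2 ⟨hxy.symm, hy⟩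
  refine ⟨a, Function.update r x (r y), hf.a_nonneg, hf.a_le_one, fun u v huv =>
    hf.a_zero u v fun h => huv (hL' _ _ h), fun u => ?_, fun u hu => ?_, fun z hz => ?_,
    fun u hu v hv huv => ?_, ?_⟩
  · by_cases hu : u = x
    · subst hu
      simpa using hf.r_nonneg y
    · simpa [hu] using hf.r_nonneg u
  · by_cases hux : u = x
    · subst hux
      simpa using hf.r_le y hyA
    · simpa [hux] using hf.r_le u (Finset.mem_erase.2 ⟨hux, hu⟩)
  · by_cases hzx : z = x
    · subst hzx
      rcases hf.witness y hyA with h1 | ⟨v, hv, h1, h2⟩ | ⟨v, hv, h1, h2⟩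
      · exact absurd h1 hSy
      · refine .inr (.inl ⟨v, Finset.mem_of_mem_erase hv, hL'x _ h1, ?_⟩)
        rw [(hay v).1] at h2
        simpa [(hax v).1] using h2
      · have hvA := Finset.mem_of_mem_erase hv
        refine .inr (.inr ⟨v, hvA, hsymm _ _ ((htw v hvA).2 (hsymm _ _ h1)), ?_⟩)
        simpa [(Finset.mem_erase.1 hv).1] using h2
    · rcases hf.witness z (Finset.mem_erase.2 ⟨hzx, hz⟩) with h1 | ⟨v, hv, h1, h2⟩ | ⟨v, hv, h1, h2⟩
      · exact .inl h1
      · exact .inr (.inl ⟨v, Finset.mem_of_mem_erase hv, hL' _ _ h1, by simpa [hzx] using h2⟩)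
      · refine .inr (.inr ⟨v, Finset.mem_of_mem_erase hv, h1, ?_⟩)
        simpa [hzx, (Finset.mem_erase.1 hv).1] using h2
  · have key : ∀ v ∈ A, adj x v → 1 + r y + Function.update r x (r y) v - a x v - a v x ≤ 2 * δ := by
      intro v hv hxv
      have hvx : v ≠ x := fun h => hirr x (h ▸ hxv)
      have := (hf.edge y hyA v (Finset.mem_erase.2 ⟨hvx, hv⟩) ((htw v hv).1 hxv)).resolve_left
        (hX v).1
      rw [(hay v).1, (hay v).2] at this
      simpa [(hax v).1, (hax v).2, hvx] using this
    by_cases hux : u = x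
    · subst hux
      right
      simpa using key v hv huv
    by_cases hvx : v = x
    · subst hvx
      right
      have := key u hu (hsymm _ _ huv)
      simp only [Function.update_self]
      linarith
    simpa [hux, hvx] using hf.edge u (Finset.mem_erase.2 ⟨hux, hu⟩) v
      (Finset.mem_erase.2 ⟨hvx, hv⟩) huv
  · refine le_trans (le_of_eq ?_) hf.cost
    rw [← Finset.sum_erase_add _ _ hx]
    simp only [(hax _).2, Finset.sum_const_zero, add_zero]
    congr 1
    refine Finset.sum_congr rfl fun u _ => ?_
    rw [← Finset.sum_erase_add _ _ hx, (hax u).1, add_zero]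

/-! ### The exchange argument for peeks into twins. -/

/-- The conditions on the parameter `h` of the kernel. -/
structure IsBound (δ K : ℝ) (h : ℕ) : Prop where
  le : K ≤ h
  deep : K + 1 ≤ h * (3 - 2 * δ)
  small : 1 ≤ δ ∨ K + 1 ≤ h * (1 - δ)

-- A vertex reached through a neighbor has `r` at least `1`. Below this value, an unvisited vertex
-- must be the target of a peek; this is the source of all deep peeks in the counting arguments.
omit [DecidableEq V] in
theorem IsFeasible.one_le_of_no_peek (hf : IsFeasible adj A S L X δ β a r) {x : V} (hx : x ∈ A)
    (hS : ¬ S x) (hr : r x < 1) : ∃ v ∈ A, L v x ∧ 1 - a v x ≤ r x := by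
  rcases hf.witness x hx with h1 | h1 | ⟨v, _, _, h2⟩
  · exact absurd h1 hS
  · exact h1
  · linarith [hf.r_nonneg v]

/-- If there are many twins, then the peeks into them can be replaced by deeper peeks into their
neighbors. -/
theorem IsFeasible.exists_no_peek (hsymm : ∀ u v, adj u v → adj v u) (hirr : ∀ u, ¬ adj u u)
    (hf : IsFeasible adj A S (fun u v => S u ∧ v ∈ A ∧ adj u v) X δ β a r) (hδ : δ < 3 / 2)
    (hK : 0 ≤ K) (hβ : β ≤ K) (hh : IsBound δ K h) (hX : ∀ u v, X u v → S u ∧ S v) (hSA : ∀ u, S u → u ∈ A) {T : Finset V}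
    (hTA : T ⊆ A) (hTS : ∀ x ∈ T, ¬ S x) (htw : ∀ x ∈ T, ∀ y ∈ T, ∀ z ∈ A, (adj x z → adj y z))
    (hT : h ≤ T.card) (hT0 : 0 < T.card) :
    ∃ x ∈ T, ∃ a r, IsFeasible adj A S (fun u v => S u ∧ v ∈ A ∧ adj u v) X δ β a r ∧
      ∀ v, a v x = 0 := by
  classical
  by_cases hz : ∃ x ∈ T, ∀ v, a v x = 0
  · obtain ⟨x, hx, h0⟩ := hz
    exact ⟨x, hx, a, r, hf, h0⟩
  push Not at hz
  have hne := hz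
  have hTh : (h : ℝ) ≤ T.card := by exact_mod_cast hT
  have hTpos : (0 : ℝ) < T.card := by exact_mod_cast hT0
  -- For `δ < 1`, each vertex of `T` would be the target of a peek of depth at least `1 - δ`, which
  -- is more than the budget allows by `IsBound.small`.
  have hδ1 : 1 ≤ δ := by
    by_contra hlt
    push Not at hlt
    have h1 := hh.small.resolve_left (not_le.2 hlt)
    have h2 := hf.card_mul_le hTA (η := 1 - δ) fun t ht => by
      obtain ⟨v, hv, -, h3⟩ := hf.one_le_of_no_peek (hTA ht) (hTS t ht)
        ((hf.r_le t (hTA ht)).trans_lt hlt)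
      exact ⟨v, hv, by linarith [hf.r_le t (hTA ht)]⟩
    nlinarith
  set σ : V → ℝ := fun x => ∑ v ∈ A, a v x with hσ
  have hσle : ∀ v x, a v x ≤ σ x := by
    intro v x
    by_cases hv : v ∈ A
    · exact Finset.single_le_sum (f := fun v => a v x) (fun v _ => hf.a_nonneg v x) hv
    · rw [hf.a_zero v x fun hL => hv (hSA _ hL.1)]
      exact Finset.sum_nonneg fun v _ => hf.a_nonneg v x
  obtain ⟨x1, hx1, hmin⟩ := T.exists_min_image σ (Finset.card_pos.1 hT0)
  set ε := σ x1 with hε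
  have hε0 : 0 ≤ ε := Finset.sum_nonneg fun v _ => hf.a_nonneg v x1
  have hsum : T.card * ε ≤ ∑ x ∈ T, σ x := by
    simpa using Finset.sum_le_sum (f := fun _ => ε) hmin
  have hsum' : ∑ x ∈ T, σ x ≤ ∑ u ∈ A, ∑ v ∈ A, a u v := by
    rw [show ∑ u ∈ A, ∑ v ∈ A, a u v = ∑ v ∈ A, ∑ u ∈ A, a u v from Finset.sum_comm]
    exact Finset.sum_le_sum_of_subset_of_nonneg hTA fun t _ _ => Finset.sum_nonneg fun v _ =>
      hf.a_nonneg v t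
  have hcost := hf.cost
  -- The least total depth `ε` is at most the average over the at least `h` vertices of `T`, and
  -- twice the sum of all depths is at most `K`.
  have hη : 2 * ε < 3 - 2 * δ := by
    have h1 := hh.deep
    by_contra hlt
    push Not at hlt
    nlinarith
  -- A smaller value would need a single peek into `x1` of depth more than `ε`, the total depth of
  -- all of them.
  have hr1 : 1 - ε ≤ r x1 := by
    by_contra hlt
    push Not at hlt
    obtain ⟨v, hv, -, h3⟩ := hf.one_le_of_no_peek (hTA hx1) (hTS _ hx1) (by linarith)
    linarith [hσle v x1]
  set X0 := A.filter fun x => adj x1 x ∧ ¬ S x with hX0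
  have hX0T : ∀ x ∈ X0, x ∉ T := fun x hx hxT => by
    simp only [hX0, Finset.mem_filter] at hx
    exact hirr x (htw x1 hx1 x hxT x hx.1 hx.2.1)
  -- Neither end of the edge from `x1` to `x` is visited, so no peek enters it and its inequality
  -- reads `1 + r x1 + r x ≤ 2 * δ`.
  have hrX : ∀ x ∈ X0, r x ≤ 2 * δ - 2 + ε := fun x hx => by
    simp only [hX0, Finset.mem_filter] at hx
    have := (hf.edge x1 (hTA hx1) x hx.1 hx.2.1).resolve_left fun h => hTS _ hx1 (hX _ _ h).1
    rw [hf.a_zero x1 x fun h => hTS _ hx1 h.1, hf.a_zero x x1 fun h => hx.2.2 h.1] at this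
    linarith
  have hpeek : ∀ x ∈ X0, ∃ v ∈ A, (S v ∧ x ∈ A ∧ adj v x) ∧ 1 - a v x ≤ r x := fun x hx => by
    have h1 := hrX x hx
    simp only [hX0, Finset.mem_filter] at hx
    exact hf.one_le_of_no_peek hx.1 hx.2.2 (by linarith)
  -- By `hrX` and `hη`, each unvisited neighbor of the twins is the target of a peek of depth at
  -- least `(3 - 2 * δ) / 2`. The budget admits at most `h` of these.
  have hcard : (X0.card : ℝ) ≤ T.card := by
    have h1 := hf.card_mul_le (T := X0) (Finset.filter_subset _ _) (η := (3 - 2 * δ) / 2)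
      fun t ht => by
        obtain ⟨v, hv, -, h2⟩ := hpeek t ht
        exact ⟨v, hv, by linarith [hrX t ht]⟩
    have h2 := hh.deep
    by_contra hlt
    push Not at hlt
    nlinarith
  choose! q hqA hqL hq using hpeek
  -- The exchange: all peeks into `T` are given up, and for each unvisited neighbor `x` of `T` one
  -- existing peek, namely that from `q x`, is deepened by `ε`. The neighbors get closer to the tour
  -- by `ε`, which makes up for the twins moving to distance `1`.
  set a' : V → V → ℝ := fun v x =>
    if x ∈ T then 0 else if x ∈ X0 ∧ v = q x then min 1 (a v x + ε) else a v x with ha'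
  set r' : V → ℝ := fun x =>
    if S x then 0 else if x ∈ T then 1 else if x ∈ X0 then max (r x - ε) 0 else r x with hr'
  have haT : ∀ v, ∀ x ∈ T, a' v x = 0 := fun v x hx => by simp [ha', hx]
  have haa : ∀ v, ∀ x ∉ T, a v x ≤ a' v x := fun v x hx => by
    simp only [ha', hx, if_false]
    split_ifs
    · exact le_min (hf.a_le_one _ _) (by linarith)
    · exact le_rfl
  have ha0 : ∀ v x, 0 ≤ a' v x := fun v x => by
    by_cases hx : x ∈ T
    · rw [haT v x hx]
    · exact (hf.a_nonneg v x).trans (haa v x hx)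
  have hrr : ∀ x ∉ T, r' x ≤ r x := fun x hx => by
    have := hf.r_nonneg x
    simp only [hr', hx, if_false]
    split_ifs
    · exact this
    · exact max_le (by linarith) this
    · exact le_rfl
  have hrT : ∀ x ∈ T, r' x = 1 := fun x hx => by simp [hr', hx, hTS x hx]
  have hrS : ∀ x, S x → r' x = 0 := fun x hx => by simp [hr', hx]
  have hrX' : ∀ x ∈ X0, r' x = max (r x - ε) 0 := fun x hx => by
    have h1 := (Finset.mem_filter.1 hx).2.2
    simp [hr', hX0T x hx, hx, h1]
  have hnbr : ∀ x ∈ T, ∀ y ∈ A, adj x y → ¬ S y → y ∈ X0 := fun x hx y hy hxy hSy =>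
    Finset.mem_filter.2 ⟨hy, htw x hx x1 hx1 y hy hxy, hSy⟩
  have hedge : ∀ x ∈ T, ∀ y ∈ A, adj x y → 2 + r' y ≤ 2 * δ := fun x hx y hy hxy => by
    by_cases hSy : S y
    · rw [hrS y hSy]
      linarith
    · have hy' := hnbr x hx y hy hxy hSy
      rw [hrX' y hy']
      have : max (r y - ε) 0 ≤ 2 * δ - 2 := max_le (by linarith [hrX y hy']) (by linarith)
      linarith
  refine ⟨x1, hx1, a', r', ⟨ha0, fun v x => ?_, fun v x hvx => ?_, fun x => ?_, fun x hx => ?_,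
    fun z hz => ?_, fun u hu v hv huv => ?_, ?_⟩, fun v => haT v x1 hx1⟩
  · simp only [ha']
    split_ifs
    exacts [zero_le_one, min_le_left _ _, hf.a_le_one _ _]
  · simp only [ha']
    split_ifs with h1 h2
    · rfl
    · exact absurd (h2.2 ▸ hqL x h2.1) hvx
    · exact hf.a_zero _ _ hvx
  · simp only [hr']
    split_ifs
    exacts [le_rfl, zero_le_one, le_max_right _ _, hf.r_nonneg x]
  · by_cases hxT : x ∈ T
    · rwa [hrT x hxT]
    · exact (hrr x hxT).trans (hf.r_le x hx)
  · by_cases hSz : S z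
    · exact .inl hSz
    by_cases hzT : z ∈ T
    · obtain ⟨v, hv⟩ := hne z hzT
      have hL : S v ∧ z ∈ A ∧ adj v z := by
        by_contra hL
        exact hv (hf.a_zero _ _ hL)
      -- A peek of depth `0` from the visited neighbor `v` witnesses distance `1`. That such a
      -- neighbor exists is known because there was a peek into `z` before.
      exact .inr (.inl ⟨v, hSA _ hL.1, hL, by rw [haT v z hzT, hrT z hzT]; norm_num⟩)
    by_cases hzX : z ∈ X0
    · refine .inr (.inl ⟨q z, hqA z hzX, hqL z hzX, ?_⟩)
      rw [hrX' z hzX]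
      have h1 := hq z hzX
      simp only [ha', hzT, hzX, if_false, true_and, if_true]
      rcases min_cases 1 (a (q z) z + ε) with h2 | h2 <;>
        rcases max_cases (r z - ε) 0 with h3 | h3 <;> linarith
    · have hrz : r' z = r z := by simp [hr', hSz, hzT, hzX]
      rw [hrz]
      rcases hf.witness z hz with h1 | ⟨v, hv, h1, h2⟩ | ⟨v, hv, h1, h2⟩
      · exact .inl h1
      · exact .inr (.inl ⟨v, hv, h1, by linarith [haa v z hzT]⟩)
      · refine .inr (.inr ⟨v, hv, h1, ?_⟩)
        have hvT : v ∉ T := fun hvT => hzX (hnbr v hvT z hz h1 hSz)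
        linarith [hrr v hvT]
  · refine (hf.edge u hu v hv huv).imp id fun h1 => ?_
    by_cases huT : u ∈ T
    · linarith [hedge u huT v hv huv, hrT u huT, ha0 u v, ha0 v u]
    by_cases hvT : v ∈ T
    · linarith [hedge v hvT u hu (hsymm _ _ huv), hrT v hvT, ha0 u v, ha0 v u]
    · linarith [haa u v hvT, haa v u huT, hrr u huT, hrr v hvT]
  · have hle : ∀ v x, a' v x ≤ a v x - (if x ∈ T then a v x else 0) +
        (if x ∈ X0 then if v = q x then ε else 0 else 0) := fun v x => by
      by_cases hxT : x ∈ T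
      · have hxX : x ∉ X0 := fun h => hX0T x h hxT
        simp [ha', hxT, hxX]
      · by_cases hxX : x ∈ X0
        · by_cases hvq : v = q x
          · simp [ha', hxT, hxX, ← hvq]
          · simp [ha', hxT, hxX, hvq]
        · simp [ha', hxT, hxX]
    -- The dropped peeks save at least `T.card * ε` and the deepened ones cost at most `X0.card *
    -- ε`.
    have h1 : ∑ u ∈ A, ∑ v ∈ A, a' u v ≤ ∑ u ∈ A, ∑ v ∈ A, a u v - ∑ x ∈ T, σ x + X0.card * ε := by
      have h2 : ∑ x ∈ T, σ x = ∑ x ∈ A, ∑ v ∈ A, if x ∈ T then a v x else 0 := by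
        rw [← Finset.sum_subset hTA (f := fun x => ∑ v ∈ A, if x ∈ T then a v x else 0)]
        · exact Finset.sum_congr rfl fun x hx => by simp [hσ, hx]
        · intro x _ hx
          simp [hx]
      have h3 : ∑ x ∈ A, ∑ v ∈ A, (if x ∈ X0 then if v = q x then ε else 0 else 0) =
          X0.card * ε := by
        rw [← Finset.sum_subset (show X0 ⊆ A from Finset.filter_subset _ _)]
        · rw [← nsmul_eq_mul, ← Finset.sum_const]
          refine Finset.sum_congr rfl fun x hx => ?_
          simp [hx, hqA x hx]
        · intro x _ hx
          simp [hx]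
      rw [h2, ← h3, Finset.sum_comm, Finset.sum_comm (f := fun u v => a u v),
        ← Finset.sum_sub_distrib, ← Finset.sum_add_distrib]
      refine Finset.sum_le_sum fun x _ => ?_
      rw [← Finset.sum_sub_distrib, ← Finset.sum_add_distrib]
      exact Finset.sum_le_sum fun v _ => hle v x
    have h2 := mul_le_mul_of_nonneg_right hcard hε0
    linarith

omit [DecidableEq V] in
theorem IsFeasible.length_le (hf : IsFeasible adj A S L X δ (K - m) a r) (hh : IsBound δ K h) :
    m ≤ h := by
  have h1 := hf.sum_nonneg
  have h2 := hf.cost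
  have h3 := hh.le
  have : (m : ℝ) ≤ h := by linarith
  exact_mod_cast this

theorem not_visits_of_erase {x : V} (hw : IsClosedWalk adj (A.erase x) m w) : ¬ Visits m w x := by
  rintro ⟨i, hi, rfl⟩
  exact (Finset.mem_erase.1 (hw.1 i hi)).1 rfl

-- Among the twins that the tour does not use, one with the largest `r` can be deleted, since any
-- other twin replaces it. The walk uses at most `h + 1` vertices, a tour in an edge at most two;
-- two further twins are needed, one to delete and one to compare with.
open Classical in
theorem Sol.exists_erase (hs : Sol adj A δ K)
    (hh : IsBound δ K h) {Z : Finset V} (hZA : Z ⊆ A)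
    (htw : ∀ x ∈ Z, ∀ y ∈ Z, ∀ z ∈ A, (adj x z → adj y z)) (hZ : h + 4 ≤ Z.card) :
    ∃ x ∈ Z, Sol adj (A.erase x) δ K := by
  have key : ∀ (T : Finset V) (r : V → ℝ), T.card + 2 ≤ Z.card →
      ∃ x ∈ Z, x ∉ T ∧ ∃ y ∈ Z, x ≠ y ∧ r y ≤ r x := by
    intro T r hT
    have h1 : 1 < (Z \ T).card := by
      have := Finset.le_card_sdiff T Z
      omega
    obtain ⟨x, hx, hmax⟩ := (Z \ T).exists_max_image r (Finset.card_pos.1 (by omega))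
    obtain ⟨y, hy, hyx⟩ := Finset.exists_mem_ne h1 x
    rw [Finset.mem_sdiff] at hx
    exact ⟨x, hx.1, hx.2, y, (Finset.mem_sdiff.1 hy).1, hyx.symm, hmax y hy⟩
  rcases hs with ⟨m, w, hw, a, r, hf⟩ | ⟨u, hu, v, hv, huv, a, r, hf⟩
  · have hm := hf.length_le hh
    have hcard := card_visits_le (m := m) (w := w) (T := A.filter (Visits m w))
      fun v hv => (Finset.mem_filter.1 hv).2
    obtain ⟨x, hx, hxT, y, hy, hxy, hr⟩ := key (A.filter (Visits m w)) r (by omega)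
    have hxS : ¬ Visits m w x := fun h => hxT (Finset.mem_filter.2 ⟨hZA hx, h⟩)
    refine ⟨x, hx, .inl ⟨m, w, ⟨fun i hi => Finset.mem_erase.2 ⟨?_, hw.1 i hi⟩, hw.2.1, hw.2.2⟩,
      hf.erase (hZA hy) hxy (htw x hx y hy) (fun z hz => hxS hz.1) (fun u v hv hL =>
        ⟨hL.1, Finset.mem_erase.2 ⟨hv, hL.2.1⟩, hL.2.2⟩) hr⟩⟩
    rintro rfl
    exact hxS ⟨i, hi, rfl⟩
  · obtain ⟨x, hx, hxT, y, hy, hxy, hr⟩ := key {u, v} r (by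
      have := Finset.card_le_two (a := u) (b := v)
      omega)
    simp only [Finset.mem_insert, Finset.mem_singleton, not_or] at hxT
    refine ⟨x, hx, .inr ⟨u, Finset.mem_erase.2 ⟨Ne.symm hxT.1, hu⟩, v,
      Finset.mem_erase.2 ⟨Ne.symm hxT.2, hv⟩, huv, hf.erase (hZA hy) hxy (htw x hx y hy)
        (fun z hz => ?_) (fun _ _ _ h => h) hr⟩⟩
    rcases hz with ⟨rfl, -⟩ | ⟨rfl, -⟩
    exacts [hxT.1 rfl, hxT.2 rfl]

-- For a closed walk, after removing `x` and the at most `h + 1` visited vertices, at least `h + 1`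
-- twins remain, so `exists_no_peek` provides one without peeks, which is then duplicated as `x`.
-- For a tour within an edge, any third twin outside this edge has no peek anyway.
open Classical in
theorem Sol.of_erase (hsymm : ∀ u v, adj u v → adj v u) (hirr : ∀ u, ¬ adj u u) (hδ : δ < 3 / 2)
    (hK : 0 ≤ K) (hh : IsBound δ K h) {Z : Finset V} (hZA : Z ⊆ A)
    (htw : ∀ x ∈ Z, ∀ y ∈ Z, ∀ z ∈ A, (adj x z → adj y z)) (hZ : 2 * h + 4 ≤ Z.card) {x : V}
    (hx : x ∈ Z) (hs : Sol adj (A.erase x) δ K) : Sol adj A δ K := by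
  have htw' : ∀ y ∈ Z, ∀ z ∈ A, (adj x z ↔ adj y z) := fun y hy z hz =>
    ⟨htw x hx y hy z hz, htw y hy x hx z hz⟩
  rcases hs with ⟨m, w, hw, a, r, hf⟩ | ⟨u, hu, v, hv, huv, a, r, hf⟩
  · have hm := hf.length_le hh
    have hcard := card_visits_le (m := m) (w := w) (T := A.filter (Visits m w))
      fun v hv => (Finset.mem_filter.1 hv).2
    have hxS := not_visits_of_erase hw
    set T := (Z.erase x) \ A.filter (Visits m w) with hT
    have hTZ : ∀ y ∈ T, y ∈ Z ∧ y ≠ x ∧ ¬ Visits m w y := fun y hy => by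
      simp only [hT, Finset.mem_sdiff, Finset.mem_erase, Finset.mem_filter, not_and] at hy
      exact ⟨hy.1.2, hy.1.1, hy.2 (hZA hy.1.2)⟩
    have hTc : h + 1 ≤ T.card := by
      have h1 := Finset.le_card_sdiff (A.filter (Visits m w)) (Z.erase x)
      rw [← hT, Finset.card_erase_of_mem hx] at h1
      omega
    have hm0 : (0 : ℝ) ≤ m := m.cast_nonneg
    obtain ⟨y, hy, a, r, hf, hay⟩ := hf.exists_no_peek (T := T) hsymm hirr hδ hK (by linarith) hh
      (fun u v huv => by
        obtain ⟨i, hi, ⟨rfl, rfl⟩ | ⟨rfl, rfl⟩⟩ := huv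
        · exact ⟨⟨i, hi.le, rfl⟩, ⟨i + 1, hi, rfl⟩⟩
        · exact ⟨⟨i + 1, hi, rfl⟩, ⟨i, hi.le, rfl⟩⟩) (fun u hu => by
        obtain ⟨i, hi, rfl⟩ := hu
        exact hw.1 i hi)
      (fun y hy => Finset.mem_erase.2 ⟨(hTZ y hy).2.1, hZA (hTZ y hy).1⟩)
      (fun y hy => (hTZ y hy).2.2) (fun y hy y' hy' z hz => htw y (hTZ y hy).1 y' (hTZ y' hy').1 z
        (Finset.mem_of_mem_erase hz)) (by omega) (by omega)
    obtain ⟨hyZ, hyx, hyS⟩ := hTZ y hy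
    refine .inl ⟨m, w, ⟨fun i hi => Finset.mem_of_mem_erase (hw.1 i hi), hw.2⟩,
      hf.insert hsymm hirr (hZA hx) (hZA hyZ) hyx.symm (htw' y hyZ) (fun z => ⟨fun h => hxS h.1,
        fun h => Finset.notMem_erase _ _ h.2.1⟩) (fun u v h => ⟨h.1, Finset.mem_of_mem_erase h.2.1,
        h.2.2⟩) (fun u h => ⟨h.1, hZA hx, ?_⟩) hyS (fun z => ⟨?_, ?_⟩) fun z => ⟨hay z,
        hf.a_zero _ _ fun h => hyS h.1⟩⟩
    · obtain ⟨i, hi, rfl⟩ := h.1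
      exact hsymm _ _ ((htw' y hyZ _ (Finset.mem_of_mem_erase (hw.1 i hi))).2 (hsymm _ _ h.2.2))
    · rintro ⟨i, hi, ⟨h1, -⟩ | ⟨-, h1⟩⟩
      exacts [hyS ⟨i, hi.le, h1⟩, hyS ⟨i + 1, hi, h1⟩]
    · rintro ⟨i, hi, ⟨-, h1⟩ | ⟨h1, -⟩⟩
      exacts [hyS ⟨i + 1, hi, h1⟩, hyS ⟨i, hi.le, h1⟩]
  · obtain ⟨hux, hu⟩ := Finset.mem_erase.1 hu
    obtain ⟨hvx, hv⟩ := Finset.mem_erase.1 hv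
    obtain ⟨y, hy⟩ : ((Z.erase x) \ {u, v}).Nonempty := by
      rw [← Finset.card_pos]
      have h1 := Finset.le_card_sdiff {u, v} (Z.erase x)
      have h2 := Finset.card_le_two (a := u) (b := v)
      rw [Finset.card_erase_of_mem hx] at h1
      omega
    simp only [Finset.mem_sdiff, Finset.mem_erase, Finset.mem_insert, Finset.mem_singleton,
      not_or] at hy
    obtain ⟨⟨hyx, hyZ⟩, hyu, hyv⟩ := hy
    have hP : ∀ y, y ≠ u → y ≠ v → ∀ z, ¬ IsPair u v y z ∧ ¬ IsPair u v z y := by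
      rintro y hyu hyv z
      refine ⟨?_, ?_⟩
      · rintro (⟨h, -⟩ | ⟨h, -⟩)
        exacts [hyu h, hyv h]
      · rintro (⟨-, h⟩ | ⟨-, h⟩)
        exacts [hyv h, hyu h]
    exact .inr ⟨u, hu, v, hv, huv, hf.insert hsymm hirr (hZA hx) (hZA hyZ) (Ne.symm hyx)
      (htw' y hyZ) (hP x (Ne.symm hux) (Ne.symm hvx)) (fun _ _ h => h)
      (fun z h => absurd h (hP y hyu hyv z).2) (fun h => h) (hP y hyu hyv) fun z =>
      ⟨hf.a_zero _ _ (hP y hyu hyv z).2, hf.a_zero _ _ (hP y hyu hyv z).1⟩⟩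

/-- A vertex with many twins can be deleted. -/
theorem sol_erase_iff (hsymm : ∀ u v, adj u v → adj v u) (hirr : ∀ u, ¬ adj u u) (hδ : δ < 3 / 2)
    (hK : 0 ≤ K) (hh : IsBound δ K h) {Z : Finset V} (hZA : Z ⊆ A)
    (htw : ∀ x ∈ Z, ∀ y ∈ Z, ∀ z ∈ A, (adj x z → adj y z)) (hZ : 2 * h + 4 ≤ Z.card) {x : V}
    (hx : x ∈ Z) : Sol adj (A.erase x) δ K ↔ Sol adj A δ K := by
  refine ⟨Sol.of_erase hsymm hirr hδ hK hh hZA htw hZ hx, fun hs => ?_⟩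
  -- The deletable twin `y` cannot be prescribed, but the transposition of `x` and `y` preserves
  -- adjacency on `A` and carries `A.erase y` to `A.erase x`.
  obtain ⟨y, hy, hs⟩ := hs.exists_erase hh hZA htw (by omega)
  have hsw : ∀ x ∈ Z, ∀ y ∈ Z, ∀ u ∈ A.erase y, Equiv.swap x y u ∈ A.erase x := by
    intro x hx y hy u hu
    obtain ⟨huy, hu⟩ := Finset.mem_erase.1 hu
    by_cases hux : u = x
    · subst hux
      rw [Equiv.swap_apply_left]
      exact Finset.mem_erase.2 ⟨Ne.symm huy, hZA hy⟩
    · rw [Equiv.swap_apply_of_ne_of_ne hux huy]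
      exact Finset.mem_erase.2 ⟨hux, hu⟩
  have hadj1 : ∀ u ∈ A, ∀ v ∈ A, adj u v → adj (Equiv.swap x y u) v := by
    intro u hu v hv huv
    by_cases hux : u = x
    · subst hux
      rw [Equiv.swap_apply_left]
      exact htw u hx y hy v hv huv
    by_cases huy : u = y
    · subst huy
      rw [Equiv.swap_apply_right]
      exact htw u hy x hx v hv huv
    · rwa [Equiv.swap_apply_of_ne_of_ne hux huy]
  have hmem : ∀ u ∈ A, Equiv.swap x y u ∈ A := by
    intro u hu
    rcases Equiv.swap_apply_eq_iff.1 (rfl : Equiv.swap x y u = Equiv.swap x y u) with _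
    by_cases hux : u = x
    · subst hux
      rw [Equiv.swap_apply_left]
      exact hZA hy
    by_cases huy : u = y
    · subst huy
      rw [Equiv.swap_apply_right]
      exact hZA hx
    · rwa [Equiv.swap_apply_of_ne_of_ne hux huy]
  have hadj2 : ∀ u ∈ A, ∀ v ∈ A, adj u v → adj (Equiv.swap x y u) (Equiv.swap x y v) :=
    fun u hu v hv huv => hsymm _ _ (hadj1 v hv _ (hmem u hu) (hsymm _ _ (hadj1 u hu v hv huv)))
  refine hs.transfer (ψ := Equiv.swap x y) (φ := Equiv.swap x y) (hsw x hx y hy) ?_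
    (fun u _ => Equiv.swap_apply_self _ _ _) (fun u _ => Equiv.swap_apply_self _ _ _) ?_
  · rw [Equiv.swap_comm]
    exact hsw y hy x hx
  · intro u hu v hv
    have hu := Finset.mem_of_mem_erase hu
    have hv := Finset.mem_of_mem_erase hv
    refine ⟨hadj2 u hu v hv, fun h => ?_⟩
    have := hadj2 _ (hmem u hu) _ (hmem v hv) h
    rwa [Equiv.swap_apply_self, Equiv.swap_apply_self] at this

/-! ### Vertex covers -/

-- If an edge avoids `C₀`, there is no peek into it and it is not covered for free, so `r u + r v ≤
-- 2 * δ - 1`. The end with the smaller `r` has `r ≤ (2 * δ - 1) / 2 < 1`, hence it is the target of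
-- a peek of depth at least `(3 - 2 * δ) / 2`. The cost bound leaves at most `2 * h` such targets.
open Classical in
theorem IsFeasible.exists_cover (hf : IsFeasible adj A S L X δ β a r) (hδ : δ < 3 / 2)
    {C₀ : Finset V} (hC₀ : C₀ ⊆ A) (hS : ∀ u ∈ A, S u → u ∈ C₀) (hX : ∀ u v, X u v → u ∈ C₀ ∨ v ∈ C₀)
    (hL : ∀ u v, L u v → u ∈ C₀) (hβ : β ≤ 2 * (h * (3 - 2 * δ))) :
    ∃ C ⊆ A, C.card ≤ C₀.card + 2 * h ∧ ∀ u ∈ A, ∀ v ∈ A, adj u v → u ∈ C ∨ v ∈ C := by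
  set D := A.filter fun x => ∃ v ∈ A, (3 - 2 * δ) / 2 ≤ a v x with hD
  have hDc : D.card ≤ 2 * h := by
    have h1 := hf.card_mul_le (T := D) (Finset.filter_subset _ _) (η := (3 - 2 * δ) / 2)
      fun t ht => (Finset.mem_filter.1 ht).2
    by_contra hlt
    push Not at hlt
    have h2 : (2 * h + 1 : ℝ) ≤ D.card := by exact_mod_cast hlt
    nlinarith
  have key : ∀ u ∈ A, u ∉ C₀ → r u ≤ (2 * δ - 1) / 2 → u ∈ D := by
    intro u hu huC hr
    obtain ⟨v, hv, -, h1⟩ := hf.one_le_of_no_peek hu (fun h => huC (hS u hu h)) (by linarith)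
    exact Finset.mem_filter.2 ⟨hu, v, hv, by linarith⟩
  refine ⟨C₀ ∪ D, Finset.union_subset hC₀ (Finset.filter_subset _ _),
    (Finset.card_union_le _ _).trans (by omega), fun u hu v hv huv => ?_⟩
  simp only [Finset.mem_union]
  rcases hf.edge u hu v hv huv with h1 | h1
  · have := hX u v h1
    tauto
  · by_cases huC : u ∈ C₀
    · tauto
    by_cases hvC : v ∈ C₀
    · tauto
    rw [hf.a_zero u v fun h => huC (hL _ _ h), hf.a_zero v u fun h => hvC (hL _ _ h)] at h1
    by_cases hr : r u ≤ (2 * δ - 1) / 2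
    · exact .inl (.inr (key u hu huC hr))
    · exact .inr (.inr (key v hv hvC (by linarith)))

-- The set `C₀` consists of the at most `h + 1` visited vertices or of the two ends of the edge of
-- the tour. In the latter case the budget is `K + 2`, which is still at most `2 * (K + 1)`.
open Classical in
theorem Sol.exists_cover (hs : Sol adj A δ K) (hδ : δ < 3 / 2) (hK : 0 ≤ K) (hh : IsBound δ K h) :
    ∃ C ⊆ A, C.card ≤ 3 * h + 2 ∧ ∀ u ∈ A, ∀ v ∈ A, adj u v → u ∈ C ∨ v ∈ C := by
  have hd := hh.deep
  rcases hs with ⟨m, w, hw, a, r, hf⟩ | ⟨u, hu, v, hv, huv, a, r, hf⟩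
  · have hm := hf.length_le hh
    have hcard := card_visits_le (m := m) (w := w) (T := A.filter (Visits m w))
      fun v hv => (Finset.mem_filter.1 hv).2
    have hmem : ∀ i ≤ m, w i ∈ A.filter (Visits m w) := fun i hi =>
      Finset.mem_filter.2 ⟨hw.1 i hi, i, hi, rfl⟩
    have hm0 : (0 : ℝ) ≤ m := m.cast_nonneg
    obtain ⟨C, hCA, hC, hC'⟩ := hf.exists_cover (h := h) (C₀ := A.filter (Visits m w)) hδ
      (Finset.filter_subset _ _) (fun u hu h => Finset.mem_filter.2 ⟨hu, h⟩)
      (by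
        rintro u v ⟨i, hi, ⟨rfl, rfl⟩ | ⟨rfl, rfl⟩⟩
        exacts [.inl (hmem i hi.le), .inr (hmem i hi.le)])
      (by
        rintro u v ⟨⟨i, hi, rfl⟩, -⟩
        exact hmem i hi) (by linarith)
    exact ⟨C, hCA, by omega, hC'⟩
  · obtain ⟨C, hCA, hC, hC'⟩ := hf.exists_cover (h := h) (C₀ := {u, v}) hδ
      (Finset.insert_subset hu (Finset.singleton_subset_iff.2 hv)) (fun u hu h => h.elim)
      (by rintro p q (⟨rfl, rfl⟩ | ⟨rfl, rfl⟩) <;> simp)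
      (by rintro p q (⟨rfl, rfl⟩ | ⟨rfl, rfl⟩) <;> simp) (by linarith)
    have := Finset.card_le_two (a := u) (b := v)
    exact ⟨C, hCA, by omega, hC'⟩

end twins

/-! ### The kernel -/

section kernel

variable {n : ℕ} {G : SimpleGraph (Fin n)} {δ K : ℝ} {h M : ℕ}

/-- The two vertices have the same neighbors. -/
def Twin (G : SimpleGraph V) (u v : V) : Prop := ∀ z, G.Adj u z ↔ G.Adj v z

open Classical in
/-- The vertices that have less than `M` smaller twins. -/
def kept (G : SimpleGraph (Fin n)) (M : ℕ) : Finset (Fin n) :=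
  Finset.univ.filter fun w => (Finset.univ.filter fun u => u < w ∧ Twin G w u).card < M

-- The smallest discarded vertex of the twin class of `w` has at least `M` smaller twins, and by
-- minimality all of these are kept.
open Classical in
theorem card_kept_twins (w : Fin n) (hw : w ∉ kept G M) :
    M ≤ ((kept G M).filter fun u => Twin G w u).card := by
  by_contra hlt
  push Not at hlt
  set D := Finset.univ.filter fun u => Twin G w u ∧ u ∉ kept G M with hD
  have hne : D.Nonempty := ⟨w, Finset.mem_filter.2 ⟨Finset.mem_univ _, fun _ => Iff.rfl, hw⟩⟩
  have hmin := D.min'_mem hne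
  set x := D.min' hne with hx
  have hx' := hmin
  simp only [hD, Finset.mem_filter, Finset.mem_univ, true_and] at hx'
  refine hx'.2 (Finset.mem_filter.2 ⟨Finset.mem_univ _, lt_of_le_of_lt (Finset.card_le_card ?_) hlt⟩)
  intro u hu
  simp only [Finset.mem_filter, Finset.mem_univ, true_and] at hu
  have hwu : Twin G w u := fun z => (hx'.1 z).trans (hu.2 z)
  refine Finset.mem_filter.2 ⟨?_, hwu⟩
  by_contra huk
  exact absurd (D.min'_le u (by simp [hD, hwu, huk])) (not_le.2 hu.1)

-- The discarded vertices are deleted one at a time. Whatever the order, each of them has `M` kept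
-- twins, which are still present when it is deleted.
open Classical in
theorem sol_kept_iff (hδ : δ < 3 / 2) (hK : 0 ≤ K) (hh : IsBound δ K h) (hM : 2 * h + 4 ≤ M) :
    Sol G.Adj (kept G M) δ K ↔ Sol G.Adj Finset.univ δ K := by
  have key : ∀ k, ∀ A : Finset (Fin n), kept G M ⊆ A → (A \ kept G M).card = k →
      (Sol G.Adj (kept G M) δ K ↔ Sol G.Adj A δ K) := by
    intro k
    induction k with
    | zero =>
      intro A hA hk
      rw [Finset.card_eq_zero, Finset.sdiff_eq_empty_iff_subset] at hk
      rw [hA.antisymm hk]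
    | succ k ih =>
      intro A hA hk
      obtain ⟨x, hx⟩ : (A \ kept G M).Nonempty := Finset.card_pos.1 (by omega)
      obtain ⟨hxA, hxk⟩ := Finset.mem_sdiff.1 hx
      rw [ih (A.erase x) (fun y hy => Finset.mem_erase.2 ⟨fun h => hxk (h ▸ hy), hA hy⟩) ?_]
      · refine sol_erase_iff (fun _ _ h => h.symm) (fun _ => G.irrefl) hδ hK hh
          (Z := insert x ((kept G M).filter fun u => Twin G x u)) ?_ ?_ ?_
          (Finset.mem_insert_self _ _)
        · exact Finset.insert_subset hxA ((Finset.filter_subset _ _).trans hA)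
        · have : ∀ y ∈ insert x ((kept G M).filter fun u => Twin G x u), Twin G x y := by
            intro y hy
            rcases Finset.mem_insert.1 hy with rfl | hy
            · exact fun z => Iff.rfl
            · exact (Finset.mem_filter.1 hy).2
          exact fun y hy y' hy' z _ => fun h => (this y' hy' z).1 ((this y hy z).2 h)
        · refine (hM.trans (card_kept_twins x hxk)).trans (Finset.card_le_card
            (Finset.subset_insert _ _))
      · rw [Finset.erase_sdiff_comm, Finset.card_erase_of_mem hx, hk]
        rfl
  exact key _ _ (Finset.subset_univ _) rfl

-- Outside of a vertex cover `C`, all neighbors lie in `C`, so vertices with the same neighbors in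
-- `C` are twins. The largest kept vertex of such a group shows that the group contains at most `M`
-- kept vertices.
open Classical in
theorem card_kept_le (hδ : δ < 3 / 2) (hK : 0 ≤ K) (hh : IsBound δ K h)
    (hs : Sol G.Adj Finset.univ δ K) : (kept G M).card ≤ (3 * h + 2) + M * 2 ^ (3 * h + 2) := by
  obtain ⟨C, -, hC, hcov⟩ := hs.exists_cover hδ hK hh
  have h1 : (kept G M \ C).card ≤ M * ((kept G M \ C).image fun w =>
      C.filter fun z => G.Adj w z).card := by
    refine Finset.card_le_mul_card_image _ _ fun N _ => ?_
    set F := (kept G M \ C).filter fun w => (C.filter fun z => G.Adj w z) = N with hF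
    by_contra hlt
    push Not at hlt
    have hne : F.Nonempty := Finset.card_pos.1 (by omega)
    have hmax := F.max'_mem hne
    set x := F.max' hne with hx
    have htw : ∀ u ∈ F, ∀ v ∈ F, ∀ z, G.Adj u z → G.Adj v z := by
      intro u hu v hv z huz
      simp only [hF, Finset.mem_filter, Finset.mem_sdiff] at hu hv
      have hz : z ∈ C := (hcov u (Finset.mem_univ _) z (Finset.mem_univ _) huz).resolve_left hu.1.2
      have : z ∈ C.filter fun z => G.Adj v z := by
        rw [hv.2, ← hu.2]
        exact Finset.mem_filter.2 ⟨hz, huz⟩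
      exact (Finset.mem_filter.1 this).2
    have hxk : x ∈ kept G M := by
      have := hmax
      simp only [hF, Finset.mem_filter, Finset.mem_sdiff] at this
      exact this.1.1
    have h2 := (Finset.mem_filter.1 hxk).2
    have h3 : F.erase x ⊆ Finset.univ.filter fun u => u < x ∧ Twin G x u := by
      intro u hu
      obtain ⟨hux, hu⟩ := Finset.mem_erase.1 hu
      exact Finset.mem_filter.2 ⟨Finset.mem_univ _, lt_of_le_of_ne (F.le_max' u hu) hux, fun z =>
        ⟨htw x hmax u hu z, htw u hu x hmax z⟩⟩
    have h4 := Finset.card_le_card h3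
    rw [Finset.card_erase_of_mem hmax] at h4
    omega
  have h2 : ((kept G M \ C).image fun w => C.filter fun z => G.Adj w z).card ≤ 2 ^ (3 * h + 2) := by
    refine (Finset.card_le_card (t := C.powerset) fun N hN => ?_).trans ?_
    · obtain ⟨w, -, rfl⟩ := Finset.mem_image.1 hN
      exact Finset.mem_powerset.2 (Finset.filter_subset _ _)
    · rw [Finset.card_powerset]
      exact Nat.pow_le_pow_right (by omega) hC
  have h3 := Finset.card_le_card_sdiff_add_card (s := kept G M) (t := C)
  have h4 := Nat.mul_le_mul_left M h2
  omega

end kernel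

end GraphTour

/-! ## Points and walks -/

namespace GraphTour

variable {V : Type*} [DecidableEq V] {G : SimpleGraph V} {u v w : V} {s t : ℝ} {x y z : V → ℝ}

theorem pt_symm (u v : V) (t : ℝ) : pt u v t = pt v u (1 - t) := by
  simp [pt, add_comm]

theorem pt_zero (u v : V) : pt u v 0 = vtx u := by simp [pt, vtx]

theorem pt_one (u v : V) : pt u v 1 = vtx v := by simp [pt, vtx]

theorem pt_apply_left (h : u ≠ v) (t : ℝ) : pt u v t u = 1 - t := by simp [pt, h]

theorem pt_apply_right (h : u ≠ v) (t : ℝ) : pt u v t v = t := by simp [pt, h.symm]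

theorem pt_apply_of_ne (hu : w ≠ u) (hv : w ≠ v) (t : ℝ) : pt u v t w = 0 := by simp [pt, hu, hv]

theorem vtx_eq_pt (huv : u ≠ v) (h : vtx w = pt u v t) : (w = u ∧ t = 0) ∨ (w = v ∧ t = 1) := by
  have hw := congrFun h w
  rw [vtx, Pi.single_eq_same] at hw
  by_cases hu : w = u
  · subst hu
    rw [pt_apply_left huv] at hw
    exact .inl ⟨rfl, by linarith⟩
  by_cases hv : w = v
  · subst hv
    rw [pt_apply_right huv] at hw
    exact .inr ⟨rfl, hw.symm⟩
  · rw [pt_apply_of_ne hu hv] at hw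
    norm_num at hw

theorem vtx_injective : Function.Injective (vtx : V → V → ℝ) := fun u v h => by
  by_contra hne
  have := congrFun h u
  simp [vtx, hne] at this

theorem pt_eq_pt {u' v' : V} (huv : u ≠ v) (huv' : u' ≠ v') (ht0 : 0 < t) (ht1 : t < 1)
    (h : pt u v t = pt u' v' s) : (u' = u ∧ v' = v ∧ s = t) ∨ (u' = v ∧ v' = u ∧ s = 1 - t) := by
  have hu := congrFun h u
  have hv := congrFun h v
  rw [pt_apply_left huv] at hu
  rw [pt_apply_right huv] at hv
  by_cases h1 : u = u'
  · subst h1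
    rw [pt_apply_left huv'] at hu
    by_cases h2 : v = v'
    · exact .inl ⟨rfl, h2.symm, by linarith⟩
    · rw [pt_apply_of_ne huv.symm h2] at hv
      linarith
  by_cases h2 : u = v'
  · subst h2
    rw [pt_apply_right huv'] at hu
    by_cases h3 : v = u'
    · exact .inr ⟨h3.symm, rfl, hu.symm⟩
    · rw [pt_apply_of_ne h3 huv.symm] at hv
      linarith
  · rw [pt_apply_of_ne h1 h2] at hu
    linarith

theorem onCommonEdge_pt (huv : G.Adj u v) (hs : s ∈ Set.Icc (0 : ℝ) 1)
    (ht : t ∈ Set.Icc (0 : ℝ) 1) : OnCommonEdge G (pt u v s) (pt u v t) :=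
  ⟨u, v, huv, s, hs, t, ht, rfl, rfl⟩

theorem OnCommonEdge.symm (h : OnCommonEdge G x y) : OnCommonEdge G y x := by
  obtain ⟨u, v, huv, s, hs, t, ht, hx, hy⟩ := h
  exact ⟨u, v, huv, t, ht, s, hs, hy, hx⟩

theorem one_sub_mem (ht : t ∈ Set.Icc (0 : ℝ) 1) : 1 - t ∈ Set.Icc (0 : ℝ) 1 :=
  ⟨by linarith [ht.2], by linarith [ht.1]⟩

theorem OnCommonEdge.of_pt (huv : G.Adj u v) (ht0 : 0 < t) (ht1 : t < 1)
    (h : OnCommonEdge G (pt u v t) y) : ∃ s ∈ Set.Icc (0 : ℝ) 1, y = pt u v s := by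
  obtain ⟨u', v', huv', s, hs, s', hs', hx, rfl⟩ := h
  rcases pt_eq_pt huv.ne huv'.ne ht0 ht1 hx with ⟨rfl, rfl, -⟩ | ⟨rfl, rfl, -⟩
  · exact ⟨s', hs', rfl⟩
  · exact ⟨1 - s', one_sub_mem hs', pt_symm _ _ _⟩

theorem OnCommonEdge.of_vtx (h : OnCommonEdge G (vtx w) y) :
    ∃ v, G.Adj w v ∧ ∃ s ∈ Set.Icc (0 : ℝ) 1, y = pt w v s := by
  obtain ⟨u', v', huv', s, hs, s', hs', hx, rfl⟩ := h
  rcases vtx_eq_pt huv'.ne hx with ⟨rfl, -⟩ | ⟨rfl, -⟩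
  · exact ⟨v', huv', s', hs', rfl⟩
  · exact ⟨u', huv'.symm, 1 - s', one_sub_mem hs', pt_symm _ _ _⟩

theorem pt_mem_points (huv : G.Adj u v) (ht : t ∈ Set.Icc (0 : ℝ) 1) : pt u v t ∈ points G :=
  .inr ⟨u, v, huv, t, ht, rfl⟩

theorem vtx_mem_points (u : V) : vtx u ∈ points G := .inl ⟨u, rfl⟩

theorem OnCommonEdge.mem_points (h : OnCommonEdge G x y) : x ∈ points G ∧ y ∈ points G := by
  obtain ⟨u, v, huv, s, hs, t, ht, rfl, rfl⟩ := h
  exact ⟨pt_mem_points huv hs, pt_mem_points huv ht⟩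

/-! ### Lists of points -/

theorem isWalk_cons_cons {L : List (V → ℝ)} :
    IsWalk G (x :: y :: L) ↔ (x ≠ y ∧ OnCommonEdge G x y) ∧ IsWalk G (y :: L) := by
  simp only [IsWalk, ne_eq, reduceCtorEq, not_false_eq_true, true_and, List.isChain_cons_cons,
    List.forall_mem_cons]
  constructor
  · tauto
  · rintro ⟨h1, h2, h3⟩
    exact ⟨⟨h1.2.mem_points.1, h2⟩, h1, h3⟩

theorem isWalk_singleton (hx : x ∈ points G) : IsWalk G [x] := by
  simp [IsWalk, hx]

theorem isWalk_append {A B : List (V → ℝ)} :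
    IsWalk G (A ++ x :: B) ↔ IsWalk G (A ++ [x]) ∧ IsWalk G (x :: B) := by
  simp only [IsWalk]
  rw [List.isChain_split]
  simp only [List.mem_append, List.mem_cons]
  constructor
  · rintro ⟨-, h2, h3, h4⟩
    refine ⟨⟨by simp, fun y hy => h2 y ?_, h3⟩, by simp, fun y hy => h2 y (.inr hy), h4⟩
    rcases hy with h | rfl | h
    exacts [.inl h, .inr (.inl rfl), by simp at h]
  · rintro ⟨⟨-, h2, h3⟩, -, h4, h5⟩
    refine ⟨by simp, fun y hy => ?_, h3, h5⟩
    rcases hy with h | h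
    exacts [h2 y (.inl h), h4 y h]

omit [DecidableEq V] in
theorem passed_singleton (x : V → ℝ) : passed [x] = {x} := by
  ext z
  simp only [passed, Set.mem_union, Set.mem_ofPred_eq, List.mem_singleton, Set.mem_singleton_iff]
  constructor
  · rintro (h | ⟨p, q, h, -⟩)
    · exact h
    · have := h.length_le
      simp at this
  · exact .inl

omit [DecidableEq V] in
theorem passed_cons_cons (x y : V → ℝ) (L : List (V → ℝ)) :
    passed (x :: y :: L) = segment ℝ x y ∪ passed (y :: L) := by
  ext z
  have h : ∀ p q : V → ℝ, [p, q] <:+: x :: y :: L ↔ (p = x ∧ q = y) ∨ [p, q] <:+: y :: L := by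
    intro p q
    rw [List.infix_cons_iff]
    simp
  simp only [passed, Set.mem_union, Set.mem_ofPred_eq, h]
  constructor
  · rintro (h | ⟨p, q, ⟨rfl, rfl⟩ | h, hz⟩)
    · rcases List.mem_cons.1 h with rfl | h
      exacts [.inl (left_mem_segment ℝ _ _), .inr (.inl h)]
    · exact .inl hz
    · exact .inr (.inr ⟨p, q, h, hz⟩)
  · rintro (h | h | ⟨p, q, h, hz⟩)
    · exact .inr ⟨x, y, .inl ⟨rfl, rfl⟩, h⟩
    · exact .inl (List.mem_cons_of_mem _ h)
    · exact .inr ⟨p, q, .inr h, hz⟩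

omit [DecidableEq V] in
theorem passed_append (A B : List (V → ℝ)) (x : V → ℝ) :
    passed (A ++ x :: B) = passed (A ++ [x]) ∪ passed (x :: B) := by
  induction A with
  | nil =>
    refine (Set.union_eq_self_of_subset_left ?_).symm
    rw [List.nil_append, passed_singleton, Set.singleton_subset_iff]
    exact .inl List.mem_cons_self
  | cons a A ih =>
    cases A with
    | nil =>
      simp only [List.cons_append, List.nil_append, passed_cons_cons, passed_singleton]
      rw [Set.union_assoc, Set.union_eq_self_of_subset_left (s := {x})]
      rw [Set.singleton_subset_iff]
      exact .inl List.mem_cons_self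
    | cons b A =>
      simp only [List.cons_append, passed_cons_cons] at ih ⊢
      rw [ih, Set.union_assoc]

variable [Fintype V]

omit [DecidableEq V] in
theorem walkLength_append (A B : List (V → ℝ)) (x : V → ℝ) :
    walkLength (A ++ x :: B) = walkLength (A ++ [x]) + walkLength (x :: B) := by
  induction A with
  | nil => simp [walkLength]
  | cons a A ih =>
    cases A with
    | nil => simp [walkLength]
    | cons b A =>
      simp only [List.cons_append, walkLength] at ih ⊢
      rw [ih, add_assoc]

omit [DecidableEq V] in
theorem walkLength_nonneg (L : List (V → ℝ)) : 0 ≤ walkLength L := by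
  induction L with
  | nil => simp [walkLength]
  | cons x L ih =>
    cases L with
    | nil => simp [walkLength]
    | cons y L => exact add_nonneg dist_nonneg ih

/-! ### The distance to a set of points -/

variable {P : Set (V → ℝ)} {δ : ℝ}

/-- The distance of a point to a set of points. -/
def setDist (G : SimpleGraph V) (P : Set (V → ℝ)) (x : V → ℝ) : ℝ≥0∞ := ⨅ y ∈ P, ptDist G x y

theorem setDist_anti {Q : Set (V → ℝ)} (h : P ⊆ Q) (x : V → ℝ) :
    setDist G Q x ≤ setDist G P x := biInf_mono h

theorem setDist_le_of_walk {W : List (V → ℝ)} (hW : IsWalk G W) (hx : W.head? = some x)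
    (hy : W.getLast? = some y) (hyP : y ∈ P) : setDist G P x ≤ ENNReal.ofReal (walkLength W) :=
  (iInf₂_le y hyP).trans (iInf₂_le W ⟨hW, hx, hy⟩)

theorem setDist_lt_iff {c : ℝ≥0∞} : setDist G P x < c ↔ ∃ W, IsWalk G W ∧ W.head? = some x ∧
    (∃ y ∈ P, W.getLast? = some y) ∧ ENNReal.ofReal (walkLength W) < c := by
  simp only [setDist, ptDist, iInf_lt_iff]
  constructor
  · rintro ⟨y, hy, W, ⟨h1, h2, h3⟩, h4⟩
    exact ⟨W, h1, h2, ⟨y, hy, h3⟩, h4⟩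
  · rintro ⟨W, h1, h2, ⟨y, hy, h3⟩, h4⟩
    exact ⟨y, hy, W, ⟨h1, h2, h3⟩, h4⟩

theorem setDist_eq_zero (hx : x ∈ points G) (hxP : x ∈ P) : setDist G P x = 0 := by
  refine le_antisymm ?_ zero_le
  simpa [walkLength] using setDist_le_of_walk (isWalk_singleton hx) rfl rfl hxP

theorem setDist_le_add (h : OnCommonEdge G x y) :
    setDist G P x ≤ ENNReal.ofReal (dist x y) + setDist G P y := by
  by_cases hxy : x = y
  · subst hxy
    simp
  by_contra hlt
  rw [not_le, ← lt_tsub_iff_left, setDist_lt_iff] at hlt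
  obtain ⟨W, h1, h2, ⟨z, hz, h3⟩, h4⟩ := hlt
  rw [lt_tsub_iff_left] at h4
  cases W with
  | nil => simp at h2
  | cons y' W =>
    obtain rfl : y' = y := by simpa using h2
    have h5 : IsWalk G (x :: y' :: W) := isWalk_cons_cons.2 ⟨⟨hxy, h⟩, h1⟩
    have h6 := setDist_le_of_walk h5 rfl (by simpa using h3) hz
    rw [walkLength, ENNReal.ofReal_add dist_nonneg (walkLength_nonneg _)] at h6
    exact absurd h4 (not_lt.2 h6)

theorem setDist_pt_le_add (huv : G.Adj u v) (hs : s ∈ Set.Icc (0 : ℝ) 1)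
    (ht : t ∈ Set.Icc (0 : ℝ) 1) :
    setDist G P (pt u v s) ≤ ENNReal.ofReal |s - t| + setDist G P (pt u v t) := by
  simpa [dist_pt huv.ne] using setDist_le_add (P := P) (onCommonEdge_pt huv hs ht)

/-- A lower bound for the distance of the points of a set `U` to `P`: it suffices to consider one
step of a walk. -/
theorem le_setDist_of_step {U : Set (V → ℝ)} {ψ : (V → ℝ) → ℝ} (hUP : ∀ x ∈ U, x ∉ P)
    (hstep : ∀ x ∈ U, ∀ y, OnCommonEdge G x y → (y ∈ U ∧ ψ x ≤ dist x y + ψ y) ∨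
      ENNReal.ofReal (ψ x) ≤ ENNReal.ofReal (dist x y) + setDist G P y) (hx : x ∈ U) :
    ENNReal.ofReal (ψ x) ≤ setDist G P x := by
  refine le_iInf₂ fun z hz => le_iInf₂ fun W hW => ?_
  obtain ⟨hW, hhead, hlast⟩ := hW
  induction W generalizing x with
  | nil => simp at hhead
  | cons x' W ih =>
    obtain rfl : x' = x := by simpa using hhead
    cases W with
    | nil =>
      obtain rfl : x' = z := by simpa using hlast
      exact absurd hz (hUP _ hx)
    | cons y W =>
      obtain ⟨⟨-, hxy⟩, hW⟩ := isWalk_cons_cons.1 hW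
      have hlast' : (y :: W).getLast? = some z := by simpa using hlast
      rw [walkLength, ENNReal.ofReal_add dist_nonneg (walkLength_nonneg _)]
      rcases hstep x' hx y hxy with ⟨hy, h1⟩ | h1
      · refine (ENNReal.ofReal_le_ofReal h1).trans (ENNReal.ofReal_add_le.trans ?_)
        exact add_le_add le_rfl (ih hy hW rfl hlast')
      · refine h1.trans ?_
        gcongr
        exact setDist_le_of_walk hW rfl hlast' hz

/-! ### Distances to a set of points which is close to all points -/

section covering

variable (hcov : ∀ x ∈ points G, setDist G P x ≤ ENNReal.ofReal δ)
include hcov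

theorem ofReal_toReal_setDist (hx : x ∈ points G) :
    ENNReal.ofReal (setDist G P x).toReal = setDist G P x :=
  ENNReal.ofReal_toReal ((hcov x hx).trans_lt ENNReal.ofReal_lt_top).ne

theorem toReal_setDist_le (hδ : 0 ≤ δ) (hx : x ∈ points G) : (setDist G P x).toReal ≤ δ :=
  ENNReal.toReal_le_of_le_ofReal hδ (hcov x hx)

theorem toReal_setDist_le_add (huv : G.Adj u v) (hs : s ∈ Set.Icc (0 : ℝ) 1)
    (ht : t ∈ Set.Icc (0 : ℝ) 1) :
    (setDist G P (pt u v s)).toReal ≤ |s - t| + (setDist G P (pt u v t)).toReal := by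
  have h := setDist_pt_le_add (P := P) huv hs ht
  rw [← ofReal_toReal_setDist hcov (pt_mem_points huv ht), ← ENNReal.ofReal_add (abs_nonneg _)
    ENNReal.toReal_nonneg] at h
  exact ENNReal.toReal_le_of_le_ofReal (add_nonneg (abs_nonneg _) ENNReal.toReal_nonneg) h

/-- The distances at the ends of an edge segment without points of `P` satisfy the inequality
which says that the middle of the segment is close to `P`. -/
theorem gap_le (hδ : 0 ≤ δ) (huv : G.Adj u v) {α β : ℝ} (hα : 0 ≤ α) (hαβ : α < β) (hβ : β ≤ 1)
    (hgap : ∀ t, α < t → t < β → pt u v t ∉ P) :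
    β - α + (setDist G P (pt u v α)).toReal + (setDist G P (pt u v β)).toReal ≤ 2 * δ := by
  set f : ℝ → ℝ := fun t => (setDist G P (pt u v t)).toReal with hf
  have hα' : α ∈ Set.Icc (0 : ℝ) 1 := ⟨hα, by linarith⟩
  have hβ' : β ∈ Set.Icc (0 : ℝ) 1 := ⟨by linarith, hβ⟩
  have h1 : f α ≤ |α - β| + f β := toReal_setDist_le_add hcov huv hα' hβ'
  have h2 : f β ≤ |β - α| + f α := toReal_setDist_le_add hcov huv hβ' hα'
  rw [abs_of_nonpos (by linarith)] at h1
  rw [abs_of_nonneg (by linarith)] at h2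
  have h3 : f α ≤ δ := toReal_setDist_le hcov hδ (pt_mem_points huv hα')
  have h4 : f β ≤ δ := toReal_setDist_le hcov hδ (pt_mem_points huv hβ')
  change β - α + f α + f β ≤ 2 * δ
  -- The point of the segment for which the routes over both ends are equally long; it is the point
  -- farthest from `P`.
  set t₀ := (α + β + f β - f α) / 2 with ht₀
  -- If `t₀` is an end of the segment, the claim says that twice the value of `f` at this end is at
  -- most `2 * δ`.
  rcases eq_or_lt_of_le (show α ≤ t₀ by linarith) with h5 | h5
  · linarith
  rcases eq_or_lt_of_le (show t₀ ≤ β by linarith) with h6 | h6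
  · linarith
  -- The length of the shorter of the two routes. It is a lower bound for the distance, since a walk
  -- to `P` has to leave the segment over one of its ends.
  set ψ : (V → ℝ) → ℝ := fun x => min (f α + (x v - α)) (f β + (β - x v)) with hψ
  have hψt : ∀ t, ψ (pt u v t) = min (f α + (t - α)) (f β + (β - t)) := fun t => by
    simp only [hψ, pt_apply_right huv.ne]
  have key := le_setDist_of_step (P := P) (G := G) (U := {x | ∃ t, α < t ∧ t < β ∧ x = pt u v t})
    (ψ := ψ) (x := pt u v t₀) ?_ ?_ ⟨t₀, h5, h6, rfl⟩
  · have h7 : f α + (t₀ - α) = f β + (β - t₀) := by linarith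
    have h8 := key.trans (hcov _ (pt_mem_points huv ⟨by linarith, by linarith⟩))
    rw [hψt, h7, min_self, ENNReal.ofReal_le_ofReal_iff hδ] at h8
    linarith
  · rintro x ⟨t, ht1, ht2, rfl⟩
    exact hgap t ht1 ht2
  · rintro x ⟨t, ht1, ht2, rfl⟩ y hy
    obtain ⟨s, hs, rfl⟩ := hy.of_pt huv (by linarith) (by linarith)
    rw [dist_pt huv.ne, hψt]
    rw [← ofReal_toReal_setDist hcov (pt_mem_points huv hs), ← ENNReal.ofReal_add (abs_nonneg _)
      ENNReal.toReal_nonneg]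
    by_cases hs1 : s ≤ α
    · right
      have h9 : f α ≤ |α - s| + f s := toReal_setDist_le_add hcov huv hα' hs
      rw [abs_of_nonneg (by linarith)] at h9
      rw [abs_of_nonneg (by linarith)]
      refine ENNReal.ofReal_le_ofReal ((min_le_left _ _).trans ?_)
      change _ ≤ t - s + f s
      linarith
    by_cases hs2 : β ≤ s
    · right
      have h9 : f β ≤ |β - s| + f s := toReal_setDist_le_add hcov huv hβ' hs
      rw [abs_of_nonpos (by linarith)] at h9
      rw [abs_of_nonpos (by linarith)]
      refine ENNReal.ofReal_le_ofReal ((min_le_right _ _).trans ?_)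
      change _ ≤ -(t - s) + f s
      linarith
    · left
      push Not at hs1 hs2
      refine ⟨⟨s, hs1, hs2, rfl⟩, ?_⟩
      rw [hψt]
      have h9 := le_abs_self (t - s)
      have h10 := neg_abs_le (t - s)
      rcases min_cases (f α + (s - α)) (f β + (β - s)) with h11 | h11
      · rw [h11.1]
        exact (min_le_left _ _).trans (by linarith)
      · rw [h11.1]
        exact (min_le_right _ _).trans (by linarith)

/-- The distance of a vertex to `P` is attained at one of the edges of the vertex; `g v` is the
length of an initial segment of the edge `wv` without points of `P`. -/
theorem exists_add_le_setDist (w : V) {g : V → ℝ} (hg : ∀ v, G.Adj w v → 0 < g v ∧ g v ≤ 1)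
    (hwP : vtx w ∉ P) (hgap : ∀ v, G.Adj w v → ∀ t, 0 ≤ t → t < g v → pt w v t ∉ P) :
    ∃ v, G.Adj w v ∧
      (setDist G P (pt w v (g v))).toReal + g v ≤ (setDist G P (vtx w)).toReal := by
  classical
  by_contra hne
  push Not at hne
  set c := (setDist G P (vtx w)).toReal with hc
  have : Nonempty V := ⟨w⟩
  -- The default `c + 1` for vertices that are not neighbors keeps the minimum above `c`, also if
  -- `w` is isolated.
  obtain ⟨v₀, hv₀⟩ := Finite.exists_min fun v =>
    if G.Adj w v then (setDist G P (pt w v (g v))).toReal + g v else c + 1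
  set q := if G.Adj w v₀ then (setDist G P (pt w v₀ (g v₀))).toReal + g v₀ else c + 1 with hq
  have hcq : c < q := by
    rw [hq]
    split_ifs with h
    · exact hne _ h
    · linarith
  have hqv : ∀ v, G.Adj w v → q ≤ (setDist G P (pt w v (g v))).toReal + g v := fun v hv => by
    simpa [hv] using hv₀ v
  -- On the star of the free segments around `w`, the quantity `1 - x w` is the distance already
  -- covered. A walk leaving the star has total length at least `q`, which contradicts `c < q`.
  set ψ : (V → ℝ) → ℝ := fun x => q - (1 - x w) with hψ
  have hψt : ∀ v, G.Adj w v → ∀ t, ψ (pt w v t) = q - t := fun v hv t => by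
    simp only [hψ, pt_apply_left hv.ne]
    ring
  set U : Set (V → ℝ) := {x | x = vtx w ∨ ∃ v, G.Adj w v ∧ ∃ t, 0 ≤ t ∧ t < g v ∧ x = pt w v t}
    with hU
  have key := le_setDist_of_step (P := P) (G := G) (U := U) (ψ := ψ) (x := vtx w) ?_ ?_ (.inl rfl)
  · have h1 : ψ (vtx w) = q := by simp [hψ, vtx]
    rw [h1, ← ofReal_toReal_setDist hcov (vtx_mem_points w),
      ENNReal.ofReal_le_ofReal_iff ENNReal.toReal_nonneg] at key
    linarith
  · rintro x (rfl | ⟨v, hv, t, ht0, ht1, rfl⟩)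
    exacts [hwP, hgap v hv t ht0 ht1]
  · have step : ∀ v, G.Adj w v → ∀ t, 0 ≤ t → t < g v → ∀ s ∈ Set.Icc (0 : ℝ) 1,
        (pt w v s ∈ U ∧ ψ (pt w v t) ≤ dist (pt w v t) (pt w v s) + ψ (pt w v s)) ∨
        ENNReal.ofReal (ψ (pt w v t)) ≤
          ENNReal.ofReal (dist (pt w v t) (pt w v s)) + setDist G P (pt w v s) := by
      intro v hv t ht0 ht1 s hs
      rw [hψt v hv, hψt v hv, dist_pt hv.ne]
      by_cases hsg : s < g v
      · refine .inl ⟨.inr ⟨v, hv, s, hs.1, hsg, rfl⟩, ?_⟩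
        linarith [neg_abs_le (t - s)]
      · right
        push Not at hsg
        obtain ⟨hg0, hg1⟩ := hg v hv
        have h1 := toReal_setDist_le_add hcov hv ⟨hg0.le, hg1⟩ hs
        have h2 := hqv v hv
        rw [abs_of_nonpos (by linarith)] at h1
        rw [abs_of_nonpos (by linarith), ← ofReal_toReal_setDist hcov (pt_mem_points hv hs),
          ← ENNReal.ofReal_add (by linarith) ENNReal.toReal_nonneg]
        exact ENNReal.ofReal_le_ofReal (by linarith)
    rintro x hx y hxy
    rcases hx with rfl | ⟨v, hv, t, ht0, ht1, rfl⟩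
    · obtain ⟨v, hv, s, hs, rfl⟩ := hxy.of_vtx
      rw [← pt_zero w v]
      exact step v hv 0 le_rfl (hg v hv).1 s hs
    · rcases eq_or_lt_of_le ht0 with rfl | ht0
      · rw [pt_zero] at hxy
        obtain ⟨v', hv', s, hs, rfl⟩ := hxy.of_vtx
        rw [pt_zero, ← pt_zero w v']
        exact step v' hv' 0 le_rfl (hg v' hv').1 s hs
      · obtain ⟨s, hs, rfl⟩ := hxy.of_pt hv ht0 (by linarith [(hg v hv).2])
        exact step v hv t ht0.le ht1 s hs

end covering

end GraphTour

/-! ## Feasibility and coverage -/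

namespace GraphTour

variable {V : Type*} [DecidableEq V] [Fintype V] {G : SimpleGraph V} {u v w : V} {s t δ β : ℝ}
  {x y z : V → ℝ} {P : Set (V → ℝ)} {S : V → Prop} {L X : V → V → Prop} {a : V → V → ℝ} {r : V → ℝ}

/-- Following the witnesses from `z` leads to the tour: each step to a neighbor lowers `r` by at
least `1`, and `r` is nonnegative. Hence the induction on an integer above `r z`. -/
theorem setDist_vtx_le (hf : IsFeasible G.Adj Finset.univ S L X δ β a r)
    (hLadj : ∀ u v, L u v → G.Adj u v) (hS : ∀ v, S v → vtx v ∈ P)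
    (hL : ∀ u v, L u v → pt u v (a u v) ∈ P) (z : V) :
    setDist G P (vtx z) ≤ ENNReal.ofReal (r z) := by
  have key : ∀ n : ℕ, ∀ z, r z < n → setDist G P (vtx z) ≤ ENNReal.ofReal (r z) := by
    intro n
    induction n with
    | zero =>
      intro z hz
      have := hf.r_nonneg z
      simp at hz
      linarith
    | succ n ih =>
      intro z hz
      rcases hf.witness z (Finset.mem_univ _) with h1 | ⟨v, -, h1, h2⟩ | ⟨x, -, h1, h2⟩
      · rw [setDist_eq_zero (vtx_mem_points z) (hS z h1)]
        exact zero_le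
      · have hadj := hLadj _ _ h1
        have ha : a v z ∈ Set.Icc (0 : ℝ) 1 := ⟨hf.a_nonneg _ _, hf.a_le_one _ _⟩
        have h3 := setDist_pt_le_add (P := P) hadj (s := 1) (by simp) ha
        rw [setDist_eq_zero (pt_mem_points hadj ha) (hL _ _ h1), pt_one, add_zero,
          abs_of_nonneg (by linarith [ha.2])] at h3
        exact h3.trans (ENNReal.ofReal_le_ofReal h2)
      · have h3 := setDist_pt_le_add (P := P) h1 (s := 1) (t := 0) (by simp) (by simp)
        rw [pt_one, pt_zero] at h3
        have h4 := ih x (by push_cast at hz; linarith)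
        refine h3.trans ((add_le_add le_rfl h4).trans ?_)
        rw [← ENNReal.ofReal_add (abs_nonneg _) (hf.r_nonneg x)]
        refine ENNReal.ofReal_le_ofReal ?_
        norm_num
        linarith
  obtain ⟨n, hn⟩ := exists_nat_gt (r z)
  exact key n z hn

/-- A point `t` of an edge that no peek covers has distance at most `t - a u v + r u` over one end
and at most `1 - t - a v u + r v` over the other. By the inequality of the edge these sum up to at
most `2 * δ`, so one of them is at most `δ`. -/
theorem setDist_le_of_isFeasible (hf : IsFeasible G.Adj Finset.univ S L X δ β a r)
    (hLadj : ∀ u v, L u v → G.Adj u v) (hS : ∀ v, S v → vtx v ∈ P)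
    (hL : ∀ u v, L u v → pt u v (a u v) ∈ P) (hXs : ∀ u v, X u v → X v u)
    (hLX : ∀ u v t, ¬ X u v → L u v → 0 ≤ t → t ≤ a u v → pt u v t ∈ P)
    (hX : ∀ u v t, G.Adj u v → X u v → t ∈ Set.Icc (0 : ℝ) 1 →
      setDist G P (pt u v t) ≤ ENNReal.ofReal δ) (hx : x ∈ points G) :
    setDist G P x ≤ ENNReal.ofReal δ := by
  have hvtx := setDist_vtx_le hf hLadj hS hL
  rcases hx with ⟨u, rfl⟩ | ⟨u, v, huv, t, ht, rfl⟩
  · exact (hvtx u).trans (ENNReal.ofReal_le_ofReal (hf.r_le u (Finset.mem_univ _)))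
  by_cases hXuv : X u v
  · exact hX u v t huv hXuv ht
  have hδ : 0 ≤ δ := (hf.r_nonneg u).trans (hf.r_le u (Finset.mem_univ _))
  have side : ∀ u v t, G.Adj u v → ¬ X u v → t ∈ Set.Icc (0 : ℝ) 1 →
      setDist G P (pt u v t) ≤ ENNReal.ofReal δ ∨ (0 ≤ t - a u v + r u ∧
        setDist G P (pt u v t) ≤ ENNReal.ofReal (t - a u v + r u)) := by
    intro u v t huv hXuv ht
    have ha : a u v ∈ Set.Icc (0 : ℝ) 1 := ⟨hf.a_nonneg _ _, hf.a_le_one _ _⟩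
    have hr := hf.r_nonneg u
    by_cases hLuv : L u v
    · by_cases hta : t ≤ a u v
      · left
        rw [setDist_eq_zero (pt_mem_points huv ht) (hLX u v t hXuv hLuv ht.1 hta)]
        exact zero_le
      · right
        push Not at hta
        refine ⟨by linarith, ?_⟩
        have h3 := setDist_pt_le_add (P := P) huv ht ha
        rw [setDist_eq_zero (pt_mem_points huv ha) (hL _ _ hLuv), add_zero,
          abs_of_nonneg (by linarith)] at h3
        exact h3.trans (ENNReal.ofReal_le_ofReal (by linarith))
    · right
      rw [hf.a_zero _ _ hLuv]
      refine ⟨by linarith [ht.1], ?_⟩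
      have h3 := setDist_pt_le_add (P := P) huv ht (t := 0) (by simp)
      rw [pt_zero, sub_zero, abs_of_nonneg ht.1] at h3
      refine h3.trans ((add_le_add le_rfl (hvtx u)).trans ?_)
      rw [← ENNReal.ofReal_add ht.1 hr, sub_zero]
  have hedge := (hf.edge u (Finset.mem_univ _) v (Finset.mem_univ _) huv).resolve_left hXuv
  rcases side u v t huv hXuv ht with h1 | ⟨h1, h1'⟩
  · exact h1
  rcases side v u (1 - t) huv.symm (fun h => hXuv (hXs _ _ h)) (one_sub_mem ht) with h2 | ⟨h2, h2'⟩
  · rwa [← pt_symm] at h2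
  rw [← pt_symm] at h2'
  by_cases h3 : t - a u v + r u ≤ δ
  · exact h1'.trans (ENNReal.ofReal_le_ofReal h3)
  · exact h2'.trans (ENNReal.ofReal_le_ofReal (by linarith))

/-! ### Tours that visit a vertex -/

variable {m : ℕ} {q : ℕ → V}

/-- The points passed by a closed walk with peeks. -/
def cover (G : SimpleGraph V) (m : ℕ) (q : ℕ → V) (a : V → V → ℝ) : Set (V → ℝ) :=
  {x | (∃ v, Visits m q v ∧ x = vtx v) ∨
    (∃ u v, Traverses m q u v ∧ ∃ t ∈ Set.Icc (0 : ℝ) 1, x = pt u v t) ∨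
    ∃ u v, Visits m q u ∧ G.Adj u v ∧ ∃ t, 0 ≤ t ∧ t ≤ a u v ∧ x = pt u v t}

omit [DecidableEq V] [Fintype V] in
theorem Traverses.symm (h : Traverses m q u v) : Traverses m q v u := by
  obtain ⟨i, hi, h⟩ := h
  exact ⟨i, hi, h.symm⟩

omit [DecidableEq V] [Fintype V] in
theorem Traverses.visits (h : Traverses m q u v) : Visits m q u ∧ Visits m q v := by
  obtain ⟨i, hi, ⟨rfl, rfl⟩ | ⟨rfl, rfl⟩⟩ := h
  · exact ⟨⟨i, hi.le, rfl⟩, ⟨i + 1, hi, rfl⟩⟩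
  · exact ⟨⟨i + 1, hi, rfl⟩, ⟨i, hi.le, rfl⟩⟩

omit [DecidableEq V] [Fintype V] in
theorem Traverses.adj (hq : ∀ i < m, G.Adj (q i) (q (i + 1))) (h : Traverses m q u v) :
    G.Adj u v := by
  obtain ⟨i, hi, ⟨rfl, rfl⟩ | ⟨rfl, rfl⟩⟩ := h
  exacts [hq i hi, (hq i hi).symm]

omit [Fintype V] in
theorem vtx_mem_cover (hq : ∀ i < m, G.Adj (q i) (q (i + 1))) (h : vtx w ∈ cover G m q a) :
    Visits m q w ∨ ∃ u, Visits m q u ∧ G.Adj u w ∧ 1 ≤ a u w := by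
  rcases h with ⟨v, h1, h2⟩ | ⟨u, v, h1, t, ht, h2⟩ | ⟨u, v, h1, huv, t, ht0, ht1, h2⟩
  · exact .inl (vtx_injective h2 ▸ h1)
  · rcases vtx_eq_pt (h1.adj hq).ne h2 with ⟨rfl, -⟩ | ⟨rfl, -⟩
    exacts [.inl h1.visits.1, .inl h1.visits.2]
  · rcases vtx_eq_pt huv.ne h2 with ⟨rfl, -⟩ | ⟨rfl, rfl⟩
    exacts [.inl h1, .inr ⟨u, h1, huv, ht1⟩]

omit [Fintype V] in
theorem pt_mem_cover (hq : ∀ i < m, G.Adj (q i) (q (i + 1))) (huv : G.Adj u v) (ht0 : 0 < t)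
    (ht1 : t < 1) (h : pt u v t ∈ cover G m q a) :
    Traverses m q u v ∨ (Visits m q u ∧ t ≤ a u v) ∨ (Visits m q v ∧ 1 - t ≤ a v u) := by
  rcases h with ⟨w, h1, h2⟩ | ⟨u', v', h1, s, hs, h2⟩ | ⟨u', v', h1, huv', s, hs0, hs1, h2⟩
  · rcases vtx_eq_pt huv.ne h2.symm with ⟨-, rfl⟩ | ⟨-, rfl⟩
    · exact absurd ht0 (lt_irrefl _)
    · exact absurd ht1 (lt_irrefl _)
  · rcases pt_eq_pt huv.ne (h1.adj hq).ne ht0 ht1 h2 with ⟨rfl, rfl, -⟩ | ⟨rfl, rfl, -⟩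
    exacts [.inl h1, .inl h1.symm]
  · rcases pt_eq_pt huv.ne huv'.ne ht0 ht1 h2 with ⟨rfl, rfl, rfl⟩ | ⟨rfl, rfl, rfl⟩
    exacts [.inr (.inl ⟨h1, hs1⟩), .inr (.inr ⟨h1, hs1⟩)]

/-- The true distances serve as `r`. Witnesses exist because the distance of a vertex is attained
along one of its edges (`exists_add_le_setDist`), and the inequality of an edge is `gap_le` for the
part between the peeks. -/
theorem isFeasible_of_cover (hq : IsClosedWalk G.Adj Finset.univ m q) (hδ : 0 ≤ δ)
    (ha0 : ∀ u v, 0 ≤ a u v) (ha1 : ∀ u v, a u v ≤ 1)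
    (haz : ∀ u v, ¬ Peek G.Adj Finset.univ m q u v → a u v = 0)
    (hcost : 2 * ∑ u, ∑ v, a u v ≤ β)
    (hcov : ∀ x ∈ points G, setDist G (cover G m q a) x ≤ ENNReal.ofReal δ) :
    IsFeasible G.Adj Finset.univ (Visits m q) (Peek G.Adj Finset.univ m q) (Traverses m q) δ β a
      fun v => (setDist G (cover G m q a) (vtx v)).toReal := by
  set P := cover G m q a with hP
  have hd0 : ∀ {x}, 0 ≤ (setDist G P x).toReal := ENNReal.toReal_nonneg
  have hmem : ∀ v, Visits m q v → vtx v ∈ P := fun v hv => .inl ⟨v, hv, rfl⟩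
  -- Either `u` is visited and both distances are `0`, or the peek has depth `0` and both points
  -- agree.
  have hend : ∀ u v, G.Adj u v →
      (setDist G P (pt u v (a u v))).toReal = (setDist G P (vtx u)).toReal := by
    intro u v huv
    by_cases hu : Visits m q u
    · rw [setDist_eq_zero (pt_mem_points huv ⟨ha0 _ _, ha1 _ _⟩)
        (.inr (.inr ⟨u, v, hu, huv, _, ha0 _ _, le_rfl, rfl⟩)),
        setDist_eq_zero (vtx_mem_points u) (hmem u hu)]
    · rw [haz u v fun h => hu h.1, pt_zero]
  refine ⟨ha0, ha1, haz, fun _ => hd0, fun u _ => toReal_setDist_le hcov hδ (vtx_mem_points u),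
    fun z _ => ?_, fun u _ v _ huv => ?_, hcost⟩
  · by_cases hz : Visits m q z
    · exact .inl hz
    right
    by_cases hfull : ∃ v, Visits m q v ∧ G.Adj v z ∧ 1 ≤ a v z
    · obtain ⟨v, h1, h2, h3⟩ := hfull
      exact .inl ⟨v, Finset.mem_univ _, ⟨h1, Finset.mem_univ _, h2⟩,
        by linarith [hd0 (x := vtx z)]⟩
    push Not at hfull
    have hfull' : ∀ v, G.Adj z v → a v z < 1 := fun v hv => by
      by_cases hv' : Visits m q v
      · exact hfull v hv' hv.symm
      · rw [haz v z fun h => hv' h.1]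
        norm_num
    have hnz : vtx z ∉ P := fun h => by
      rcases vtx_mem_cover hq.2.1 h with h | ⟨v, h1, h2, h3⟩
      exacts [hz h, absurd h3 (not_le.2 (hfull v h1 h2))]
    -- Seen from the unvisited vertex `z`, the edge to `v` is free of the tour up to the end of the
    -- peek from `v`.
    obtain ⟨v, hzv, h1⟩ := exists_add_le_setDist hcov z (g := fun v => 1 - a v z)
      (fun v hv => ⟨by linarith [hfull' v hv], by linarith [ha0 v z]⟩) hnz
      fun v hv t ht0 ht1 h => by
        rcases eq_or_lt_of_le ht0 with rfl | ht0
        · rw [pt_zero] at h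
          exact hnz h
        · rcases pt_mem_cover hq.2.1 hv ht0 (by linarith [ha0 v z]) h with h | h | h
          exacts [hz h.visits.1, hz h.1, by linarith [h.2]]
    rw [← pt_symm, hend v z hzv.symm] at h1
    by_cases hv : Visits m q v
    · exact .inl ⟨v, Finset.mem_univ _, ⟨hv, Finset.mem_univ _, hzv.symm⟩,
        by linarith [hd0 (x := vtx v)]⟩
    · rw [haz v z fun h => hv h.1] at h1
      exact .inr ⟨v, Finset.mem_univ _, hzv.symm, by linarith⟩
  · by_cases hX : Traverses m q u v
    · exact .inl hX
    right
    have hu := toReal_setDist_le hcov hδ (vtx_mem_points u)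
    have hv := toReal_setDist_le hcov hδ (vtx_mem_points v)
    -- If the peeks from both sides meet, the inequality of the edge follows from `r ≤ δ` at both
    -- ends.
    by_cases hlt : a u v < 1 - a v u
    · have h1 := gap_le hcov hδ huv (ha0 u v) hlt (by linarith [ha0 v u]) fun t ht0 ht1 h => ?_
      · rw [hend u v huv, ← pt_symm, hend v u huv.symm] at h1
        linarith
      · rcases pt_mem_cover hq.2.1 huv (by linarith [ha0 u v]) (by linarith [ha0 v u]) h with
          h | h | h
        exacts [hX h, by linarith [h.2], by linarith [h.2]]
    · linarith

/-! ### Tours within an edge -/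

/-- A segment of an edge. -/
def edgeSeg (u v : V) (α β : ℝ) : Set (V → ℝ) := {x | ∃ t, α ≤ t ∧ t ≤ β ∧ x = pt u v t}

omit [Fintype V] in
theorem edgeSeg_symm (u v : V) (α β : ℝ) : edgeSeg u v α β = edgeSeg v u (1 - β) (1 - α) := by
  have key : ∀ (u v : V) (α β : ℝ), edgeSeg u v α β ⊆ edgeSeg v u (1 - β) (1 - α) := by
    rintro u v α β x ⟨t, h1, h2, rfl⟩
    exact ⟨1 - t, by linarith, by linarith, pt_symm _ _ _⟩
  refine (key u v α β).antisymm ((key v u _ _).trans_eq ?_)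
  simp

/-- From `u` the segment is reached either directly, along the edge, or by way of another neighbor.
The first alternative is what a peek of depth `1 - α` from `v` towards `u` requires. -/
theorem exists_of_edgeSeg {α β : ℝ} (huv : G.Adj u v) (hα : 0 ≤ α) (hα1 : α ≤ 1)
    (hcov : ∀ x ∈ points G, setDist G (edgeSeg u v α β) x ≤ ENNReal.ofReal δ) :
    α ≤ (setDist G (edgeSeg u v α β) (vtx u)).toReal ∨ ∃ x, G.Adj x u ∧
      (setDist G (edgeSeg u v α β) (vtx x)).toReal + 1 ≤
        (setDist G (edgeSeg u v α β) (vtx u)).toReal := by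
  rcases eq_or_lt_of_le hα with rfl | hα
  · exact .inl ENNReal.toReal_nonneg
  have hu : vtx u ∉ edgeSeg u v α β := by
    rintro ⟨s, hs1, hs2, h⟩
    rcases vtx_eq_pt huv.ne h with ⟨-, rfl⟩ | ⟨h, -⟩
    exacts [by linarith, huv.ne h]
  obtain ⟨x, hx, h⟩ := exists_add_le_setDist hcov u (g := fun x => if x = v then α else 1)
    (fun x hx => by split_ifs <;> constructor <;> linarith) hu fun x hx t ht0 ht1 => by
      rcases eq_or_lt_of_le ht0 with rfl | ht0
      · rwa [pt_zero]
      have ht : t < 1 := ht1.trans_le (by split_ifs <;> linarith)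
      rintro ⟨s, hs1, hs2, h⟩
      rcases pt_eq_pt hx.ne huv.ne ht0 ht h with ⟨-, rfl, rfl⟩ | ⟨rfl, -, -⟩
      · rw [if_pos rfl] at ht1
        linarith
      · exact hx.ne rfl
  by_cases hxv : x = v
  · simp only [hxv, if_true] at h
    exact .inl (by linarith [ENNReal.toReal_nonneg (a := setDist G (edgeSeg u v α β) (pt u v α))])
  · simp only [hxv, if_false, pt_one] at h
    exact .inr ⟨x, hx.symm, h⟩

/-- The segment is encoded by a peek of depth `κ` from `u` and one of depth `1 - α` from `v`.
Together they exceed the length of the segment by `1`, whence the surplus `2` in the budget. -/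
theorem isFeasible_of_edgeSeg {α κ : ℝ} (huv : G.Adj u v) (hα : 0 ≤ α) (hαβ : α ≤ κ) (hκ : κ ≤ 1)
    (hδ : 0 ≤ δ) (hcost : 2 * (κ - α) + 2 ≤ β)
    (hcov : ∀ x ∈ points G, setDist G (edgeSeg u v α κ) x ≤ ENNReal.ofReal δ) :
    Feasible G.Adj Finset.univ (fun _ => False) (IsPair u v) (IsPair u v) δ β := by
  set P := edgeSeg u v α κ with hP
  have hne := huv.ne
  set a : V → V → ℝ := fun p q => (if p = u ∧ q = v then κ else 0) +
    (if p = v ∧ q = u then 1 - α else 0) with ha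
  have hauv : a u v = κ := by simp [ha, hne]
  have havu : a v u = 1 - α := by simp [ha, hne.symm]
  have haz : ∀ p q, ¬ IsPair u v p q → a p q = 0 := fun p q h => by
    simp only [IsPair, not_or] at h
    simp [ha, h.1, h.2]
  have hcases : ∀ p q, a p q = κ ∨ a p q = 1 - α ∨ a p q = 0 := fun p q => by
    by_cases h : IsPair u v p q
    · rcases h with ⟨rfl, rfl⟩ | ⟨rfl, rfl⟩
      exacts [.inl hauv, .inr (.inl havu)]
    · exact .inr (.inr (haz p q h))
  refine ⟨a, fun z => (setDist G P (vtx z)).toReal, ⟨fun p q => ?_, fun p q => ?_, haz,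
    fun _ => ENNReal.toReal_nonneg, fun z _ => toReal_setDist_le hcov hδ (vtx_mem_points z),
    fun z _ => .inr ?_, fun p _ q _ hpq => ?_, ?_⟩⟩
  · rcases hcases p q with h | h | h <;> rw [h] <;> linarith
  · rcases hcases p q with h | h | h <;> rw [h] <;> linarith
  · by_cases hzu : z = u
    · subst hzu
      refine (exists_of_edgeSeg huv hα (by linarith) hcov).imp (fun h => ?_) fun h => ?_
      · exact ⟨v, Finset.mem_univ _, .inr ⟨rfl, rfl⟩, by rw [havu]; linarith⟩
      · obtain ⟨x, h1, h2⟩ := h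
        exact ⟨x, Finset.mem_univ _, h1, h2⟩
    by_cases hzv : z = v
    · subst hzv
      rw [hP, edgeSeg_symm] at hcov ⊢
      refine (exists_of_edgeSeg huv.symm (by linarith) (by linarith) hcov).imp (fun h => ?_)
        fun h => ?_
      · exact ⟨u, Finset.mem_univ _, .inl ⟨rfl, rfl⟩, by rw [hauv]; linarith⟩
      · obtain ⟨x, h1, h2⟩ := h
        exact ⟨x, Finset.mem_univ _, h1, h2⟩
    · right
      have hz : vtx z ∉ P := by
        rintro ⟨s, hs1, hs2, h⟩
        rcases vtx_eq_pt huv.ne h with ⟨h, -⟩ | ⟨h, -⟩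
        exacts [hzu h, hzv h]
      obtain ⟨x, hx, h⟩ := exists_add_le_setDist hcov z (g := fun _ => 1)
        (fun x hx => by norm_num) hz fun x hx t ht0 ht1 => by
          rcases eq_or_lt_of_le ht0 with rfl | ht0
          · rwa [pt_zero]
          rintro ⟨s, hs1, hs2, h⟩
          rcases pt_eq_pt hx.ne huv.ne ht0 ht1 h with ⟨h, -⟩ | ⟨-, h, -⟩
          exacts [hzu h.symm, hzv h.symm]
      rw [pt_one] at h
      exact ⟨x, Finset.mem_univ _, hx.symm, h⟩
  · by_cases hX : IsPair u v p q
    · exact .inl hX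
    right
    have h1 := gap_le hcov hδ hpq (α := 0) (β := 1) le_rfl one_pos le_rfl fun t ht0 ht1 => by
      rintro ⟨s, hs1, hs2, h⟩
      rcases pt_eq_pt hpq.ne huv.ne ht0 ht1 h with ⟨rfl, rfl, -⟩ | ⟨rfl, rfl, -⟩
      exacts [hX (.inl ⟨rfl, rfl⟩), hX (.inr ⟨rfl, rfl⟩)]
    rw [pt_zero, pt_one] at h1
    have hX' : ¬ IsPair u v q p := by
      rintro (⟨rfl, rfl⟩ | ⟨rfl, rfl⟩)
      exacts [hX (.inr ⟨rfl, rfl⟩), hX (.inl ⟨rfl, rfl⟩)]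
    rw [haz p q hX, haz q p hX']
    linarith
  · have : ∑ p, ∑ q, a p q = κ + (1 - α) := by
      simp only [ha, Finset.sum_add_distrib]
      congr 1
      · rw [Finset.sum_eq_single u, Finset.sum_eq_single v] <;> simp +contextual
      · rw [Finset.sum_eq_single v, Finset.sum_eq_single u] <;> simp +contextual
    rw [this]
    linarith

end GraphTour

/-! ## Tours and solutions -/

namespace GraphTour

variable {V : Type*} [DecidableEq V] [Fintype V] {G : SimpleGraph V} {u v w : V} {s t δ K : ℝ}
  {x y z : V → ℝ} {P : Set (V → ℝ)} {T : List (V → ℝ)} {m : ℕ} {q : ℕ → V} {a : V → V → ℝ}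

/-! ### From solutions to tours -/

omit [Fintype V] in
theorem pt_mem_segment {r : ℝ} (h1 : s ≤ r) (h2 : r ≤ t) :
    pt u v r ∈ segment ℝ (pt u v s) (pt u v t) := by
  rw [segment_pt]
  exact ⟨r, (min_le_left _ _).trans h1, h2.trans (le_max_right _ _), rfl⟩

omit [DecidableEq V] [Fintype V] in
theorem mem_passed (h : x ∈ T) : x ∈ passed T := .inl h

theorem exists_walk_of_adj (m : ℕ) : ∀ q : ℕ → V, (∀ i < m, G.Adj (q i) (q (i + 1))) →
    ∃ L, IsWalk G (vtx (q 0) :: L) ∧ (vtx (q 0) :: L).getLast? = some (vtx (q m)) ∧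
      walkLength (vtx (q 0) :: L) = m ∧ (∀ i ≤ m, vtx (q i) ∈ vtx (q 0) :: L) ∧
      ∀ i < m, ∀ t ∈ Set.Icc (0 : ℝ) 1, pt (q i) (q (i + 1)) t ∈ passed (vtx (q 0) :: L) := by
  induction m with
  | zero =>
    refine fun q _ => ⟨[], isWalk_singleton (vtx_mem_points _), rfl, by simp [walkLength],
      fun i hi => ?_, fun i hi => absurd hi (by simp)⟩
    obtain rfl : i = 0 := by omega
    simp
  | succ m ih =>
    intro q hq
    obtain ⟨L, h1, h2, h3, h4, h5⟩ := ih (fun i => q (i + 1)) fun i hi => hq (i + 1) (by omega)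
    have hadj : G.Adj (q 0) (q (0 + 1)) := hq 0 (by omega)
    refine ⟨vtx (q (0 + 1)) :: L, isWalk_cons_cons.2 ⟨⟨fun h => hadj.ne (vtx_injective h), ?_⟩, h1⟩,
      ?_, ?_, fun i hi => ?_, fun i hi t ht => ?_⟩
    · rw [← pt_zero _ (q (0 + 1)), ← pt_one (q 0) (q (0 + 1))]
      exact onCommonEdge_pt hadj (by simp) (by simp)
    · rw [List.getLast?_cons_cons]
      exact h2
    · have hd := dist_pt hadj.ne 0 1
      rw [pt_zero, pt_one] at hd
      rw [walkLength, hd, h3]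
      norm_num
      ring
    · cases i with
      | zero => simp
      | succ i => exact List.mem_cons_of_mem _ (h4 i (by omega))
    · rw [passed_cons_cons]
      cases i with
      | zero =>
        left
        rw [← pt_zero _ (q (0 + 1)), ← pt_one (q 0) (q (0 + 1))]
        exact pt_mem_segment ht.1 ht.2
      | succ i => exact .inr (h5 i (by omega) t ht)

/-- At an occurrence of `u`, the detour to the point at depth `c` and back is inserted. -/
theorem exists_insert_peek {c : ℝ} (hT : IsTour G T) (hu : vtx u ∈ T) (huv : G.Adj u v)
    (hc0 : 0 ≤ c) (hc1 : c ≤ 1) :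
    ∃ T', IsTour G T' ∧ walkLength T' = walkLength T + 2 * c ∧ (∀ x ∈ T, x ∈ T') ∧
      passed T ⊆ passed T' ∧ ∀ t, 0 ≤ t → t ≤ c → pt u v t ∈ passed T' := by
  -- A detour of depth `0` would repeat a stopping point, which a walk must not do.
  rcases eq_or_lt_of_le hc0 with rfl | hc
  · refine ⟨T, hT, by ring, fun _ h => h, subset_rfl, fun t h1 h2 => ?_⟩
    rw [le_antisymm h2 h1, pt_zero]
    exact mem_passed hu
  obtain ⟨A, B, rfl⟩ := List.append_of_mem hu
  obtain ⟨hW, hT⟩ := hT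
  rw [isWalk_append] at hW
  have hne : vtx u ≠ pt u v c := fun h => by
    rcases vtx_eq_pt huv.ne h with ⟨-, h⟩ | ⟨h, -⟩
    exacts [hc.ne' h, huv.ne h]
  have hedge : OnCommonEdge G (vtx u) (pt u v c) := by
    rw [← pt_zero u v]
    exact onCommonEdge_pt huv (by simp) ⟨hc0, hc1⟩
  have hd : dist (vtx u) (pt u v c) = c := by
    rw [← pt_zero u v, dist_pt huv.ne, zero_sub, abs_neg, abs_of_nonneg hc0]
  refine ⟨A ++ vtx u :: pt u v c :: vtx u :: B, ⟨isWalk_append.2 ⟨hW.1, isWalk_cons_cons.2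
    ⟨⟨hne, hedge⟩, isWalk_cons_cons.2 ⟨⟨hne.symm, hedge.symm⟩, hW.2⟩⟩⟩, ?_⟩, ?_, ?_, ?_, ?_⟩
  · have h1 : (A ++ vtx u :: pt u v c :: vtx u :: B).getLast? = (A ++ vtx u :: B).getLast? := by
      simp [List.getLast?_append, List.getLast?_cons]
    rw [h1, ← hT]
    cases A <;> rfl
  · rw [walkLength_append, walkLength_append A B, walkLength, walkLength, dist_comm _ (vtx u), hd]
    ring
  · intro x hx
    simp only [List.mem_append, List.mem_cons] at hx ⊢
    tauto
  · rw [passed_append A B, passed_append A (pt u v c :: vtx u :: B), passed_cons_cons,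
      passed_cons_cons]
    refine Set.union_subset_union le_rfl ?_
    exact Set.subset_union_of_subset_right Set.subset_union_right _
  · intro t h1 h2
    rw [passed_append, passed_cons_cons]
    refine .inr (.inl ?_)
    rw [← pt_zero u v]
    exact pt_mem_segment h1 h2

theorem exists_insert_peeks (ha0 : ∀ u v, 0 ≤ a u v) (ha1 : ∀ u v, a u v ≤ 1) (hT : IsTour G T)
    (s : Finset (V × V)) (hs : ∀ p ∈ s, vtx p.1 ∈ T ∧ G.Adj p.1 p.2) :
    ∃ T', IsTour G T' ∧ walkLength T' = walkLength T + 2 * ∑ p ∈ s, a p.1 p.2 ∧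
      (∀ x ∈ T, x ∈ T') ∧ passed T ⊆ passed T' ∧
      ∀ p ∈ s, ∀ t, 0 ≤ t → t ≤ a p.1 p.2 → pt p.1 p.2 t ∈ passed T' := by
  induction s using Finset.induction_on with
  | empty => exact ⟨T, hT, by simp, fun _ h => h, subset_rfl, by simp⟩
  | insert p s hp ih =>
    obtain ⟨T', h1, h2, h3, h4, h5⟩ := ih fun p hp => hs p (Finset.mem_insert_of_mem hp)
    have hp' := hs p (Finset.mem_insert_self p s)
    obtain ⟨T'', k1, k2, k3, k4, k5⟩ := exists_insert_peek h1 (h3 _ hp'.1) hp'.2 (ha0 _ _) (ha1 _ _)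
    refine ⟨T'', k1, ?_, fun x hx => k3 x (h3 x hx), h4.trans k4, fun p' hp' => ?_⟩
    · rw [k2, h2, Finset.sum_insert hp]
      ring
    · rcases Finset.mem_insert.1 hp' with rfl | hp'
      · exact k5
      · exact fun t ht0 ht1 => k4 (h5 p' hp' t ht0 ht1)

theorem hasDeltaTour_of_vertexSol (h : VertexSol G.Adj Finset.univ δ K) :
    HasDeltaTour G δ K := by
  classical
  obtain ⟨m, q, ⟨-, hq, hqm⟩, a, r, hf⟩ := h
  obtain ⟨L, h1, h2, h3, h4, h5⟩ := exists_walk_of_adj m q hq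
  have hT : IsTour G (vtx (q 0) :: L) := ⟨h1, by rw [h2, hqm]; rfl⟩
  obtain ⟨T, k1, k2, k3, k4, k5⟩ := exists_insert_peeks hf.a_nonneg hf.a_le_one hT
    (Finset.univ.filter fun p : V × V => Peek G.Adj Finset.univ m q p.1 p.2) fun p hp => by
      obtain ⟨⟨i, hi, h⟩, -, h'⟩ := (Finset.mem_filter.1 hp).2
      exact ⟨h ▸ h4 i hi, h'⟩
  have hvis : ∀ v, Visits m q v → vtx v ∈ passed T := fun v ⟨i, hi, h⟩ =>
    mem_passed (k3 _ (h ▸ h4 i hi))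
  have hpeek : ∀ u v t, Peek G.Adj Finset.univ m q u v → 0 ≤ t → t ≤ a u v → pt u v t ∈ passed T :=
    fun u v t huv => k5 (u, v) (Finset.mem_filter.2 ⟨Finset.mem_univ _, huv⟩) t
  refine ⟨T, ⟨k1, fun x hx => setDist_le_of_isFeasible hf (fun u v h => h.2.2) hvis
    (fun u v h => hpeek u v _ h (hf.a_nonneg _ _) le_rfl) (fun u v h => h.symm)
    (fun u v t _ h h0 h1 => hpeek u v t h h0 h1) (fun u v t huv hX ht => ?_) hx⟩, ?_⟩
  · refine (setDist_eq_zero (pt_mem_points huv ht) ?_).trans_le zero_le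
    obtain ⟨i, hi, ⟨rfl, rfl⟩ | ⟨rfl, rfl⟩⟩ := hX
    · exact k4 (h5 i hi t ht)
    · rw [pt_symm]
      exact k4 (h5 i hi _ (one_sub_mem ht))
  · have hsum : ∑ p ∈ Finset.univ.filter (fun p : V × V => Peek G.Adj Finset.univ m q p.1 p.2),
        a p.1 p.2 = ∑ u, ∑ v, a u v := by
      rw [← Finset.sum_product', Finset.univ_product_univ, Finset.sum_filter_of_ne]
      intro p _ hp
      by_contra h
      exact hp (hf.a_zero _ _ h)
    rw [k2, h3, hsum]
    linarith [hf.cost]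

theorem exists_tour_edgeSeg {α β : ℝ} (huv : G.Adj u v) (hα : 0 ≤ α) (hαβ : α ≤ β) (hβ : β ≤ 1) :
    ∃ T, IsTour G T ∧ walkLength T = 2 * (β - α) ∧ ∀ t, α ≤ t → t ≤ β → pt u v t ∈ passed T := by
  have hα' : α ∈ Set.Icc (0 : ℝ) 1 := ⟨hα, by linarith⟩
  have hβ' : β ∈ Set.Icc (0 : ℝ) 1 := ⟨by linarith, hβ⟩
  rcases eq_or_lt_of_le hαβ with rfl | hlt
  · refine ⟨[pt u v α], ⟨isWalk_singleton (pt_mem_points huv hα'), rfl⟩, by simp [walkLength],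
      fun t h1 h2 => ?_⟩
    rw [le_antisymm h2 h1, passed_singleton]
    rfl
  · have hne : pt u v α ≠ pt u v β := fun h => by
      have := dist_pt huv.ne α β
      rw [h, dist_self, eq_comm, abs_eq_zero] at this
      linarith
    have hE := onCommonEdge_pt huv hα' hβ'
    refine ⟨[pt u v α, pt u v β, pt u v α], ⟨isWalk_cons_cons.2 ⟨⟨hne, hE⟩, isWalk_cons_cons.2
      ⟨⟨hne.symm, hE.symm⟩, isWalk_singleton (pt_mem_points huv hα')⟩⟩, rfl⟩, ?_, fun t h1 h2 => ?_⟩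
    · simp only [walkLength, dist_pt huv.ne]
      rw [abs_of_neg (by linarith), abs_of_pos (by linarith)]
      ring
    · rw [passed_cons_cons]
      exact .inl (pt_mem_segment h1 h2)

/-- The tour runs back and forth on the segment where the two peeks overlap. If they do not overlap,
one of them is deepened until they touch, and the tour is a single point. -/
theorem hasDeltaTour_of_edgeSol (hK : 0 ≤ K) (h : EdgeSol G.Adj Finset.univ δ K) :
    HasDeltaTour G δ K := by
  obtain ⟨u, -, v, -, huv, a, r, hf⟩ := h
  have hne := huv.ne
  -- Deeper peeks preserve all conditions except the cost, which is dealt with separately.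
  set b : V → V → ℝ := fun p q => if p = u ∧ q = v then max (a u v) (1 - a v u) else a p q with hb
  have hab : ∀ p q, a p q ≤ b p q := fun p q => by
    simp only [hb]
    split_ifs with h
    · rw [h.1, h.2]
      exact le_max_left _ _
    · rfl
  have hb0 : ∀ p q, 0 ≤ b p q := fun p q => (hf.a_nonneg p q).trans (hab p q)
  have hb1 : ∀ p q, b p q ≤ 1 := fun p q => by
    simp only [hb]
    split_ifs with h
    · exact max_le (hf.a_le_one _ _) (by linarith [hf.a_nonneg v u])
    · exact hf.a_le_one _ _
  have hbuv : b u v = max (a u v) (1 - a v u) := by simp [hb]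
  have hbvu : b v u = a v u := by simp [hb, hne.symm]
  have hf' : IsFeasible G.Adj Finset.univ (fun _ => False) (IsPair u v) (IsPair u v) δ
      (2 * ∑ p, ∑ q, b p q) b r := by
    refine ⟨hb0, hb1, fun p q h => ?_, hf.r_nonneg, hf.r_le, fun w hw => ?_, fun p hp q hq h => ?_,
      le_rfl⟩
    · simp only [hb]
      rw [if_neg fun h' => h (.inl h'), hf.a_zero p q h]
    · exact (hf.witness w hw).imp_right (Or.imp_left fun ⟨p, hp, h1, h2⟩ =>
        ⟨p, hp, h1, by linarith [hab p w]⟩)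
    · exact (hf.edge p hp q hq h).imp_right fun h => by linarith [hab p q, hab q p]
  have hle : 1 - a v u ≤ b u v := hbuv ▸ le_max_right _ _
  obtain ⟨T, h1, h2, h3⟩ := exists_tour_edgeSeg huv (by linarith [hf.a_le_one v u]) hle (hb1 _ _)
  have hmem : ∀ p q, IsPair u v p q → pt p q (b p q) ∈ passed T := by
    rintro p q (⟨rfl, rfl⟩ | ⟨rfl, rfl⟩)
    · exact h3 _ hle le_rfl
    · rw [pt_symm, hbvu]
      exact h3 _ le_rfl hle
  -- The edge of the tour is exempt from the inequality of edges, so the parts beyond the segment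
  -- are handled by hand: either the end `q` is reached from the peek towards it, or `1 ≤ r q ≤ δ`
  -- anyway.
  have hw : ∀ p q, IsPair u v p q → 1 - b p q ≤ δ := by
    intro p q hpq
    rcases (hf'.witness q (Finset.mem_univ _)).resolve_left not_false with
      ⟨x, -, h4, h5⟩ | ⟨x, -, h4, h5⟩
    · obtain rfl : x = p := by
        rcases h4 with ⟨rfl, rfl⟩ | ⟨rfl, rfl⟩ <;> rcases hpq with ⟨rfl, h⟩ | ⟨rfl, h⟩
        exacts [rfl, (hne h.symm).elim, (hne h).elim, rfl]
      exact h5.trans (hf.r_le _ (Finset.mem_univ _))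
    · linarith [hf.r_nonneg x, hf.r_le q (Finset.mem_univ _), hb0 p q]
  have hside : ∀ p q t, IsPair u v p q → t ∈ Set.Icc (0 : ℝ) 1 → b p q ≤ t →
      setDist G (passed T) (pt p q t) ≤ ENNReal.ofReal δ := by
    intro p q t hpq ht hbt
    have hadj : G.Adj p q := by
      rcases hpq with ⟨rfl, rfl⟩ | ⟨rfl, rfl⟩
      exacts [huv, huv.symm]
    have hbI : b p q ∈ Set.Icc (0 : ℝ) 1 := ⟨hb0 p q, hb1 p q⟩
    refine (setDist_pt_le_add hadj ht hbI).trans ?_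
    rw [setDist_eq_zero (pt_mem_points hadj hbI) (hmem p q hpq), add_zero,
      abs_of_nonneg (by linarith)]
    exact ENNReal.ofReal_le_ofReal (by linarith [hw p q hpq, ht.2])
  refine ⟨T, ⟨h1, fun x hx => setDist_le_of_isFeasible hf' (fun p q h => ?_) (fun _ h => h.elim) hmem
    (fun p q h => h.symm.imp And.symm And.symm) (fun p q t h h' => absurd h' h) (fun p q t hpq h ht => ?_) hx⟩,
    ?_⟩
  · rcases h with ⟨rfl, rfl⟩ | ⟨rfl, rfl⟩
    exacts [huv, huv.symm]
  · have key : ∀ t ∈ Set.Icc (0 : ℝ) 1, setDist G (passed T) (pt u v t) ≤ ENNReal.ofReal δ := by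
      intro t ht
      rcases le_total (b u v) t with h4 | h4
      · exact hside u v t (.inl ⟨rfl, rfl⟩) ht h4
      rcases le_total t (1 - a v u) with h5 | h5
      · rw [pt_symm]
        exact hside v u _ (.inr ⟨rfl, rfl⟩) (one_sub_mem ht) (by rw [hbvu]; linarith)
      · rw [setDist_eq_zero (pt_mem_points huv ht) (h3 t h5 h4)]
        exact zero_le
    rcases h with ⟨rfl, rfl⟩ | ⟨rfl, rfl⟩
    · exact key t ht
    · rw [pt_symm]
      exact key _ (one_sub_mem ht)
  · rw [h2, hbuv]
    have hsum : a u v + a v u ≤ ∑ p, ∑ q, a p q := by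
      rw [← Finset.sum_product', Finset.univ_product_univ]
      have : ∑ p ∈ ({(u, v), (v, u)} : Finset (V × V)), a p.1 p.2 = a u v + a v u := by
        rw [Finset.sum_pair]
        simp [hne]
      rw [← this]
      exact Finset.sum_le_sum_of_subset_of_nonneg (Finset.subset_univ _) fun p _ _ =>
        hf.a_nonneg _ _
    have hcost := hf.cost
    -- If the segment is a point, the tour has length `0`; here `0 ≤ K` is needed.
    rcases le_total (a u v) (1 - a v u) with h | h
    · rw [max_eq_right h]
      linarith
    · rw [max_eq_left h]
      linarith

/-! ### From tours to solutions -/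

/-- A walk with peeks from `u` to `v₀`. -/
structure IsTrail (G : SimpleGraph V) (v₀ u : V) (m : ℕ) (q : ℕ → V) (a : V → V → ℝ) : Prop where
  first : q 0 = u
  last : q m = v₀
  adj : ∀ i < m, G.Adj (q i) (q (i + 1))
  nonneg : ∀ p p', 0 ≤ a p p'
  le_one : ∀ p p', a p p' ≤ 1
  zero : ∀ p p', ¬ (Visits m q p ∧ G.Adj p p') → a p p' = 0

omit [Fintype V] in
theorem IsTrail.cons {v₀ : V} (h : IsTrail G v₀ u m q a) (hvu : G.Adj v u) :
    ∃ q', IsTrail G v₀ v (m + 1) q' a ∧ cover G m q a ⊆ cover G (m + 1) q' a ∧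
      ∀ t ∈ Set.Icc (0 : ℝ) 1, pt u v t ∈ cover G (m + 1) q' a := by
  have hvis : ∀ p, Visits m q p → Visits (m + 1) (fun i => Nat.casesOn i v q) p :=
    fun p ⟨i, hi, h⟩ => ⟨i + 1, by omega, h⟩
  have htr : ∀ p p', Traverses m q p p' → Traverses (m + 1) (fun i => Nat.casesOn i v q) p p' :=
    fun p p' ⟨i, hi, h⟩ => ⟨i + 1, by omega, h⟩
  refine ⟨fun i => Nat.casesOn i v q, ⟨rfl, h.last, fun i hi => ?_, h.nonneg, h.le_one,
    fun p p' hp => h.zero p p' fun h => hp ⟨hvis p h.1, h.2⟩⟩, ?_, fun t ht => ?_⟩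
  · cases i with
    | zero =>
      change G.Adj v (q 0)
      rwa [h.first]
    | succ i => exact h.adj i (by omega)
  · rintro x (⟨p, h1, h2⟩ | ⟨p, p', h1, h2⟩ | ⟨p, p', h1, h2⟩)
    exacts [.inl ⟨p, hvis p h1, h2⟩, .inr (.inl ⟨p, p', htr p p' h1, h2⟩),
      .inr (.inr ⟨p, p', hvis p h1, h2⟩)]
  · exact .inr (.inl ⟨u, v, ⟨0, by omega, .inr ⟨rfl, h.first⟩⟩, t, ht, rfl⟩)

theorem IsTrail.peek {v₀ : V} {D : ℝ} (h : IsTrail G v₀ u m q a) (huv : G.Adj u v) (hD0 : 0 ≤ D)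
    (hD1 : D ≤ 1) : ∃ a', IsTrail G v₀ u m q a' ∧ ∑ p, ∑ p', a' p p' ≤ ∑ p, ∑ p', a p p' + D ∧
      cover G m q a ⊆ cover G m q a' ∧ edgeSeg u v 0 D ⊆ cover G m q a' := by
  -- Several peeks into an edge from the same end cover no more than the deepest one.
  set a' : V → V → ℝ := fun p p' => max (a p p') (if p = u ∧ p' = v then D else 0) with ha'
  have hle : ∀ p p', a p p' ≤ a' p p' := fun p p' => le_max_left _ _
  have hu : Visits m q u := ⟨0, by omega, h.first⟩
  refine ⟨a', ⟨h.first, h.last, h.adj, fun p p' => (h.nonneg p p').trans (hle p p'),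
    fun p p' => max_le (h.le_one p p') (by split_ifs <;> linarith), fun p p' hp => ?_⟩, ?_, ?_, ?_⟩
  · simp only [ha']
    rw [if_neg fun h => hp (by rw [h.1, h.2]; exact ⟨hu, huv⟩), h.zero p p' hp, max_self]
  · have : D = ∑ p, ∑ p', if p = u ∧ p' = v then D else 0 := by
      rw [Finset.sum_eq_single u, Finset.sum_eq_single v] <;> simp +contextual
    conv_rhs => rw [this]
    rw [← Finset.sum_add_distrib]
    refine Finset.sum_le_sum fun p _ => ?_
    rw [← Finset.sum_add_distrib]
    refine Finset.sum_le_sum fun p' _ => max_le ?_ ?_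
    · split_ifs <;> linarith
    · linarith [h.nonneg p p']
  · rintro x (h1 | h1 | ⟨p, p', h1, h2, t, h3, h4, h5⟩)
    exacts [.inl h1, .inr (.inl h1), .inr (.inr ⟨p, p', h1, h2, t, h3, h4.trans (hle _ _), h5⟩)]
  · rintro x ⟨t, h1, h2, rfl⟩
    refine .inr (.inr ⟨u, v, hu, huv, t, h1, h2.trans ?_, rfl⟩)
    simp [ha']

omit [Fintype V] in
theorem segment_pt_subset {α β : ℝ} (hs : s ∈ Set.Icc α β) (ht : t ∈ Set.Icc α β) :
    segment ℝ (pt u v s) (pt u v t) ⊆ edgeSeg u v α β := by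
  rw [segment_pt]
  rintro x ⟨r, h1, h2, h3⟩
  exact ⟨r, (le_min hs.1 ht.1).trans h1, h2.trans (max_le hs.2 ht.2), h3⟩

/-- The walk is built up from its last point, so the new stopping point is put in front. If this
point is inside an edge, `u` is the vertex over which the rest of the walk leaves the edge and `D`
is the greatest depth reached before that; going from `t` to `D` and then to `u` takes `2 * D - t`.
This excursion becomes a peek if the walk came from `u`, and a traversal if it came from `v`. -/
theorem exists_trail {v₀ : V} (L : List (V → ℝ)) : ∀ x, IsWalk G (x :: L) →
    (x :: L).getLast? = some (vtx v₀) →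
    (∃ u m q a, x = vtx u ∧ IsTrail G v₀ u m q a ∧
      m + 2 * ∑ p, ∑ p', a p p' ≤ walkLength (x :: L) ∧ passed (x :: L) ⊆ cover G m q a) ∨
    ∃ u v t D m q a, G.Adj u v ∧ 0 < t ∧ t < 1 ∧ t ≤ D ∧ D ≤ 1 ∧ x = pt u v t ∧
      IsTrail G v₀ u m q a ∧ m + 2 * ∑ p, ∑ p', a p p' + 2 * D - t ≤ walkLength (x :: L) ∧
      passed (x :: L) ⊆ cover G m q a ∪ edgeSeg u v 0 D := by
  induction L with
  | nil =>
    intro x hx hl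
    obtain rfl : x = vtx v₀ := by simpa using hl
    refine .inl ⟨v₀, 0, fun _ => v₀, fun _ _ => 0, rfl, ⟨rfl, rfl, by simp, by simp, by simp,
      by simp⟩, by simp [walkLength], ?_⟩
    rw [passed_singleton]
    rintro _ rfl
    exact .inl ⟨v₀, ⟨0, le_rfl, rfl⟩, rfl⟩
  | cons y L ih =>
    intro x hx hl
    rw [isWalk_cons_cons] at hx
    obtain ⟨⟨hxy, hE⟩, hW⟩ := hx
    rw [List.getLast?_cons_cons] at hl
    rw [passed_cons_cons, walkLength]
    rcases ih y hW hl with ⟨u, m, q, a, rfl, htr, hlen, hpass⟩ |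
      ⟨u, v, t, D, m, q, a, huv, ht0, ht1, htD, hD1, rfl, htr, hlen, hpass⟩
    · obtain ⟨v, huv, s, hs, rfl⟩ := hE.symm.of_vtx
      have hs0 : 0 < s := lt_of_le_of_ne hs.1 fun h => hxy (by rw [← h, pt_zero])
      have hd : dist (pt u v s) (vtx u) = s := by
        rw [← pt_zero u v, dist_pt huv.ne, sub_zero, abs_of_nonneg hs.1]
      have hseg : segment ℝ (pt u v s) (vtx u) ⊆ edgeSeg u v 0 s := by
        rw [← pt_zero u v]
        exact segment_pt_subset ⟨hs.1, le_rfl⟩ ⟨le_rfl, hs.1⟩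
      rw [hd]
      rcases eq_or_lt_of_le hs.2 with rfl | hs1
      · obtain ⟨q', k1, k2, k3⟩ := htr.cons huv.symm
        refine .inl ⟨v, m + 1, q', a, pt_one _ _, k1, by push_cast; linarith,
          Set.union_subset (hseg.trans ?_) (hpass.trans k2)⟩
        rintro x ⟨t, h1, h2, rfl⟩
        exact k3 t ⟨h1, h2⟩
      · exact .inr ⟨u, v, s, s, m, q, a, huv, hs0, hs1, le_rfl, hs1.le, rfl, htr, by linarith,
          Set.union_subset (hseg.trans Set.subset_union_right)
            (hpass.trans Set.subset_union_left)⟩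
    · obtain ⟨s, hs, rfl⟩ := hE.symm.of_pt huv ht0 ht1
      rw [dist_pt huv.ne]
      rcases eq_or_lt_of_le hs.1 with rfl | hs0
      -- The excursion also started at `u`: with the step of length `t` its length is `2 * D`, the
      -- price of a peek of depth `D`.
      · obtain ⟨a', k1, k2, k3, k4⟩ := htr.peek huv (ht0.le.trans htD) hD1
        refine .inl ⟨u, m, q, a', pt_zero _ _, k1, ?_, Set.union_subset ?_
          (hpass.trans (Set.union_subset k3 k4))⟩
        · rw [zero_sub, abs_neg, abs_of_pos ht0]
          linarith
        · exact (segment_pt_subset ⟨le_rfl, ht0.le.trans htD⟩ ⟨ht0.le, htD⟩).trans k4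
      rcases eq_or_lt_of_le hs.2 with rfl | hs1
      -- The excursion started at `v`: its length `1 - t + (2 * D - t)` is at least `1`, as `t ≤ D`,
      -- and one traversal covers the entire edge.
      · obtain ⟨q', k1, k2, k3⟩ := htr.cons huv.symm
        have h4 : ∀ D ≤ 1, edgeSeg u v 0 D ⊆ cover G (m + 1) q' a := by
          rintro D hD x ⟨r, h1, h2, rfl⟩
          exact k3 r ⟨h1, h2.trans hD⟩
        refine .inl ⟨v, m + 1, q', a, pt_one _ _, k1, ?_, Set.union_subset ?_
          (hpass.trans (Set.union_subset k2 (h4 D hD1)))⟩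
        · rw [abs_of_pos (by linarith)]
          push_cast
          linarith
        · exact (segment_pt_subset ⟨zero_le_one, le_rfl⟩ ⟨ht0.le, ht1.le⟩).trans (h4 1 le_rfl)
      · refine .inr ⟨u, v, s, max D s, m, q, a, huv, hs0, hs1, le_max_right _ _,
          max_le hD1 hs1.le, rfl, htr, ?_, Set.union_subset ?_
            (hpass.trans (Set.union_subset_union le_rfl ?_))⟩
        · rcases le_total D s with h | h
          · rw [max_eq_right h]
            linarith [le_abs_self (s - t)]
          · rw [max_eq_left h]
            linarith [neg_le_abs (s - t)]
        · exact (segment_pt_subset ⟨hs0.le, le_max_right _ _⟩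
            ⟨ht0.le, htD.trans (le_max_left _ _)⟩).trans Set.subset_union_right
        · rintro x ⟨r, h1, h2, rfl⟩
          exact ⟨r, h1, h2.trans (le_max_left _ _), rfl⟩

/-- A walk without stops at vertices cannot leave the edge. Sweeping all of `[α, κ]` and returning
to the start takes at least `2 * (κ - α)`; a walk from `t` to `e` lacks at most the way back, which
is `|t - e|`. For a tour this term vanishes. -/
theorem exists_edgeSeg (huv : G.Adj u v) {e : ℝ} (L : List (V → ℝ)) : ∀ x, IsWalk G (x :: L) →
    (∀ w, vtx w ∉ x :: L) → (x :: L).getLast? = some (pt u v e) → 0 < e → e < 1 →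
    ∃ t α κ, x = pt u v t ∧ 0 < t ∧ t < 1 ∧ 0 ≤ α ∧ κ ≤ 1 ∧ t ∈ Set.Icc α κ ∧ e ∈ Set.Icc α κ ∧
      2 * (κ - α) ≤ walkLength (x :: L) + |t - e| ∧ passed (x :: L) ⊆ edgeSeg u v α κ := by
  induction L with
  | nil =>
    intro x hx _ hl he0 he1
    obtain rfl : x = pt u v e := by simpa using hl
    refine ⟨e, e, e, rfl, he0, he1, he0.le, he1.le, ⟨le_rfl, le_rfl⟩, ⟨le_rfl, le_rfl⟩,
      by simp [walkLength], ?_⟩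
    rw [passed_singleton]
    rintro _ rfl
    exact ⟨e, le_rfl, le_rfl, rfl⟩
  | cons y L ih =>
    intro x hx hvtx hl he0 he1
    rw [isWalk_cons_cons] at hx
    rw [List.getLast?_cons_cons] at hl
    obtain ⟨t, α, κ, rfl, ht0, ht1, hα, hκ, ht, he, hlen, hpass⟩ :=
      ih y hx.2 (fun w hw => hvtx w (List.mem_cons_of_mem _ hw)) hl he0 he1
    obtain ⟨s, hs, rfl⟩ := hx.1.2.symm.of_pt huv ht0 ht1
    have hs0 : 0 < s := lt_of_le_of_ne hs.1 fun h => hvtx u (by simp [← h, pt_zero])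
    have hs1 : s < 1 := lt_of_le_of_ne hs.2 fun h => hvtx v (by simp [h, pt_one])
    refine ⟨s, min α s, max κ s, rfl, hs0, hs1, le_min hα hs.1, max_le hκ hs.2,
      ⟨min_le_right _ _, le_max_right _ _⟩,
      ⟨(min_le_left _ _).trans he.1, he.2.trans (le_max_left _ _)⟩, ?_, ?_⟩
    · rw [walkLength, dist_pt huv.ne]
      have h1 := le_abs_self (s - t)
      have h2 := neg_le_abs (s - t)
      have h3 := le_abs_self (s - e)
      have h4 := neg_le_abs (s - e)
      have h5 : |t - e| ≤ |s - t| + |s - e| := by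
        rw [abs_sub_comm s t]
        exact abs_sub_le _ _ _
      obtain ⟨ht2, ht3⟩ := ht
      obtain ⟨he2, he3⟩ := he
      rcases le_total s α with h | h
      · rw [min_eq_right h, max_eq_left (h.trans (ht2.trans ht3))]
        rcases abs_cases (t - e) with ⟨h6, -⟩ | ⟨h6, -⟩ <;> linarith
      rcases le_total κ s with h' | h'
      · rw [min_eq_left h, max_eq_right h']
        rcases abs_cases (t - e) with ⟨h6, -⟩ | ⟨h6, -⟩ <;> linarith
      · rw [min_eq_left h, max_eq_left h']
        linarith
    · rw [passed_cons_cons]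
      refine Set.union_subset (segment_pt_subset ⟨min_le_right _ _, le_max_right _ _⟩
        ⟨(min_le_left _ _).trans ht.1, ht.2.trans (le_max_left _ _)⟩) (hpass.trans ?_)
      rintro x ⟨r, h1, h2, rfl⟩
      exact ⟨r, (min_le_left _ _).trans h1, h2.trans (le_max_left _ _), rfl⟩

/-- The tour is cut at `v` and its two parts are joined at the old base point, so that
`exists_trail`, which needs a vertex at the end, becomes applicable. -/
theorem IsTour.exists_rotate (hT : IsTour G T) (hv : vtx v ∈ T) :
    ∃ L, IsWalk G (vtx v :: L) ∧ (vtx v :: L).getLast? = some (vtx v) ∧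
      walkLength (vtx v :: L) = walkLength T ∧ passed (vtx v :: L) = passed T := by
  obtain ⟨A, B, rfl⟩ := List.append_of_mem hv
  obtain ⟨hW, hT⟩ := hT
  rcases A with _ | ⟨p, A⟩
  · exact ⟨B, hW, hT.symm, rfl, rfl⟩
  rcases List.eq_nil_or_concat B with rfl | ⟨B, b, rfl⟩
  · obtain rfl : p = vtx v := by simpa [List.getLast?_append, List.getLast?_cons] using hT
    exact ⟨A ++ [vtx v], hW, by simp [List.getLast?_append, List.getLast?_cons], rfl, rfl⟩
  · obtain rfl : p = b := by simpa [List.getLast?_append, List.getLast?_cons] using hT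
    rw [List.concat_eq_append] at *
    have h2 : vtx v :: (B ++ p :: (A ++ [vtx v])) = (vtx v :: B) ++ p :: (A ++ [vtx v]) := rfl
    rw [isWalk_append] at hW
    refine ⟨B ++ p :: (A ++ [vtx v]), ?_, by simp [List.getLast?_append, List.getLast?_cons], ?_, ?_⟩
    · rw [h2, isWalk_append]
      exact ⟨hW.2, hW.1⟩
    · rw [h2, walkLength_append (vtx v :: B) (A ++ [vtx v]),
        walkLength_append (p :: A) (B ++ [p]), add_comm]
      rfl
    · rw [h2, passed_append (vtx v :: B) (A ++ [vtx v]),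
        passed_append (p :: A) (B ++ [p]), Set.union_comm]
      rfl

/-- The normal form of the tour is no longer than the tour and covers at least the same points, so
all distances can only decrease (`setDist_anti`). -/
theorem sol_of_hasDeltaTour (hδ : 0 ≤ δ) (h : HasDeltaTour G δ K) : Sol G.Adj Finset.univ δ K := by
  obtain ⟨T, ⟨hT, hcov⟩, hlen⟩ := h
  by_cases hv : ∃ v, vtx v ∈ T
  · obtain ⟨v, hv⟩ := hv
    obtain ⟨L, h1, h2, h3, h4⟩ := hT.exists_rotate hv
    rcases exists_trail L _ h1 h2 with ⟨u, m, q, a, hu, htr, hl, hpass⟩ |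
      ⟨u, w, t, D, m, q, a, huw, ht0, ht1, -, -, hp, -⟩
    · rw [h3] at hl
      rw [h4] at hpass
      obtain rfl := vtx_injective hu
      refine .inl ⟨m, q, ?_, a, _, isFeasible_of_cover ?_ hδ htr.nonneg htr.le_one
        (fun p p' h => htr.zero p p' fun h' => h ⟨h'.1, Finset.mem_univ _, h'.2⟩) (by linarith)
        fun x hx => (setDist_anti hpass x).trans (hcov x hx)⟩ <;>
      exact ⟨fun _ _ => Finset.mem_univ _, htr.adj, by rw [htr.first, htr.last]⟩
    · rcases vtx_eq_pt huw.ne hp with ⟨-, h⟩ | ⟨-, h⟩ <;> linarith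
  · push Not at hv
    obtain ⟨hW, hT⟩ := hT
    rcases T with _ | ⟨x, L⟩
    · exact absurd rfl hW.1
    rcases hW.2.1 x List.mem_cons_self with ⟨u, rfl⟩ | ⟨u, v, huv, e, he, rfl⟩
    · exact absurd List.mem_cons_self (hv u)
    have he0 : 0 < e := lt_of_le_of_ne he.1 fun h => hv u (by simp [← h, pt_zero])
    have he1 : e < 1 := lt_of_le_of_ne he.2 fun h => hv v (by simp [h, pt_one])
    obtain ⟨t, α, κ, h1, ht0, ht1, hα, hκ, ht, -, hl, hpass⟩ :=
      exists_edgeSeg huv L _ hW hv hT.symm he0 he1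
    obtain rfl : e = t := by
      rcases pt_eq_pt huv.ne huv.ne he0 he1 h1 with ⟨-, -, h⟩ | ⟨h, -⟩
      exacts [h.symm, (huv.ne h).elim]
    rw [sub_self, abs_zero, add_zero] at hl
    exact .inr ⟨u, Finset.mem_univ _, v, Finset.mem_univ _, huv, isFeasible_of_edgeSeg huv hα
      (ht.1.trans ht.2) hκ hδ (by linarith) fun x hx => (setDist_anti hpass x).trans (hcov x hx)⟩

theorem hasDeltaTour_iff_sol (hδ : 0 ≤ δ) (hK : 0 ≤ K) :
    HasDeltaTour G δ K ↔ Sol G.Adj Finset.univ δ K :=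
  ⟨sol_of_hasDeltaTour hδ, fun h => h.elim hasDeltaTour_of_vertexSol
    (hasDeltaTour_of_edgeSol hK)⟩

end GraphTour

/-! ## Linear forms on the machine -/

attribute [fun_prop] Primrec

namespace Primrec

variable {α β γ : Type*} [Primcodable α] [Primcodable β] [Primcodable γ]

@[fun_prop]
theorem fun_id : Primrec fun a : α => a := Primrec.id

@[fun_prop]
theorem fun_const (b : β) : Primrec fun _ : α => b := Primrec.const b

@[fun_prop]
theorem fun_comp {f : β → γ} {g : α → β} (hf : Primrec f) (hg : Primrec g) :
    Primrec fun a => f (g a) := hf.comp hg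

@[fun_prop]
theorem fun_fst {f : α → β × γ} (hf : Primrec f) : Primrec fun a => (f a).1 := fst.comp hf

@[fun_prop]
theorem fun_snd {f : α → β × γ} (hf : Primrec f) : Primrec fun a => (f a).2 := snd.comp hf

@[fun_prop]
theorem fun_mk {f : α → β} {g : α → γ} (hf : Primrec f) (hg : Primrec g) :
    Primrec fun a => (f a, g a) := hf.pair hg

@[fun_prop]
theorem fun_add {f g : α → ℕ} (hf : Primrec f) (hg : Primrec g) : Primrec fun a => f a + g a :=
  nat_add.comp hf hg

@[fun_prop]
theorem fun_mul {f g : α → ℕ} (hf : Primrec f) (hg : Primrec g) : Primrec fun a => f a * g a :=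
  nat_mul.comp hf hg

@[fun_prop]
theorem fun_div {f g : α → ℕ} (hf : Primrec f) (hg : Primrec g) : Primrec fun a => f a / g a :=
  nat_div.comp hf hg

@[fun_prop]
theorem fun_mod {f g : α → ℕ} (hf : Primrec f) (hg : Primrec g) : Primrec fun a => f a % g a :=
  nat_mod.comp hf hg

theorem nat_pow : Primrec₂ ((· ^ ·) : ℕ → ℕ → ℕ) :=
  Primrec₂.unpaired'.1 Nat.Primrec.pow

@[fun_prop]
theorem fun_pow {f g : α → ℕ} (hf : Primrec f) (hg : Primrec g) : Primrec fun a => f a ^ g a :=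
  nat_pow.comp hf hg

@[fun_prop]
theorem fun_sum {n : α → ℕ} {f : α → ℕ → ℕ} (hn : Primrec n)
    (hf : Primrec fun p : α × ℕ => f p.1 p.2) :
    Primrec fun a => ∑ i ∈ Finset.range (n a), f a i := sum_range hn hf

end Primrec

namespace RealRAM

variable {α β : Type*} [Primcodable α] [Primcodable β]

/-- A real number depending on `x`, `y` and `a` that is the difference of two expressions
`p + q * x + r * y` whose coefficients are primitive recursive functions of `a`. -/
def RealLin (F : ℝ → ℝ → α → ℝ) : Prop :=
  ∃ f g : α → ℕ × ℕ × ℕ, Primrec f ∧ Primrec g ∧ ∀ x y a, F x y a = lin x y (f a) - lin x y (g a)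

variable {F F' : ℝ → ℝ → α → ℝ}

theorem lin_add (x y : ℝ) (s t : ℕ × ℕ × ℕ) :
    lin x y (s.1 + t.1, s.2.1 + t.2.1, s.2.2 + t.2.2) = lin x y s + lin x y t := by
  simp only [lin]
  push_cast
  ring

theorem RealLin.of_eq (h : RealLin F) (H : ∀ x y a, F x y a = F' x y a) : RealLin F' := by
  obtain ⟨f, g, hf, hg, h⟩ := h
  exact ⟨f, g, hf, hg, fun x y a => by rw [← H, h]⟩

theorem RealLin.add (h : RealLin F) (h' : RealLin F') :
    RealLin fun x y a => F x y a + F' x y a := by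
  obtain ⟨f, g, hf, hg, h⟩ := h
  obtain ⟨f', g', hf', hg', h'⟩ := h'
  refine ⟨fun a => ((f a).1 + (f' a).1, (f a).2.1 + (f' a).2.1, (f a).2.2 + (f' a).2.2),
    fun a => ((g a).1 + (g' a).1, (g a).2.1 + (g' a).2.1, (g a).2.2 + (g' a).2.2), by fun_prop,
    by fun_prop, fun x y a => ?_⟩
  beta_reduce
  rw [h, h', lin_add, lin_add]
  ring

theorem RealLin.neg (h : RealLin F) : RealLin fun x y a => - F x y a := by
  obtain ⟨f, g, hf, hg, h⟩ := h
  exact ⟨g, f, hg, hf, fun x y a => by beta_reduce; rw [h]; ring⟩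

theorem RealLin.sub (h : RealLin F) (h' : RealLin F') :
    RealLin fun x y a => F x y a - F' x y a :=
  (h.add h'.neg).of_eq fun x y a => by ring

theorem RealLin.natCast {f : α → ℕ} (hf : Primrec f) : RealLin fun _ _ a => (f a : ℝ) :=
  ⟨fun a => (f a, 0, 0), fun _ => (0, 0, 0), by fun_prop, by fun_prop, fun x y a => by simp [lin]⟩

theorem RealLin.natCast_mul_fst {f : α → ℕ} (hf : Primrec f) : RealLin fun x _ a => f a * x :=
  ⟨fun a => (0, f a, 0), fun _ => (0, 0, 0), by fun_prop, by fun_prop, fun x y a => by simp [lin]⟩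

theorem RealLin.natCast_mul_snd {f : α → ℕ} (hf : Primrec f) : RealLin fun _ y a => f a * y :=
  ⟨fun a => (0, 0, f a), fun _ => (0, 0, 0), by fun_prop, by fun_prop, fun x y a => by simp [lin]⟩

theorem RealLin.comp {f : β → α} (h : RealLin F) (hf : Primrec f) :
    RealLin fun x y b => F x y (f b) := by
  obtain ⟨g, g', hg, hg', h⟩ := h
  exact ⟨fun b => g (f b), fun b => g' (f b), by fun_prop, by fun_prop, fun x y b => h x y (f b)⟩

theorem RealLin.sum {F : ℝ → ℝ → α → ℕ → ℝ} {n : α → ℕ} (hn : Primrec n)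
    (h : RealLin fun x y (p : α × ℕ) => F x y p.1 p.2) :
    RealLin fun x y a => ∑ i ∈ Finset.range (n a), F x y a i := by
  obtain ⟨f, g, hf, hg, h⟩ := h
  have key : ∀ (x y : ℝ) (f : α × ℕ → ℕ × ℕ × ℕ) (a : α),
      lin x y (∑ i ∈ Finset.range (n a), (f (a, i)).1, ∑ i ∈ Finset.range (n a), (f (a, i)).2.1,
        ∑ i ∈ Finset.range (n a), (f (a, i)).2.2) =
      ∑ i ∈ Finset.range (n a), lin x y (f (a, i)) := by
    intro x y f a
    simp only [lin, Finset.sum_add_distrib, ← Finset.sum_mul]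
    push_cast
    rfl
  refine ⟨fun a => (∑ i ∈ Finset.range (n a), (f (a, i)).1,
      ∑ i ∈ Finset.range (n a), (f (a, i)).2.1, ∑ i ∈ Finset.range (n a), (f (a, i)).2.2),
    fun a => (∑ i ∈ Finset.range (n a), (g (a, i)).1,
      ∑ i ∈ Finset.range (n a), (g (a, i)).2.1, ∑ i ∈ Finset.range (n a), (g (a, i)).2.2),
    by fun_prop, by fun_prop, fun x y a => ?_⟩
  rw [key, key, ← Finset.sum_sub_distrib]
  exact Finset.sum_congr rfl fun i _ => h x y (a, i)

theorem RealDec.linLe (h : RealLin F) (h' : RealLin F') :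
    RealDec fun x y a => F x y a ≤ F' x y a := by
  obtain ⟨f, g, hf, hg, h⟩ := h.sub h'
  refine (RealDec.le hf hg).of_eq fun x y a => ?_
  rw [← sub_nonpos, ← h, sub_nonpos]

theorem RealDec.natLe {f g : α → ℕ} (hf : Primrec f) (hg : Primrec g) :
    RealDec fun _ _ a => f a ≤ g a :=
  (linLe (.natCast hf) (.natCast hg)).of_eq fun _ _ _ => Nat.cast_le

theorem RealDec.natLt {f g : α → ℕ} (hf : Primrec f) (hg : Primrec g) :
    RealDec fun _ _ a => f a < g a :=
  (natLe hg hf).not.of_eq fun _ _ _ => not_le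

theorem RealDec.natEq {f g : α → ℕ} (hf : Primrec f) (hg : Primrec g) :
    RealDec fun _ _ a => f a = g a :=
  ((natLe hf hg).and (natLe hg hf)).of_eq fun _ _ _ => le_antisymm_iff.symm

/-! ### Small solutions of systems of linear inequalities -/

section small

variable {κ : Type*} [Fintype κ]

/-- A real solution of a system of linear inequalities, whose right hand sides are integer
combinations of the parameters `θ`, can be replaced by one which consists of small rational
combinations of the parameters, simultaneously for all systems with small integer coefficients. -/
theorem exists_small_solution (θ : κ → ℝ) (d : ℕ) : ∀ (C : ℕ) (z : Fin d → ℝ), 1 ≤ C →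
    (∀ l, 0 ≤ z l) → ∃ D : ℕ, 1 ≤ D ∧ D ≤ (2 * (d + 1) * C) ^ 4 ^ d ∧ ∃ p : Fin d → κ → ℤ,
      (∀ l j, |p l j| ≤ ((2 * (d + 1) * C) ^ 4 ^ d : ℕ)) ∧ ∀ (c : Fin d → ℤ) (e : κ → ℤ),
        (∀ l, |c l| ≤ C) → (∀ j, |e j| ≤ C) → ∑ l, c l * z l ≤ ∑ j, e j * θ j →
        ∑ l, c l * ∑ j, p l j * θ j ≤ D * ∑ j, e j * θ j := by
  induction d with
  | zero =>
    intro C z hC _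
    refine ⟨1, le_rfl, Nat.one_le_pow _ _ (by omega), fun _ _ => 0, fun l => l.elim0,
      fun c e _ _ h => ?_⟩
    simpa using h
  | succ d ih =>
    intro C z hC hz
    obtain ⟨D, hD1, hDB, p, hp, hsol⟩ := ih (2 * C ^ 2) (fun l => z l.castSucc)
      (by nlinarith) fun l => hz _
    set B := (2 * (d + 1) * (2 * C ^ 2)) ^ 4 ^ d with hB
    -- Eliminating a variable replaces `C` by `2 * C ^ 2`, and the new coordinate is a sum of `d +
    -- 1` products of a coefficient and an old bound.
    have hBle : (d + 1) * C * B ≤ (2 * (d + 1 + 1) * C) ^ 4 ^ (d + 1) := by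
      have h1 : 2 * (d + 1) * (2 * C ^ 2) ≤ (2 * (d + 1 + 1) * C) ^ 2 := by nlinarith
      have h2 : (d + 1) * C ≤ 2 * (d + 1 + 1) * C := Nat.mul_le_mul_right _ (by omega)
      calc (d + 1) * C * B ≤ (2 * (d + 1 + 1) * C) * ((2 * (d + 1 + 1) * C) ^ 2) ^ 4 ^ d :=
            Nat.mul_le_mul h2 (Nat.pow_le_pow_left h1 _)
        _ = (2 * (d + 1 + 1) * C) ^ (2 * 4 ^ d + 1) := by rw [← pow_mul, pow_succ, mul_comm]
        _ ≤ _ := by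
            refine Nat.pow_le_pow_right (by positivity) ?_
            have : 1 ≤ 4 ^ d := Nat.one_le_pow _ _ (by norm_num)
            rw [pow_succ]
            omega
    set Z : Fin d → ℝ := fun l => ∑ j, p l j * θ j with hZ
    set ev : (κ → ℤ) → ℝ := fun e => ∑ j, e j * θ j with hev
    -- The finitely many valid inequalities with small coefficients that bound the last variable
    -- from below; `f` is the bound that results once the other variables have the values `Z l`, the
    -- last one being scaled by `D` too.
    set R : Set ((Fin (d + 1) → ℤ) × (κ → ℤ)) := {ce | (∀ l, |ce.1 l| ≤ C) ∧ (∀ j, |ce.2 j| ≤ C) ∧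
      ce.1 (Fin.last d) < 0 ∧ ∑ l, ce.1 l * z l ≤ ev ce.2} with hR
    set f : (Fin (d + 1) → ℤ) × (κ → ℤ) → ℝ := fun ce =>
      (∑ l, ce.1 (Fin.castSucc l) * Z l - D * ev ce.2) / (-ce.1 (Fin.last d) : ℤ) with hf
    have hfin : R.Finite := by
      classical
      refine ((Set.finite_Icc (fun _ : Fin (d + 1) => -(C : ℤ)) fun _ => (C : ℤ)).prod
        (Set.finite_Icc (fun _ : κ => -(C : ℤ)) fun _ => (C : ℤ))).subset fun ce h => ?_
      exact ⟨⟨fun l => (abs_le.1 (h.1 l)).1, fun l => (abs_le.1 (h.1 l)).2⟩,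
        ⟨fun j => (abs_le.1 (h.2.1 j)).1, fun j => (abs_le.1 (h.2.1 j)).2⟩⟩
    -- Nonnegativity of the last variable is one of these inequalities.
    have hne : R.Nonempty := by
      refine ⟨(fun l => if l = Fin.last d then -1 else 0, fun _ => 0), fun l => ?_, fun j => ?_,
        by simp, ?_⟩
      · dsimp only
        split_ifs <;> simp
        exact_mod_cast hC
      · simp
      · simpa [hev] using hz (Fin.last d)
    obtain ⟨⟨c, e⟩, ⟨hc, he, hneg, hrow⟩, hmax⟩ := Set.exists_max_image R f hfin hne
    dsimp only at hc he hneg hrow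
    obtain ⟨a, ha⟩ : ∃ a : ℕ, c (Fin.last d) = -a := ⟨(-c (Fin.last d)).toNat, by omega⟩
    have ha1 : 1 ≤ a := by omega
    have haC : a ≤ C := by
      have := hc (Fin.last d)
      rw [ha, abs_neg, Nat.abs_cast] at this
      exact_mod_cast this
    have haR : (0 : ℝ) < a := by exact_mod_cast ha1
    set S : ℝ := ∑ l, c (Fin.castSucc l) * Z l - D * ev e with hS
    have hfS : f (c, e) = S / a := by simp only [hf, ha]; push_cast; rw [neg_neg]
    have hBR : 0 ≤ (B : ℤ) := by positivity
    -- The last variable takes the value `S / a` of the strongest lower bound. Everything is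
    -- multiplied by `a` to keep integer coefficients.
    refine ⟨a * D, Nat.mul_pos ha1 hD1, ?_, Fin.snoc (fun l j => a * p l j)
      (fun j => ∑ l, c (Fin.castSucc l) * p l j - D * e j), fun l j => ?_, fun c' e' hc' he' h => ?_⟩
    · refine le_trans ?_ hBle
      exact Nat.mul_le_mul (haC.trans (Nat.le_mul_of_pos_left _ (by omega))) hDB
    · refine le_trans ?_ (Int.ofNat_le.2 hBle)
      push_cast
      refine Fin.lastCases ?_ (fun l => ?_) l
      · rw [Fin.snoc_last]
        refine (abs_sub _ _).trans ?_
        have h1 : |∑ l, c (Fin.castSucc l) * p l j| ≤ d * (C * B) := by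
          refine (Finset.abs_sum_le_sum_abs _ _).trans ?_
          refine (Finset.sum_le_card_nsmul _ _ ((C : ℤ) * B) fun l _ => ?_).trans (by simp)
          rw [abs_mul]
          exact mul_le_mul (hc _) (hp l j) (abs_nonneg _) (by positivity)
        have h2 : |(D : ℤ) * e j| ≤ B * C := by
          rw [abs_mul, Nat.abs_cast]
          exact mul_le_mul (by exact_mod_cast hDB) (he j) (abs_nonneg _) hBR
        linarith
      · rw [Fin.snoc_castSucc, abs_mul, Nat.abs_cast]
        refine mul_le_mul ?_ (hp l j) (abs_nonneg _) (by positivity)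
        have : (a : ℤ) ≤ C := by exact_mod_cast haC
        nlinarith
    · rw [Fin.sum_univ_castSucc]
      simp only [Fin.snoc_castSucc, Fin.snoc_last]
      have e1 : ∀ l, ∑ j, ((a * p l j : ℤ) : ℝ) * θ j = a * Z l := fun l => by
        simp only [hZ, Finset.mul_sum]
        exact Finset.sum_congr rfl fun j _ => by push_cast; ring
      have e2 : ∑ j, ((∑ l, c (Fin.castSucc l) * p l j - D * e j : ℤ) : ℝ) * θ j = S := by
        simp only [hS, hZ, hev, Finset.mul_sum]
        rw [Finset.sum_comm, ← Finset.sum_sub_distrib]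
        refine Finset.sum_congr rfl fun j _ => ?_
        push_cast
        rw [sub_mul, Finset.sum_mul]
        congr 1
        · exact Finset.sum_congr rfl fun l _ => by ring
        · ring
      simp only [e1]
      rw [e2]
      have e3 : ∑ l, (c' (Fin.castSucc l) : ℝ) * (a * Z l) =
          a * ∑ l, c' (Fin.castSucc l) * Z l := by
        rw [Finset.mul_sum]
        exact Finset.sum_congr rfl fun l _ => by ring
      rw [e3]
      push_cast
      set S' : ℝ := ∑ l, c' (Fin.castSucc l) * Z l with hS'
      have hC2 : C ≤ 2 * C ^ 2 := by nlinarith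
      -- Lower bounds hold by maximality of `S / a`. Inequalities without the last variable hold by
      -- induction. An upper bound is combined with the strongest lower bound so that the last
      -- variable cancels; this consequence has coefficients at most `2 * C ^ 2` and holds by
      -- induction as well.
      rcases lt_trichotomy (c' (Fin.last d)) 0 with hneg' | hzero | hpos
      · have h1 := hmax (c', e') ⟨hc', he', hneg', h⟩
        rw [hfS] at h1
        have hb : (0 : ℝ) < (-c' (Fin.last d) : ℤ) := by exact_mod_cast (by omega)
        simp only [hf] at h1
        rw [div_le_div_iff₀ hb haR] at h1
        push_cast at h1
        change (S' - D * ev e') * a ≤ _ at h1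
        change _ ≤ a * D * ev e'
        linarith
      · have h1 := hsol (fun l => c' l.castSucc) e'
          (fun l => (hc' _).trans (by exact_mod_cast hC2))
          (fun j => (he' j).trans (by exact_mod_cast hC2)) (by
            rw [Fin.sum_univ_castSucc, hzero] at h
            simpa using h)
        rw [hzero, Int.cast_zero, zero_mul, add_zero, mul_assoc]
        exact mul_le_mul_of_nonneg_left h1 haR.le
      · obtain ⟨b, hb⟩ : ∃ b : ℕ, c' (Fin.last d) = b := ⟨(c' (Fin.last d)).toNat, by omega⟩
        have hbC : (b : ℤ) ≤ C := by
          have := hc' (Fin.last d)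
          rwa [hb, Nat.abs_cast] at this
        have haC' : (a : ℤ) ≤ C := by exact_mod_cast haC
        have bound : ∀ s t : ℤ, |s| ≤ C → |t| ≤ C → |b * s + a * t| ≤ (2 * C ^ 2 : ℕ) := by
          intro s t hs ht
          refine (abs_add_le _ _).trans ?_
          rw [abs_mul, abs_mul, Nat.abs_cast, Nat.abs_cast]
          have h1 := mul_le_mul hbC hs (abs_nonneg _) (by positivity)
          have h2 := mul_le_mul haC' ht (abs_nonneg _) (by positivity)
          push_cast
          nlinarith
        have hev2 : ev (fun j => b * e j + a * e' j) = b * ev e + a * ev e' := by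
          simp only [hev, Finset.mul_sum, ← Finset.sum_add_distrib]
          exact Finset.sum_congr rfl fun j _ => by push_cast; ring
        have hsum2 : ∀ y : Fin d → ℝ, ∑ l, ((b * c (Fin.castSucc l) + a * c' (Fin.castSucc l) : ℤ) : ℝ)
            * y l = b * ∑ l, c (Fin.castSucc l) * y l + a * ∑ l, c' (Fin.castSucc l) * y l := by
          intro y
          simp only [Finset.mul_sum, ← Finset.sum_add_distrib]
          exact Finset.sum_congr rfl fun j _ => by push_cast; ring
        have h1 := hsol (fun l => b * c l.castSucc + a * c' l.castSucc)
          (fun j => b * e j + a * e' j) (fun l => bound _ _ (hc _) (hc' _))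
          (fun j => bound _ _ (he _) (he' _)) (by
            change _ ≤ ev (fun j => b * e j + a * e' j)
            rw [hev2, hsum2]
            rw [Fin.sum_univ_castSucc, ha] at hrow
            rw [Fin.sum_univ_castSucc, hb] at h
            push_cast at hrow h
            change _ ≤ ev e' at h
            have h2 := mul_le_mul_of_nonneg_left hrow (Nat.cast_nonneg (α := ℝ) b)
            have h3 := mul_le_mul_of_nonneg_left h (Nat.cast_nonneg (α := ℝ) a)
            linarith)
        change _ ≤ D * ev (fun j => b * e j + a * e' j) at h1
        rw [hev2, hsum2] at h1
        rw [hb]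
        push_cast
        change _ ≤ a * D * ev e'
        linarith

end small

end RealRAM

/-! ## Feasibility is decidable -/

namespace RealRAM

/-- The digit number `k` of `e` in base `B`. -/
def dig (e B k : ℕ) : ℕ := e / B ^ k % B

theorem dig_add_pow_mul {B n e c : ℕ} (hB : 0 < B) (he : e < B ^ n) (hc : c < B) :
    e + B ^ n * c < B ^ (n + 1) ∧ (∀ k < n, dig (e + B ^ n * c) B k = dig e B k) ∧
      dig (e + B ^ n * c) B n = c := by
  refine ⟨?_, fun k hk => ?_, ?_⟩
  · calc e + B ^ n * c < B ^ n * 1 + B ^ n * c := by omega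
      _ = B ^ n * (1 + c) := by ring
      _ ≤ B ^ n * B := Nat.mul_le_mul_left _ (by omega)
      _ = _ := (pow_succ _ _).symm
  · rw [dig, dig]
    obtain ⟨j, rfl⟩ : ∃ j, n = k + (j + 1) := ⟨n - k - 1, by omega⟩
    rw [pow_add, mul_assoc, Nat.add_mul_div_left _ _ (by positivity), pow_succ, mul_comm _ B,
      mul_assoc, Nat.add_mul_mod_self_left]
  · rw [dig, Nat.add_mul_div_left _ _ (by positivity), Nat.div_eq_of_lt he, zero_add,
      Nat.mod_eq_of_lt hc]

theorem exists_dig {B : ℕ} (f : ℕ → ℕ) (n : ℕ) (hf : ∀ k < n, f k < B) :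
    ∃ e < B ^ n, ∀ k < n, dig e B k = f k := by
  induction n with
  | zero => exact ⟨0, by simp, by simp⟩
  | succ n ih =>
    obtain ⟨e, he, h⟩ := ih fun k hk => hf k (by omega)
    have hn := hf n (by omega)
    obtain ⟨h1, h2, h3⟩ := dig_add_pow_mul (by omega) he hn
    refine ⟨_, h1, fun k hk => ?_⟩
    rcases Nat.lt_succ_iff_lt_or_eq.1 hk with hk | rfl
    exacts [(h2 k hk).trans (h k hk), h3]

/-- The coordinate number `i` of the vector with the code `e` in base `B`. -/
def coord (x y : ℝ) (B e i : ℕ) : ℝ :=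
  lin x y (dig e B (6 * i), dig e B (6 * i + 1), dig e B (6 * i + 2)) -
    lin x y (dig e B (6 * i + 3), dig e B (6 * i + 4), dig e B (6 * i + 5))

/-- The elimination is applied with the parameters `1`, `x`, `y`. Each coordinate has three integer
coefficients, whose positive and negative parts become six digits of `e`. -/
theorem exists_coord (x y : ℝ) {C d B : ℕ} (hC : 1 ≤ C) {z : ℕ → ℝ} (hz : ∀ l < d, 0 ≤ z l)
    (hB : (2 * (d + 1) * C) ^ 4 ^ d < B) : ∃ D < B, ∃ e < B ^ (6 * d), 1 ≤ D ∧
      ∀ (c : ℕ → ℤ) (e₀ e₁ e₂ : ℤ), (∀ l < d, |c l| ≤ C) → |e₀| ≤ C → |e₁| ≤ C → |e₂| ≤ C →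
        ∑ l ∈ Finset.range d, c l * z l ≤ e₀ + e₁ * x + e₂ * y →
        ∑ l ∈ Finset.range d, c l * coord x y B e l ≤ D * (e₀ + e₁ * x + e₂ * y) := by
  obtain ⟨D, hD1, hDB, p, hp, h⟩ := exists_small_solution ![1, x, y] d C (fun l => z l) hC
    fun l => hz _ l.2
  set P : ℕ → ℕ → ℤ := fun i j => if h : i < d ∧ j < 3 then p ⟨i, h.1⟩ ⟨j, h.2⟩ else 0 with hP
  have hPB : ∀ i j, |P i j| < B := fun i j => by
    simp only [hP]
    split_ifs with h
    · exact (hp _ _).trans_lt (by exact_mod_cast hB)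
    · rw [abs_zero]
      exact_mod_cast (Nat.zero_le _).trans_lt hB
  obtain ⟨e, he, hdig⟩ := exists_dig (B := B) (fun k => if k % 6 < 3 then (P (k / 6) (k % 6)).toNat
    else (-P (k / 6) (k % 6 - 3)).toNat) (6 * d) fun k _ => by
      split_ifs
      · have := (abs_lt.1 (hPB (k / 6) (k % 6))).2
        have := (abs_lt.1 (hPB (k / 6) (k % 6))).1
        omega
      · have := (abs_lt.1 (hPB (k / 6) (k % 6 - 3))).2
        have := (abs_lt.1 (hPB (k / 6) (k % 6 - 3))).1
        omega
  have hcoord : ∀ i < d, coord x y B e i = P i 0 + P i 1 * x + P i 2 * y := by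
    intro i hi
    have cast : ∀ t : ℤ, (t.toNat : ℝ) - ((-t).toNat : ℝ) = t := fun t => by
      exact_mod_cast t.toNat_sub_toNat_neg
    rw [coord, hdig _ (by omega), hdig _ (by omega), hdig _ (by omega), hdig _ (by omega),
      hdig _ (by omega), hdig _ (by omega)]
    have h1 : ∀ j < 6, (6 * i + j) % 6 = j ∧ (6 * i + j) / 6 = i := fun j hj => by omega
    have h0 : (6 * i) % 6 = 0 ∧ (6 * i) / 6 = i := by omega
    simp only [h1 1 (by norm_num), h1 2 (by norm_num), h1 3 (by norm_num), h1 4 (by norm_num),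
      h1 5 (by norm_num), h0, lin]
    rw [← cast (P i 0), ← cast (P i 1), ← cast (P i 2)]
    norm_num
    ring
  refine ⟨D, hDB.trans_lt hB, e, he, hD1, fun c e₀ e₁ e₂ hc h₀ h₁ h₂ hle => ?_⟩
  have key := h (fun l => c l) ![e₀, e₁, e₂] (fun l => hc _ l.2) (fun j => by
    fin_cases j
    exacts [h₀, h₁, h₂])
  rw [← Fin.sum_univ_eq_sum_range (fun l => (c l : ℝ) * z l)] at hle
  rw [← Fin.sum_univ_eq_sum_range (fun l => (c l : ℝ) * coord x y B e l)]
  have e1 : ∑ j : Fin 3, ((![e₀, e₁, e₂] j : ℤ) : ℝ) * ![1, x, y] j = e₀ + e₁ * x + e₂ * y := by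
    simp [Fin.sum_univ_three]
  rw [e1] at key
  refine (le_of_eq (Finset.sum_congr rfl fun l _ => ?_)).trans (key hle)
  rw [hcoord l l.2, Fin.sum_univ_three]
  simp [hP]

/-! ### Feasibility as a search over numerators and a common denominator. -/

/-- The inequalities of a solution multiplied by the common denominator `D`. -/
def IsScaled (adj : ℕ → ℕ → Prop) (N : ℕ) (S : ℕ → Prop) (L X : ℕ → ℕ → Prop) (δ K : ℝ)
    (c₁ c₂ D : ℕ) (A : ℕ → ℕ → ℝ) (R : ℕ → ℝ) : Prop :=
  (∀ u < N, ∀ v < N, ((0 : ℕ) : ℝ) ≤ A u v ∧ A u v ≤ D ∧ (L u v ∨ A u v ≤ (0 : ℕ))) ∧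
  (∀ u < N, ((0 : ℕ) : ℝ) ≤ R u ∧ R u ≤ D * δ) ∧
  (∀ w < N, S w ∨ (∃ v < N, L v w ∧ D - A v w ≤ R w) ∨ ∃ x < N, adj x w ∧ R x + D ≤ R w) ∧
  (∀ u < N, ∀ v < N, adj u v → X u v ∨ D + R u + R v - A u v - A v u ≤ D * δ + D * δ) ∧
  ∑ u ∈ Finset.range N, ∑ v ∈ Finset.range N, A u v +
    ∑ u ∈ Finset.range N, ∑ v ∈ Finset.range N, A u v ≤ D * K + (D * c₁ : ℕ) - (D * c₂ : ℕ)

section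

variable {adj L X : ℕ → ℕ → Prop} {S : ℕ → Prop} {N c₁ c₂ D : ℕ} {δ K : ℝ} {A : ℕ → ℕ → ℝ}
  {R : ℕ → ℝ}

open GraphTour

theorem IsScaled.feasible (hD : 1 ≤ D) (h : IsScaled adj N S L X δ K c₁ c₂ D A R) :
    Feasible adj (Finset.range N) S L X δ (K + c₁ - c₂) := by
  obtain ⟨h1, h2, h3, h4, h5⟩ := h
  have hDR : (0 : ℝ) < D := by exact_mod_cast hD
  set a : ℕ → ℕ → ℝ := fun u v => if u < N ∧ v < N then A u v / D else 0 with ha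
  set r : ℕ → ℝ := fun u => if u < N then R u / D else 0 with hr
  have hA : ∀ u < N, ∀ v < N, A u v = D * a u v := fun u hu v hv => by
    simp only [ha, hu, hv, and_self, if_true]
    field_simp
  have hR : ∀ u < N, R u = D * r u := fun u hu => by
    simp only [hr, hu, if_true]
    field_simp
  have ha0 : ∀ u v, ¬ (u < N ∧ v < N) → a u v = 0 := fun u v h => by simp only [ha, h, if_false]
  have hr0 : ∀ u, ¬ u < N → r u = 0 := fun u h => by simp only [hr, h, if_false]
  have cancel : ∀ {s t : ℝ}, D * s ≤ D * t → s ≤ t := fun h => le_of_mul_le_mul_left h hDR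
  refine ⟨a, r, fun u v => ?_, fun u v => ?_, fun u v huv => ?_, fun u => ?_, fun u hu => ?_,
    fun w hw => ?_, fun u hu v hv huv => ?_, ?_⟩
  · by_cases h : u < N ∧ v < N
    · have := (h1 u h.1 v h.2).1
      rw [hA u h.1 v h.2] at this
      exact cancel (by simpa using this)
    · rw [ha0 u v h]
  · by_cases h : u < N ∧ v < N
    · have := (h1 u h.1 v h.2).2.1
      rw [hA u h.1 v h.2] at this
      exact cancel (by simpa using this)
    · rw [ha0 u v h]
      exact zero_le_one
  · by_cases h : u < N ∧ v < N
    · obtain ⟨h6, -, h7⟩ := h1 u h.1 v h.2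
      have h7 := h7.resolve_left huv
      rw [hA u h.1 v h.2] at h6 h7
      exact le_antisymm (cancel (by simpa using h7)) (cancel (by simpa using h6))
    · exact ha0 u v h
  · by_cases h : u < N
    · have := (h2 u h).1
      rw [hR u h] at this
      exact cancel (by simpa using this)
    · rw [hr0 u h]
  · have hu := Finset.mem_range.1 hu
    have := (h2 u hu).2
    rw [hR u hu] at this
    exact cancel this
  · have hw := Finset.mem_range.1 hw
    refine (h3 w hw).imp_right (Or.imp (fun ⟨v, hv, hL, h⟩ =>
      ⟨v, Finset.mem_range.2 hv, hL, cancel ?_⟩) fun ⟨x, hx, hadj, h⟩ =>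
      ⟨x, Finset.mem_range.2 hx, hadj, cancel ?_⟩)
    · rw [hA v hv w hw, hR w hw] at h
      linarith
    · rw [hR x hx, hR w hw] at h
      linarith
  · have hu := Finset.mem_range.1 hu
    have hv := Finset.mem_range.1 hv
    refine (h4 u hu v hv huv).imp_right fun h => cancel ?_
    rw [hR u hu, hR v hv, hA u hu v hv, hA v hv u hu] at h
    linarith
  · have : ∑ u ∈ Finset.range N, ∑ v ∈ Finset.range N, A u v =
        D * ∑ u ∈ Finset.range N, ∑ v ∈ Finset.range N, a u v := by
      rw [Finset.mul_sum]
      refine Finset.sum_congr rfl fun u hu => ?_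
      rw [Finset.mul_sum]
      exact Finset.sum_congr rfl fun v hv =>
        hA u (Finset.mem_range.1 hu) v (Finset.mem_range.1 hv)
    rw [this] at h5
    push_cast at h5
    exact cancel (by linarith)

theorem sum_range_sum_range (f : ℕ → ℝ) (m n : ℕ) :
    ∑ u ∈ Finset.range m, ∑ v ∈ Finset.range n, f (u * n + v) = ∑ l ∈ Finset.range (m * n), f l := by
  induction m with
  | zero => simp
  | succ m ih => rw [Finset.sum_range_succ, ih, Nat.succ_mul, Finset.sum_range_add]

/-- The variables `a u v` and `r u` of a solution as one vector. -/
def vec (N : ℕ) (a : ℕ → ℕ → ℝ) (r : ℕ → ℝ) (l : ℕ) : ℝ :=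
  if l < N * N then a (l / N) (l % N) else r (l - N * N)

theorem mul_add_lt_mul {u v : ℕ} (hu : u < N) (hv : v < N) : u * N + v < N * N := by
  nlinarith [Nat.mul_le_mul_right N (Nat.succ_le_of_lt hu)]

theorem vec_pair {a : ℕ → ℕ → ℝ} {r : ℕ → ℝ} {u v : ℕ} (hu : u < N) (hv : v < N) :
    vec N a r (u * N + v) = a u v := by
  rw [vec, if_pos (mul_add_lt_mul hu hv), mul_comm u, Nat.mul_add_mod,
    Nat.mod_eq_of_lt hv, Nat.mul_add_div (by omega), Nat.div_eq_of_lt hv, add_zero]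

theorem vec_single {a : ℕ → ℕ → ℝ} {r : ℕ → ℝ} (u : ℕ) : vec N a r (N * N + u) = r u := by
  rw [vec, if_neg (by omega), Nat.add_sub_cancel_left]

/-- The conditions contain disjunctions, so they are not one linear system. But `exists_coord`
preserves every valid inequality with small coefficients at once, and therefore the disjuncts that
hold for the given solution. -/
theorem exists_isScaled {B C : ℕ} (hC : 4 ≤ C) (hc₁ : c₁ ≤ C) (hc₂ : c₂ ≤ C)
    (hc : c₁ = 0 ∨ c₂ = 0)
    (hB : (2 * (N * N + N + 1) * C) ^ 4 ^ (N * N + N) < B)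
    (h : Feasible adj (Finset.range N) S L X δ (K + c₁ - c₂)) :
    ∃ D < B, ∃ e < B ^ (6 * (N * N + N)), 1 ≤ D ∧ IsScaled adj N S L X δ K c₁ c₂ D
      (fun u v => coord δ K B e (u * N + v)) fun u => coord δ K B e (N * N + u) := by
  obtain ⟨a, r, hf⟩ := h
  obtain ⟨D, hD, e, he, hD1, hrow⟩ := exists_coord δ K (C := C) (by omega) (z := vec N a r)
    (fun l _ => by
      unfold vec
      split_ifs
      exacts [hf.a_nonneg _ _, hf.r_nonneg _]) hB
  refine ⟨D, hD, e, he, hD1, ?_⟩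
  set V := coord δ K B e with hV
  set d := N * N + N with hd
  have hC4 : (4 : ℤ) ≤ C := by exact_mod_cast hC
  -- All inequalities but that of the cost involve at most four variables. The indices may coincide,
  -- in which case the coefficients add up to at most `4`; this is why `4 ≤ C`. Unused slots get the
  -- coefficient `0`.
  have row4 : ∀ i₁ < d, ∀ i₂ < d, ∀ i₃ < d, ∀ i₄ < d, ∀ k₁ k₂ k₃ k₄ e₀ e₁ : ℤ, |k₁| ≤ 1 →
      |k₂| ≤ 1 → |k₃| ≤ 1 → |k₄| ≤ 1 → |e₀| ≤ 4 → |e₁| ≤ 4 →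
      k₁ * vec N a r i₁ + k₂ * vec N a r i₂ + k₃ * vec N a r i₃ + k₄ * vec N a r i₄ ≤ e₀ + e₁ * δ →
      k₁ * V i₁ + k₂ * V i₂ + k₃ * V i₃ + k₄ * V i₄ ≤ D * (e₀ + e₁ * δ) := by
    intro i₁ h₁ i₂ h₂ i₃ h₃ i₄ h₄ k₁ k₂ k₃ k₄ e₀ e₁ hk₁ hk₂ hk₃ hk₄ he₀ he₁ hle
    set c : ℕ → ℤ := fun l => (if l = i₁ then k₁ else 0) + (if l = i₂ then k₂ else 0) +
      (if l = i₃ then k₃ else 0) + (if l = i₄ then k₄ else 0) with hc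
    have hsum : ∀ z : ℕ → ℝ, ∑ l ∈ Finset.range d, c l * z l =
        k₁ * z i₁ + k₂ * z i₂ + k₃ * z i₃ + k₄ * z i₄ := fun z => by
      simp only [hc]
      push_cast
      simp only [add_mul, Finset.sum_add_distrib, ite_mul, zero_mul, Finset.sum_ite_eq',
        Finset.mem_range, h₁, h₂, h₃, h₄, if_true]
    have hcb : ∀ l < d, |c l| ≤ C := fun l _ => by
      rw [abs_le] at *
      simp only [hc]
      constructor <;> split_ifs <;> omega
    have := hrow c e₀ e₁ 0 hcb (he₀.trans hC4) (he₁.trans hC4) (by simp)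
    rw [hsum, hsum, Int.cast_zero, zero_mul, add_zero] at this
    exact this hle
  have hp : ∀ {u v}, u < N → v < N → u * N + v < d := fun hu hv =>
    (mul_add_lt_mul hu hv).trans_le (by omega)
  have hs : ∀ {u}, u < N → N * N + u < d := fun hu => by omega
  refine ⟨fun u hu v hv => ⟨?_, ?_, ?_⟩, fun u hu => ⟨?_, ?_⟩, fun w hw => ?_,
    fun u hu v hv huv => ?_, ?_⟩
  · have := row4 _ (hp hu hv) _ (hp hu hv) _ (hp hu hv) _ (hp hu hv) (-1) 0 0 0 0 0 (by simp)
      (by simp) (by simp) (by simp) (by simp) (by simp)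
      (by simpa [vec_pair hu hv] using hf.a_nonneg u v)
    simpa using this
  · have := row4 _ (hp hu hv) _ (hp hu hv) _ (hp hu hv) _ (hp hu hv) 1 0 0 0 1 0 (by simp)
      (by simp) (by simp) (by simp) (by simp) (by simp)
      (by simpa [vec_pair hu hv] using hf.a_le_one u v)
    simpa using this
  · by_cases hL : L u v
    · exact .inl hL
    have := row4 _ (hp hu hv) _ (hp hu hv) _ (hp hu hv) _ (hp hu hv) 1 0 0 0 0 0 (by simp)
      (by simp) (by simp) (by simp) (by simp) (by simp)
      (by simpa [vec_pair hu hv] using (hf.a_zero u v hL).le)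
    exact .inr (by simpa using this)
  · have := row4 _ (hs hu) _ (hs hu) _ (hs hu) _ (hs hu) (-1) 0 0 0 0 0 (by simp)
      (by simp) (by simp) (by simp) (by simp) (by simp)
      (by simpa [vec_single] using hf.r_nonneg u)
    simpa using this
  · have := row4 _ (hs hu) _ (hs hu) _ (hs hu) _ (hs hu) 1 0 0 0 0 1 (by simp)
      (by simp) (by simp) (by simp) (by simp) (by simp)
      (by simpa [vec_single] using hf.r_le u (Finset.mem_range.2 hu))
    simpa using this
  · refine (hf.witness w (Finset.mem_range.2 hw)).imp_right (Or.imp (fun ⟨v, hv, hL, h⟩ =>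
      ⟨v, Finset.mem_range.1 hv, hL, ?_⟩) fun ⟨x, hx, hadj, h⟩ =>
      ⟨x, Finset.mem_range.1 hx, hadj, ?_⟩)
    · have hv := Finset.mem_range.1 hv
      have := row4 _ (hp hv hw) _ (hs hw) _ (hs hw) _ (hs hw) (-1) (-1) 0 0 (-1) 0 (by simp)
        (by simp) (by simp) (by simp) (by simp) (by simp)
        (by simp [vec_single, vec_pair hv hw]; linarith)
      simp at this
      linarith
    · have hx := Finset.mem_range.1 hx
      have := row4 _ (hs hx) _ (hs hw) _ (hs hw) _ (hs hw) 1 (-1) 0 0 (-1) 0 (by simp)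
        (by simp) (by simp) (by simp) (by simp) (by simp)
        (by simp [vec_single]; linarith)
      simp at this
      linarith
  · refine (hf.edge u (Finset.mem_range.2 hu) v (Finset.mem_range.2 hv) huv).imp_right fun h => ?_
    have := row4 _ (hs hu) _ (hs hv) _ (hp hu hv) _ (hp hv hu) 1 1 (-1) (-1) (-1) 2 (by simp)
      (by simp) (by simp) (by simp) (by simp) (by simp)
      (by simp [vec_single, vec_pair hu hv, vec_pair hv hu]; linarith)
    simp at this
    linarith
  · have hsum : ∀ z : ℕ → ℝ, ∑ l ∈ Finset.range d, ((if l < N * N then 2 else 0 : ℤ) : ℝ) * z l =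
        2 * ∑ u ∈ Finset.range N, ∑ v ∈ Finset.range N, z (u * N + v) := fun z => by
      rw [sum_range_sum_range, hd, Finset.sum_range_add, Finset.mul_sum]
      rw [Finset.sum_eq_zero (s := Finset.range N), add_zero]
      · exact Finset.sum_congr rfl fun l hl => by simp [Finset.mem_range.1 hl]
      · exact fun l _ => by simp
    have := hrow (fun l => if l < N * N then 2 else 0) (c₁ - c₂ : ℤ) 0 1 (fun l _ => by
        split_ifs <;> simp
        omega) (by rcases hc with rfl | rfl <;> simp <;> omega) (by simp)
        (by simp only [abs_one]; omega)
    rw [hsum, hsum] at this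
    have h1 : ∑ u ∈ Finset.range N, ∑ v ∈ Finset.range N, vec N a r (u * N + v) =
        ∑ u ∈ Finset.range N, ∑ v ∈ Finset.range N, a u v :=
      Finset.sum_congr rfl fun u hu => Finset.sum_congr rfl fun v hv =>
        vec_pair (Finset.mem_range.1 hu) (Finset.mem_range.1 hv)
    rw [h1] at this
    push_cast at this ⊢
    have h2 := this (by linarith [hf.cost])
    linarith

end

section

open GraphTour

variable {γ : Type*} [Primcodable γ] {N c₁ c₂ B C : γ → ℕ} {adj L X : γ → ℕ → ℕ → Prop}
  {S : γ → ℕ → Prop}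

@[fun_prop]
theorem _root_.Primrec.fun_dig {e B k : γ → ℕ} (he : Primrec e) (hB : Primrec B) (hk : Primrec k) :
    Primrec fun g => dig (e g) (B g) (k g) := by
  unfold dig
  fun_prop

theorem RealLin.coord {e i : γ → ℕ} (hB : Primrec B) (he : Primrec e) (hi : Primrec i) :
    RealLin fun x y g => coord x y (B g) (e g) (i g) :=
  ⟨_, _, by fun_prop, by fun_prop, fun _ _ _ => rfl⟩

theorem RealDec.isScaled {D : γ → ℕ} {A : ℝ → ℝ → γ → ℕ → ℕ → ℝ} {R : ℝ → ℝ → γ → ℕ → ℝ}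
    (hN : Primrec N) (hc₁ : Primrec c₁) (hc₂ : Primrec c₂) (hD : Primrec D)
    (hadj : RealDec fun _ _ (p : γ × ℕ × ℕ) => adj p.1 p.2.1 p.2.2)
    (hL : RealDec fun _ _ (p : γ × ℕ × ℕ) => L p.1 p.2.1 p.2.2)
    (hX : RealDec fun _ _ (p : γ × ℕ × ℕ) => X p.1 p.2.1 p.2.2)
    (hS : RealDec fun _ _ (p : γ × ℕ) => S p.1 p.2)
    (hA : RealLin fun x y (p : γ × ℕ × ℕ) => A x y p.1 p.2.1 p.2.2)
    (hR : RealLin fun x y (p : γ × ℕ) => R x y p.1 p.2) :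
    RealDec fun δ K g => IsScaled (adj g) (N g) (S g) (L g) (X g) δ K (c₁ g) (c₂ g) (D g)
      (A δ K g) (R δ K g) := by
  have hN1 : Primrec fun p : γ × ℕ => N p.1 := by fun_prop
  have hD1 : Primrec fun p : γ × ℕ => D p.1 := by fun_prop
  have hD2 : Primrec fun p : (γ × ℕ) × ℕ => D p.1.1 := by fun_prop
  have hab : Primrec fun p : (γ × ℕ) × ℕ => (p.1.1, p.1.2, p.2) := by fun_prop
  have hba : Primrec fun p : (γ × ℕ) × ℕ => (p.1.1, p.2, p.1.2) := by fun_prop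
  have ha : Primrec fun p : (γ × ℕ) × ℕ => (p.1.1, p.1.2) := by fun_prop
  have hb : Primrec fun p : (γ × ℕ) × ℕ => (p.1.1, p.2) := by fun_prop
  have hAab := hA.comp hab
  have hAba := hA.comp hba
  have hRa := hR.comp ha
  have hRb := hR.comp hb
  have hDl := RealLin.natCast hD2
  have hDx := RealLin.natCast_mul_fst hD2
  have hsum := RealLin.sum (F := fun x y g u => ∑ v ∈ Finset.range (N g), A x y g u v) hN
    (RealLin.sum (F := fun x y p v => A x y p.1 p.2 v) hN1 hAab)
  have h1 := ((RealDec.linLe (.natCast (.const 0)) hAab).and ((RealDec.linLe hAab hDl).and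
    ((hL.comp hab).or (RealDec.linLe hAab (.natCast (.const 0)))))).all hN1 |>.all hN
  have h2 := ((RealDec.linLe (.natCast (.const 0)) hR).and
    (RealDec.linLe hR (.natCast_mul_fst hD1))).all hN
  have h3 := (hS.or ((((hL.comp hba).and (RealDec.linLe (hDl.sub hAba) hRa)).ex hN1).or
    (((hadj.comp hba).and (RealDec.linLe (hRb.add hDl) hRa)).ex hN1))).all hN
  have h4 := ((hadj.comp hab).imp ((hX.comp hab).or (RealDec.linLe
    ((((hDl.add hRa).add hRb).sub hAab).sub hAba) (hDx.add hDx)))).all hN1 |>.all hN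
  have h5 := RealDec.linLe (hsum.add hsum) (((RealLin.natCast_mul_snd hD).add
    (.natCast (Primrec.fun_mul hD hc₁))).sub (.natCast (Primrec.fun_mul hD hc₂)))
  exact h1.and (h2.and (h3.and (h4.and h5)))

/-- Real solutions are replaced by the codes `D` and `e`, both below primitive recursive bounds, so
that feasibility becomes a formula with bounded quantifiers. The sum `c₁ g + c₂ g + 4` bounds the
coefficients. -/
theorem RealDec.feasible (hN : Primrec N) (hc₁ : Primrec c₁) (hc₂ : Primrec c₂)
    (hc : ∀ g, c₁ g = 0 ∨ c₂ g = 0)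
    (hadj : RealDec fun _ _ (p : γ × ℕ × ℕ) => adj p.1 p.2.1 p.2.2)
    (hL : RealDec fun _ _ (p : γ × ℕ × ℕ) => L p.1 p.2.1 p.2.2)
    (hX : RealDec fun _ _ (p : γ × ℕ × ℕ) => X p.1 p.2.1 p.2.2)
    (hS : RealDec fun _ _ (p : γ × ℕ) => S p.1 p.2) :
    RealDec fun δ K g => Feasible (adj g) (Finset.range (N g)) (S g) (L g) (X g) δ
      (K + c₁ g - c₂ g) := by
  set B : γ → ℕ := fun g => (2 * (N g * N g + N g + 1) * (c₁ g + c₂ g + 4)) ^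
    4 ^ (N g * N g + N g) + 1 with hB
  have hB' : Primrec B := by fun_prop
  have h1 := (RealDec.natLe (α := (γ × ℕ) × ℕ) (.const 1) (Primrec.snd.comp .fst)).and
    (RealDec.isScaled (γ := (γ × ℕ) × ℕ) (N := fun p => N p.1.1) (c₁ := fun p => c₁ p.1.1)
      (c₂ := fun p => c₂ p.1.1) (D := fun p => p.1.2) (adj := fun p => adj p.1.1)
      (L := fun p => L p.1.1) (X := fun p => X p.1.1) (S := fun p => S p.1.1)
      (A := fun x y p u v => coord x y (B p.1.1) p.2 (u * N p.1.1 + v))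
      (R := fun x y p u => coord x y (B p.1.1) p.2 (N p.1.1 * N p.1.1 + u))
      (by fun_prop) (by fun_prop) (by fun_prop) (by fun_prop)
      (hadj.comp (f := fun q : ((γ × ℕ) × ℕ) × ℕ × ℕ => (q.1.1.1, q.2)) (by fun_prop))
      (hL.comp (f := fun q : ((γ × ℕ) × ℕ) × ℕ × ℕ => (q.1.1.1, q.2)) (by fun_prop))
      (hX.comp (f := fun q : ((γ × ℕ) × ℕ) × ℕ × ℕ => (q.1.1.1, q.2)) (by fun_prop))
      (hS.comp (f := fun q : ((γ × ℕ) × ℕ) × ℕ => (q.1.1.1, q.2)) (by fun_prop))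
      (.coord (B := fun q : ((γ × ℕ) × ℕ) × ℕ × ℕ => B q.1.1.1) (e := fun q => q.1.2)
        (i := fun q => q.2.1 * N q.1.1.1 + q.2.2) (by fun_prop) (by fun_prop) (by fun_prop))
      (.coord (B := fun q : ((γ × ℕ) × ℕ) × ℕ => B q.1.1.1) (e := fun q => q.1.2)
        (i := fun q => N q.1.1.1 * N q.1.1.1 + q.2) (by fun_prop) (by fun_prop) (by fun_prop)))
  have h2 := h1.ex (f := fun p : γ × ℕ => B p.1 ^ (6 * (N p.1 * N p.1 + N p.1))) (by fun_prop)
  refine (h2.ex hB').of_eq fun x y g => ⟨?_, fun h => ?_⟩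
  · rintro ⟨D, _, e, _, hD, h⟩
    exact h.feasible hD
  exact exists_isScaled (C := c₁ g + c₂ g + 4) (by omega) (by omega) (by omega) (hc g)
    (Nat.lt_succ_self _) h

end

end RealRAM

/-! ## The existence of solutions is decidable -/

namespace GraphTour

variable {V : Type*} {adj : V → V → Prop} {A : Finset V} {m : ℕ} {w w' : ℕ → V}

theorem visits_congr (h : ∀ i ≤ m, w i = w' i) : Visits m w = Visits m w' := by
  funext v
  exact propext (exists_congr fun i => and_congr_right fun hi => by rw [h i hi])

theorem traverses_congr (h : ∀ i ≤ m, w i = w' i) : Traverses m w = Traverses m w' := by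
  funext u v
  exact propext (exists_congr fun i => and_congr_right fun hi => by
    rw [h i hi.le, h (i + 1) hi])

theorem peek_congr (h : ∀ i ≤ m, w i = w' i) : Peek adj A m w = Peek adj A m w' := by
  funext u v
  rw [Peek, Peek, visits_congr h]

theorem IsClosedWalk.congr (h : ∀ i ≤ m, w i = w' i) (hw : IsClosedWalk adj A m w) :
    IsClosedWalk adj A m w' :=
  ⟨fun i hi => h i hi ▸ hw.1 i hi, fun i hi => h i hi.le ▸ h (i + 1) hi ▸ hw.2.1 i hi,
    h m le_rfl ▸ h 0 (Nat.zero_le m) ▸ hw.2.2⟩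

end GraphTour

namespace RealRAM

open GraphTour

/-- The relation on the numbers below `N` whose matrix has the digits of `x` as its entries. -/
def bitAdj (N x i j : ℕ) : Prop := dig x 2 (i * N + j) = 1

theorem RealDec.bitAdj {γ : Type*} [Primcodable γ] {N x i j : γ → ℕ} (hN : Primrec N)
    (hx : Primrec x) (hi : Primrec i) (hj : Primrec j) :
    RealDec fun _ _ g => bitAdj (N g) (x g) (i g) (j g) :=
  .natEq (by fun_prop) (.const 1)

section walk

variable {γ : Type*} [Primcodable γ] {N x m : γ → ℕ} {w : γ → ℕ → ℕ}

theorem RealDec.visits (hm : Primrec m) (hw : Primrec fun p : γ × ℕ => w p.1 p.2) :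
    RealDec fun _ _ (p : γ × ℕ) => Visits (m p.1) (w p.1) p.2 := by
  have hw' : Primrec fun q : (γ × ℕ) × ℕ => w q.1.1 q.2 :=
    hw.comp (g := fun q : (γ × ℕ) × ℕ => (q.1.1, q.2)) (by fun_prop)
  refine ((RealDec.natEq hw' (Primrec.snd.comp .fst)).ex (f := fun p => m p.1 + 1)
    (by fun_prop)).of_eq fun _ _ p => ?_
  simp only [Visits, Nat.lt_succ_iff]

theorem RealDec.traverses (hm : Primrec m) (hw : Primrec fun p : γ × ℕ => w p.1 p.2) :
    RealDec fun _ _ (p : γ × ℕ × ℕ) => Traverses (m p.1) (w p.1) p.2.1 p.2.2 := by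
  have h0 : Primrec fun q : (γ × ℕ × ℕ) × ℕ => w q.1.1 q.2 :=
    hw.comp (g := fun q : (γ × ℕ × ℕ) × ℕ => (q.1.1, q.2)) (by fun_prop)
  have h1 : Primrec fun q : (γ × ℕ × ℕ) × ℕ => w q.1.1 (q.2 + 1) :=
    hw.comp (g := fun q : (γ × ℕ × ℕ) × ℕ => (q.1.1, q.2 + 1)) (by fun_prop)
  have hu : Primrec fun q : (γ × ℕ × ℕ) × ℕ => q.1.2.1 := by fun_prop
  have hv : Primrec fun q : (γ × ℕ × ℕ) × ℕ => q.1.2.2 := by fun_prop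
  exact (((RealDec.natEq h0 hu).and (RealDec.natEq h1 hv)).or
    ((RealDec.natEq h0 hv).and (RealDec.natEq h1 hu))).ex (f := fun p => m p.1) (by fun_prop)

theorem RealDec.peek (hN : Primrec N) (hx : Primrec x) (hm : Primrec m)
    (hw : Primrec fun p : γ × ℕ => w p.1 p.2) :
    RealDec fun _ _ (p : γ × ℕ × ℕ) =>
      Peek (RealRAM.bitAdj (N p.1) (x p.1)) (Finset.range (N p.1)) (m p.1) (w p.1) p.2.1 p.2.2 := by
  have h1 := (RealDec.visits hm hw).comp (f := fun p : γ × ℕ × ℕ => (p.1, p.2.1)) (by fun_prop)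
  have h2 := RealDec.natLt (f := fun p : γ × ℕ × ℕ => p.2.2) (g := fun p => N p.1)
    (by fun_prop) (by fun_prop)
  have h3 := RealDec.bitAdj (N := fun p : γ × ℕ × ℕ => N p.1) (x := fun p => x p.1)
    (i := fun p => p.2.1) (j := fun p => p.2.2) (by fun_prop) (by fun_prop) (by fun_prop)
    (by fun_prop)
  refine (h1.and (h2.and h3)).of_eq fun _ _ p => ?_
  rw [Peek, Finset.mem_range]

theorem RealDec.isClosedWalk (hN : Primrec N) (hx : Primrec x) (hm : Primrec m)
    (hw : Primrec fun p : γ × ℕ => w p.1 p.2) :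
    RealDec fun _ _ g =>
      IsClosedWalk (RealRAM.bitAdj (N g) (x g)) (Finset.range (N g)) (m g) (w g) := by
  have hs : Primrec fun p : γ × ℕ => w p.1 (p.2 + 1) :=
    hw.comp (g := fun p : γ × ℕ => (p.1, p.2 + 1)) (by fun_prop)
  have hl : Primrec fun g => w g (m g) := hw.comp (g := fun g => (g, m g)) (by fun_prop)
  have h0 : Primrec fun g => w g 0 := hw.comp (g := fun g : γ => (g, 0)) (by fun_prop)
  have hN1 : Primrec fun p : γ × ℕ => N p.1 := by fun_prop
  have hx1 : Primrec fun p : γ × ℕ => x p.1 := by fun_prop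
  refine (((RealDec.natLt hw hN1).all (f := fun g => m g + 1) (by fun_prop)).and
    (((RealDec.bitAdj hN1 hx1 hw hs).all hm).and (RealDec.natEq hl h0))).of_eq fun _ _ g => ?_
  simp only [IsClosedWalk, Finset.mem_range, Nat.lt_succ_iff]

theorem RealDec.feasible_walk (hN : Primrec N) (hx : Primrec x) (hm : Primrec m)
    (hw : Primrec fun p : γ × ℕ => w p.1 p.2) :
    RealDec fun δ K g =>
      IsClosedWalk (RealRAM.bitAdj (N g) (x g)) (Finset.range (N g)) (m g) (w g) ∧
      Feasible (RealRAM.bitAdj (N g) (x g)) (Finset.range (N g)) (Visits (m g) (w g))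
        (Peek (RealRAM.bitAdj (N g) (x g)) (Finset.range (N g)) (m g) (w g))
        (Traverses (m g) (w g)) δ (K + (0 : ℕ) - m g) :=
  (RealDec.isClosedWalk hN hx hm hw).and <| RealDec.feasible (N := N) (c₁ := fun _ => 0) (c₂ := m)
    (adj := fun g => RealRAM.bitAdj (N g) (x g)) (S := fun g => Visits (m g) (w g))
    (L := fun g => Peek (RealRAM.bitAdj (N g) (x g)) (Finset.range (N g)) (m g) (w g))
    (X := fun g => Traverses (m g) (w g)) hN (.const 0) hm (fun _ => .inl rfl)
    (.bitAdj (by fun_prop) (by fun_prop) (by fun_prop) (by fun_prop)) (.peek hN hx hm hw)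
    (.traverses hm hw) (.visits hm hw)

theorem RealDec.feasible_edge {u v : γ → ℕ} (hN : Primrec N) (hx : Primrec x) (hu : Primrec u)
    (hv : Primrec v) : RealDec fun δ K g => RealRAM.bitAdj (N g) (x g) (u g) (v g) ∧
      Feasible (RealRAM.bitAdj (N g) (x g)) (Finset.range (N g)) (fun _ => False)
        (IsPair (u g) (v g)) (IsPair (u g) (v g)) δ (K + (2 : ℕ) - (0 : ℕ)) := by
  have hu' : Primrec fun p : γ × ℕ × ℕ => u p.1 := by fun_prop
  have hv' : Primrec fun p : γ × ℕ × ℕ => v p.1 := by fun_prop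
  have hp : Primrec fun p : γ × ℕ × ℕ => p.2.1 := by fun_prop
  have hq : Primrec fun p : γ × ℕ × ℕ => p.2.2 := by fun_prop
  have h0 : RealDec fun _ _ (p : γ × ℕ × ℕ) => IsPair (u p.1) (v p.1) p.2.1 p.2.2 :=
    ((RealDec.natEq hp hu').and (RealDec.natEq hq hv')).or
      ((RealDec.natEq hp hv').and (RealDec.natEq hq hu'))
  exact (RealDec.bitAdj hN hx hu hv).and <| RealDec.feasible (N := N) (c₁ := fun _ => 2)
    (c₂ := fun _ => 0) (adj := fun g => RealRAM.bitAdj (N g) (x g)) (S := fun g _ => False)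
    (L := fun g => IsPair (u g) (v g)) (X := fun g => IsPair (u g) (v g))
    hN (.const 2) (.const 0) (fun _ => .inr rfl)
    (.bitAdj (by fun_prop) (by fun_prop) (by fun_prop) (by fun_prop)) h0 h0
    ((RealDec.natLt (.const 0) (.const 0)).of_eq fun _ _ _ => by simp)

end walk

/-- A closed walk has at most `h` steps by `IsFeasible.length_le`, and it is coded by its sequence
of vertices as digits in base `N + 1`. Only the bound on the number of steps depends on `IsBound`.
-/
theorem exists_realDec_vertexSol : ∃ φ : ℝ → ℝ → ℕ × ℕ × ℕ → Prop, RealDec φ ∧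
    ∀ δ K h N x, IsBound δ K h →
      (φ δ K (h, N, x) ↔ VertexSol (bitAdj N x) (Finset.range N) δ K) := by
  have h2 := RealDec.feasible_walk (γ := ((ℕ × ℕ × ℕ) × ℕ) × ℕ) (N := fun g => g.1.1.2.1)
    (x := fun g => g.1.1.2.2) (m := fun g => g.1.2)
    (w := fun g => dig g.2 (g.1.1.2.1 + 1)) (by fun_prop) (by fun_prop) (by fun_prop) (by fun_prop)
  have h3 := h2.ex (α := (ℕ × ℕ × ℕ) × ℕ) (f := fun p => (p.1.2.1 + 1) ^ (p.2 + 1)) (by fun_prop)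
  refine ⟨_, h3.ex (α := ℕ × ℕ × ℕ) (f := fun p => p.1 + 1) (by fun_prop),
    fun δ K h N x hh => ⟨?_, ?_⟩⟩
  · rintro ⟨m, _, c, _, h4, h5⟩
    refine ⟨m, _, h4, ?_⟩
    simpa using h5
  · rintro ⟨m, w, h4, a, r, h5⟩
    obtain ⟨c, hc, hcw⟩ := exists_dig (B := N + 1) w (m + 1) fun k hk =>
      Nat.lt_succ_of_lt (Finset.mem_range.1 (h4.1 k (Nat.lt_succ_iff.1 hk)))
    have hcw' : ∀ i ≤ m, w i = dig c (N + 1) i := fun i hi => (hcw i (Nat.lt_succ_of_le hi)).symm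
    refine ⟨m, Nat.lt_succ_of_le (h5.length_le hh), c, hc, h4.congr hcw', a, r, ?_⟩
    rw [visits_congr hcw', traverses_congr hcw', peek_congr hcw'] at h5
    simpa using h5

theorem realDec_edgeSol :
    RealDec fun δ K (p : ℕ × ℕ) => EdgeSol (bitAdj p.1 p.2) (Finset.range p.1) δ K := by
  have h1 := RealDec.feasible_edge (γ := ((ℕ × ℕ) × ℕ) × ℕ) (N := fun g => g.1.1.1)
    (x := fun g => g.1.1.2) (u := fun g => g.1.2) (v := fun g => g.2)
    (by fun_prop) (by fun_prop) (by fun_prop) (by fun_prop)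
  have h3 := h1.ex (α := (ℕ × ℕ) × ℕ) (f := fun p => p.1.1) (by fun_prop)
  refine (h3.ex (α := ℕ × ℕ) (f := fun p => p.1) (by fun_prop)).of_eq fun δ K p => ?_
  simp [EdgeSol]

theorem exists_realDec_sol : ∃ φ : ℝ → ℝ → ℕ × ℕ × ℕ → Prop, RealDec φ ∧
    ∀ δ K h N x, IsBound δ K h →
      (φ δ K (h, N, x) ↔ Sol (bitAdj N x) (Finset.range N) δ K) := by
  obtain ⟨φ, h1, h2⟩ := exists_realDec_vertexSol
  exact ⟨_, h1.or (realDec_edgeSol.comp Primrec.snd), fun δ K h N x hh =>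
    or_congr (h2 δ K h N x hh) Iff.rfl⟩

end RealRAM

/-! ## Programs with registers on the diagonal of the adjacency matrix -/

namespace RealRAM

/-- The address of the register `k`: the cell of the entry `(k, k)` of the adjacency matrix. -/
def regAddr : ℕ → NatExpr
  | 0 => .lit 1
  | k + 1 => .add (regAddr k) (.add (.mem (.lit 0)) (.lit 1))

def reg (k : ℕ) : NatExpr := .mem (regAddr k)

open Classical in
/-- The memory contains the size `n` and the matrix of the relation `E`, and the registers on its
diagonal have the values `v`. -/
structure Mem (n : ℕ) (E : ℕ → ℕ → Prop) (v : ℕ → ℕ) (s : State) : Prop where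
  size : s.nat 0 = n
  entry : ∀ i < n, ∀ j < n, i ≠ j → s.nat (1 + (i * n + j)) = if E i j then 1 else 0
  reg : ∀ k, s.nat (k * (n + 1) + 1) = v k

variable {n : ℕ} {E : ℕ → ℕ → Prop} {v v' : ℕ → ℕ} {s s' : State}

theorem Mem.eval_regAddr (h : Mem n E v s) (k : ℕ) : (regAddr k).eval s = k * (n + 1) + 1 := by
  induction k with
  | zero => simp [regAddr, NatExpr.eval]
  | succ k ih =>
    simp only [regAddr, NatExpr.eval, ih, h.size]
    ring

theorem Mem.eval_reg (h : Mem n E v s) (k : ℕ) : (RealRAM.reg k).eval s = v k := by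
  rw [RealRAM.reg, NatExpr.eval, h.eval_regAddr, h.reg]

theorem regAddr_cost (k : ℕ) : (regAddr k).cost = 5 * k + 1 := by
  induction k with
  | zero => rfl
  | succ k ih =>
    simp only [regAddr, NatExpr.cost, ih]
    ring

theorem reg_cost (k : ℕ) : (reg k).cost = 5 * k + 2 := by
  rw [reg, NatExpr.cost, regAddr_cost]

/-- The address `k * (n + 1) + 1` is neither `0` nor that of an entry off the diagonal, also for `k
≥ n`, where it lies beyond the matrix. Hence registers can be used without damage to the graph,
although no fixed cell is free for all `n`. -/
theorem Mem.update (h : Mem n E v s) (k x : ℕ) :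
    Mem n E (Function.update v k x) { s with nat := Function.update s.nat (k * (n + 1) + 1) x } := by
  refine ⟨?_, fun i hi j hj hij => ?_, fun l => ?_⟩
  · dsimp only
    rw [Function.update_of_ne (by omega)]
    exact h.size
  · dsimp only
    rw [Function.update_of_ne, h.entry i hi j hj hij]
    intro h
    rcases lt_trichotomy k i with hk | rfl | hk
    · have := Nat.mul_le_mul_right n (Nat.succ_le_of_lt hk)
      rw [Nat.succ_mul] at this
      rw [Nat.mul_add] at h
      omega
    · rw [Nat.mul_add] at h
      omega
    · have := Nat.mul_le_mul_right n (Nat.succ_le_of_lt hk)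
      rw [Nat.succ_mul] at this
      rw [Nat.mul_add] at h
      omega
  · dsimp only
    by_cases hl : l = k
    · subst hl
      rw [Function.update_self, Function.update_self]
    · rw [Function.update_of_ne hl, Function.update_of_ne, h.reg]
      intro h
      exact hl (Nat.eq_of_mul_eq_mul_right (Nat.succ_pos n) (Nat.add_right_cancel h))

/-- Total correctness with a time bound for programs that use the registers only. -/
def RunsReg (n : ℕ) (E : ℕ → ℕ → Prop) (P : Prog) (v : ℕ → ℕ) (T : ℕ) (Q : (ℕ → ℕ) → Prop) :
    Prop :=
  ∀ s, Mem n E v s → Runs P s T fun s' => s'.real = s.real ∧ ∃ v', Mem n E v' s' ∧ Q v'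

variable {P P' : Prog} {T T' : ℕ} {Q Q' : (ℕ → ℕ) → Prop}

theorem RunsReg.mono (h : RunsReg n E P v T Q) (hT : T ≤ T') (hQ : ∀ v', Q v' → Q' v') :
    RunsReg n E P v T' Q' := fun s hs =>
  (h s hs).mono hT fun _ ⟨h1, v', h2, h3⟩ => ⟨h1, v', h2, hQ v' h3⟩

theorem RunsReg.le (h : RunsReg n E P v T Q) (hT : T ≤ T') : RunsReg n E P v T' Q :=
  h.mono hT fun _ h => h

theorem RunsReg.seq (h : RunsReg n E P v T Q) (h' : ∀ v', Q v' → RunsReg n E P' v' T' Q') :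
    RunsReg n E (.seq P P') v (T + T') Q' := fun s hs =>
  (h s hs).seq fun s1 ⟨h1, v1, h2, h3⟩ => (h' v1 h3 s1 h2).mono le_rfl fun _ ⟨h4, h5⟩ =>
    ⟨h4.trans h1, h5⟩

theorem RunsReg.skip (h : Q v) : RunsReg n E .skip v 1 Q := fun _ hs => Runs.skip ⟨rfl, v, hs, h⟩

/-- Assignment to a register. -/
def setReg (k : ℕ) (e : NatExpr) : Prog := .setNat (regAddr k) e

theorem RunsReg.set {k x : ℕ} {e : NatExpr} (he : ∀ s, Mem n E v s → e.eval s = x)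
    (h : Q (Function.update v k x)) : RunsReg n E (setReg k e) v (5 * k + e.cost + 2) Q := by
  intro s hs
  have hm := hs.update k x
  rw [← hs.eval_regAddr, ← he s hs] at hm
  rw [← he s hs] at h
  refine (Runs.setNat ⟨rfl, _, hm, h⟩).mono ?_ fun _ h => h
  rw [regAddr_cost]
  omega

theorem RunsReg.ite {b : Test} {c : Prop} (hb : ∀ s, Mem n E v s → (b.Holds s ↔ c))
    (h : c → RunsReg n E P v T Q) (h' : ¬ c → RunsReg n E P' v T Q) :
    RunsReg n E (.ite b P P') v (b.cost + T) Q := fun s hs =>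
  Runs.ite (fun hc => h ((hb s hs).1 hc) s hs) fun hc => h' (fun h => hc ((hb s hs).2 h)) s hs

/-- Runs `P` with the register `c` equal to `0, …, n - 1`. -/
def forReg (c : ℕ) (P : Prog) : Prog :=
  .seq (setReg c (.lit 0)) (.loop (.natLe (.add (reg c) (.lit 1)) (.mem (.lit 0)))
    (.seq P (setReg c (.add (reg c) (.lit 1)))))

theorem RunsReg.for {c : ℕ} {I : ℕ → (ℕ → ℕ) → Prop} (h0 : I 0 (Function.update v c 0))
    (hstep : ∀ k < n, ∀ v, v c = k → I k v →
      RunsReg n E P v T fun v' => v' c = k ∧ I (k + 1) (Function.update v' c (k + 1))) :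
    RunsReg n E (forReg c P) v (n * (T + (15 * c + 20)) + (10 * c + 20)) (I n) := by
  intro s hs
  have hset := RunsReg.set (n := n) (E := E) (v := v) (k := c) (x := 0) (e := .lit 0)
    (Q := fun v' => v' c = 0 ∧ I 0 v') (fun s _ => rfl) ⟨Function.update_self _ _ _, h0⟩ s hs
  refine (hset.seq fun s1 ⟨h1, v1, h2, h3, h4⟩ => Runs.loop_const (N := n)
    (c := T + (10 * c + 10)) (I := fun k s' => s'.real = s.real ∧ ∃ v', Mem n E v' s' ∧ v' c = k ∧ I k v')
    ⟨h1, v1, h2, h3, h4⟩ (fun k hk s2 ⟨h5, v2, h6, h7, h8⟩ => ⟨?_, ?_⟩)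
    fun s2 ⟨_, v2, h6, h7, _⟩ => ?_).mono ?_ fun s' ⟨h5, v2, h6, h7, h8⟩ => ⟨h5, v2, h6, h8⟩
  · simp only [Test.Holds, NatExpr.eval, h6.eval_reg, h6.size, h7]
    omega
  · refine ((hstep k hk v2 h7 h8 s2 h6).seq fun s3 ⟨h9, v3, h10, h11, h12⟩ =>
      (RunsReg.set (x := k + 1) (fun s hs => ?_) ⟨Function.update_self _ _ _, h12⟩ s3 h10).mono
        le_rfl fun s4 ⟨h13, h14⟩ => ⟨h13.trans (h9.trans h5), h14⟩).mono ?_ fun _ h => h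
    · simp only [NatExpr.eval, hs.eval_reg, h11]
    · simp only [NatExpr.cost, reg_cost]
      omega
  · simp only [Test.Holds, NatExpr.eval, h6.eval_reg, h6.size, h7]
    omega
  · simp only [NatExpr.cost, Test.cost, reg_cost]
    nlinarith

/-! ### Subroutines of the kernelization -/

/-- Loads the entry at `(reg 30, reg 31)` into the register `32`. -/
def loadEntry : Prog :=
  .seq (setReg 34 (.lit 0)) (.seq (forReg 33 (setReg 34 (.add (reg 34) (reg 30))))
    (.ite (.and (.natLe (reg 30) (reg 31)) (.natLe (reg 31) (reg 30))) (setReg 32 (.lit 0))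
      (setReg 32 (.mem (.add (.lit 1) (.add (reg 34) (reg 31)))))))

-- The offset `i * n` of a row is accumulated by `n` additions, which makes the access to an entry
-- linear in `n`. Diagonal cells serve as registers, so for these the answer `0` is given without a
-- look; it is correct as `E` is irreflexive.
open Classical in
theorem runsReg_loadEntry (hE : ∀ i, ¬ E i i) (hn : 1 ≤ n) (h1 : v 30 < n) (h2 : v 31 < n) :
    RunsReg n E loadEntry v (4000 * n) fun v' =>
      v' 32 = (if E (v 30) (v 31) then 1 else 0) ∧ ∀ k < 32, v' k = v k := by
  refine RunsReg.le (RunsReg.seq (Q := fun v' => v' 34 = 0 ∧ ∀ k < 32, v' k = v k)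
    (.set (x := 0) (fun _ _ => rfl) ⟨Function.update_self _ _ _, fun k hk =>
      Function.update_of_ne (by omega) _ _⟩) fun v1 hv1 => RunsReg.seq
    (RunsReg.for (I := fun i v' => v' 34 = i * v 30 ∧ ∀ k < 32, v' k = v k) ⟨by simp [hv1.1],
      fun k hk => by rw [Function.update_of_ne (by omega), hv1.2 k hk]⟩ fun i hi v2 hc hv2 =>
      RunsReg.set (x := v2 34 + v2 30) (fun s hs => by simp only [NatExpr.eval, hs.eval_reg])
        ⟨by simpa using hc, ?_, fun k hk => ?_⟩) fun v3 hv3 =>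
    RunsReg.ite (c := v 30 = v 31) (T := 1000) (fun s hs => ?_) (fun h =>
      RunsReg.le (RunsReg.set (x := 0) (fun _ _ => rfl) ⟨?_, fun k hk => ?_⟩) ?_) fun h =>
      RunsReg.le (RunsReg.set (x := if E (v 30) (v 31) then 1 else 0) (fun s hs => ?_)
        ⟨by simp, fun k hk => ?_⟩) ?_) ?_
  · simp [hv2, add_mul]
  · rw [Function.update_of_ne (by omega), Function.update_of_ne (by omega), hv2.2 k hk]
  · simp only [Test.Holds, hs.eval_reg, hv3.2 30 (by norm_num), hv3.2 31 (by norm_num)]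
    omega
  · simp [h, hE]
  · rw [Function.update_of_ne (by omega), hv3.2 k hk]
  · simp [NatExpr.cost]
  · simp only [NatExpr.eval, hs.eval_reg, hv3.1, hv3.2 31 (by norm_num)]
    rw [mul_comm n]
    exact hs.entry _ h1 _ h2 h
  · rw [Function.update_of_ne (by omega), hv3.2 k hk]
  · simp [NatExpr.cost, reg_cost]
  · simp only [NatExpr.cost, Test.cost, reg_cost]
    omega

/-- Register `22` becomes `1` if the rows of the registers `20` and `21` agree, and `0` otherwise. -/
def compareRows : Prog :=
  .seq (setReg 22 (.lit 1)) (forReg 23 (.seq (setReg 30 (reg 20)) (.seq (setReg 31 (reg 23))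
    (.seq loadEntry (.seq (setReg 24 (reg 32)) (.seq (setReg 30 (reg 21)) (.seq loadEntry
      (.ite (.and (.natLe (reg 24) (reg 32)) (.natLe (reg 32) (reg 24))) .skip
        (setReg 22 (.lit 0))))))))))

open Classical in
theorem runsReg_compareRows (hE : ∀ i, ¬ E i i) (hn : 1 ≤ n) (h1 : v 20 < n) (h2 : v 21 < n) :
    RunsReg n E compareRows v (20000 * n ^ 2) fun v' =>
      v' 22 = (if ∀ z < n, E (v 20) z ↔ E (v 21) z then 1 else 0) ∧ ∀ k < 22, v' k = v k := by
  refine RunsReg.le (RunsReg.seq (Q := fun v' => v' 22 = 1 ∧ ∀ k < 22, v' k = v k)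
    (.set (x := 1) (fun _ _ => rfl) ⟨Function.update_self _ _ _, fun k hk =>
      Function.update_of_ne (by omega) _ _⟩) fun v1 hv1 =>
    RunsReg.for (T := 2000 + 4000 * n + (4000 * n) + 2000) (I := fun i v' =>
      v' 22 = (if ∀ z < i, E (v 20) z ↔ E (v 21) z then 1 else 0) ∧
      ∀ k < 22, v' k = v k) ⟨by simp [hv1.1],
      fun k hk => by rw [Function.update_of_ne (by omega), hv1.2 k hk]⟩ fun i hi v2 hc hv2 => ?_) ?_
  · have e20 := hv2.2 20 (by norm_num)
    have e21 := hv2.2 21 (by norm_num)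
    refine RunsReg.le (RunsReg.seq (Q := fun v' => v' 30 = v 20 ∧ ∀ k < 24, v' k = v2 k)
      (.set (x := v 20) (fun s hs => by rw [hs.eval_reg, e20]) ⟨Function.update_self _ _ _,
        fun k hk => Function.update_of_ne (by omega) _ _⟩) fun v3 hv3 => RunsReg.seq
      (Q := fun v' => v' 30 = v 20 ∧ v' 31 = i ∧ ∀ k < 24, v' k = v2 k)
      (.set (x := i) (fun s hs => by rw [hs.eval_reg, hv3.2 23 (by norm_num), hc])
        ⟨by simp [hv3.1], Function.update_self _ _ _, fun k hk => by
          rw [Function.update_of_ne (by omega), hv3.2 k hk]⟩) fun v4 hv4 => RunsReg.seq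
      (runsReg_loadEntry hE hn (by rw [hv4.1]; exact h1) (by rw [hv4.2.1]; exact hi))
      fun v5 hv5 => RunsReg.seq (Q := fun v' => v' 24 = (if E (v 20) i then 1 else 0) ∧
        v' 31 = i ∧ ∀ k < 24, v' k = v2 k)
      (.set (x := if E (v 20) i then 1 else 0)
        (fun s hs => by rw [hs.eval_reg, hv5.1, hv4.1, hv4.2.1])
        ⟨Function.update_self _ _ _, by simp [hv5.2 31 (by norm_num), hv4.2.1], fun k hk => by
          rw [Function.update_of_ne (by omega), hv5.2 k (by omega), hv4.2.2 k hk]⟩)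
      fun v6 hv6 => RunsReg.seq (Q := fun v' => v' 30 = v 21 ∧ v' 31 = i ∧
        v' 24 = (if E (v 20) i then 1 else 0) ∧ ∀ k < 24, v' k = v2 k)
      (.set (x := v 21) (fun s hs => by rw [hs.eval_reg, hv6.2.2 21 (by norm_num), e21])
        ⟨Function.update_self _ _ _, by simp [hv6.2.1], by simp [hv6.1], fun k hk => by
          rw [Function.update_of_ne (by omega), hv6.2.2 k hk]⟩)
      fun v7 hv7 => RunsReg.seq
      (runsReg_loadEntry hE hn (by rw [hv7.1]; exact h2) (by rw [hv7.2.1]; exact hi))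
      fun v8 hv8 => RunsReg.ite (c := E (v 20) i ↔ E (v 21) i) (T := 200) (fun s hs => ?_)
        (fun h => RunsReg.le (RunsReg.skip ⟨?_, ?_, fun k hk => ?_⟩) (by norm_num)) fun h =>
        RunsReg.le (RunsReg.set (x := 0) (fun _ _ => rfl) ⟨?_, ?_, fun k hk => ?_⟩) ?_) ?_
    · simp only [Test.Holds, hs.eval_reg, hv8.1, hv8.2 24 (by norm_num), hv7.1, hv7.2.1,
        hv7.2.2.1]
      split_ifs <;> simp_all
    · rw [hv8.2 23 (by norm_num), hv7.2.2.2 23 (by norm_num), hc]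
    · rw [Function.update_of_ne (by norm_num), hv8.2 22 (by norm_num),
        hv7.2.2.2 22 (by norm_num), hv2.1]
      refine if_congr ⟨fun h' z hz => ?_, fun h' z hz => h' z (by omega)⟩ rfl rfl
      rcases Nat.lt_succ_iff_lt_or_eq.1 hz with hz | rfl
      exacts [h' z hz, h]
    · rw [Function.update_of_ne (by omega), hv8.2 k (by omega), hv7.2.2.2 k (by omega), hv2.2 k hk]
    · rw [Function.update_of_ne (by norm_num), hv8.2 23 (by norm_num),
        hv7.2.2.2 23 (by norm_num), hc]
    · rw [Function.update_of_ne (by norm_num), Function.update_self,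
        if_neg fun h' => h (h' i (Nat.lt_succ_self i))]
    · rw [Function.update_of_ne (by omega), Function.update_of_ne (by omega), hv8.2 k (by omega),
        hv7.2.2.2 k (by omega), hv2.2 k hk]
    · simp [NatExpr.cost]
    · simp only [Test.cost, reg_cost]
      omega
  · simp only [NatExpr.cost]
    nlinarith

/-- The vertex `w` is kept: it has fewer than `M` smaller twins. -/
def IsKept (n : ℕ) (E : ℕ → ℕ → Prop) (M w : ℕ) : Prop := by
  classical
  exact Nat.count (fun u => u < w ∧ ∀ z < n, E w z ↔ E u z) n < M

/-- Register `16` becomes `1` if the vertex in the register `15` is kept, and `0` otherwise. -/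
def testKept : Prog :=
  .seq (setReg 16 (.lit 0)) (.seq (forReg 17 (.ite (.natLe (.add (reg 17) (.lit 1)) (reg 15))
    (.seq (setReg 20 (reg 15)) (.seq (setReg 21 (reg 17)) (.seq compareRows
      (setReg 16 (.add (reg 16) (reg 22)))))) .skip))
    (.ite (.natLe (.add (reg 16) (.lit 1)) (.add (.add (reg 3) (reg 3)) (.lit 4)))
      (setReg 16 (.lit 1)) (setReg 16 (.lit 0))))

open Classical in
theorem runsReg_testKept (hE : ∀ i, ¬ E i i) (hn : 1 ≤ n) (h1 : v 15 < n) :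
    RunsReg n E testKept v (24000 * n ^ 3) fun v' =>
      v' 16 = (if IsKept n E (2 * v 3 + 4) (v 15) then 1 else 0) ∧ ∀ k < 16, v' k = v k := by
  refine RunsReg.le (RunsReg.seq (Q := fun v' => v' 16 = 0 ∧ ∀ k < 16, v' k = v k)
    (.set (x := 0) (fun _ _ => rfl) ⟨Function.update_self _ _ _, fun k hk =>
      Function.update_of_ne (by omega) _ _⟩) fun v1 hv1 => RunsReg.seq
    (RunsReg.for (T := 2000 + 20000 * n ^ 2) (I := fun i v' =>
      v' 16 = Nat.count (fun u => u < v 15 ∧ ∀ z < n, E (v 15) z ↔ E u z) i ∧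
      ∀ k < 16, v' k = v k) ⟨by simp [hv1.1],
      fun k hk => by rw [Function.update_of_ne (by omega), hv1.2 k hk]⟩ fun i hi v2 hc hv2 => ?_)
    fun v3 hv3 => RunsReg.ite (c := IsKept n E (2 * v 3 + 4) (v 15)) (T := 300) (fun s hs => ?_)
      (fun h => RunsReg.le (RunsReg.set (x := 1) (fun _ _ => rfl) ⟨?_, fun k hk => ?_⟩) ?_)
      fun h => RunsReg.le (RunsReg.set (x := 0) (fun _ _ => rfl) ⟨?_, fun k hk => ?_⟩) ?_) ?_
  · have e15 := hv2.2 15 (by norm_num)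
    refine RunsReg.le (RunsReg.ite (c := i < v 15) (T := 1000 + 20000 * n ^ 2) (fun s hs => ?_) (fun h =>
      RunsReg.le (RunsReg.seq (Q := fun v' => v' 20 = v 15 ∧ ∀ k < 18, v' k = v2 k)
      (.set (x := v 15) (fun s hs => by rw [hs.eval_reg, e15]) ⟨Function.update_self _ _ _,
        fun k hk => Function.update_of_ne (by omega) _ _⟩) fun v3 hv3 => RunsReg.seq
      (Q := fun v' => v' 20 = v 15 ∧ v' 21 = i ∧ ∀ k < 18, v' k = v2 k)
      (.set (x := i) (fun s hs => by rw [hs.eval_reg, hv3.2 17 (by norm_num), hc])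
        ⟨by simp [hv3.1], Function.update_self _ _ _, fun k hk => by
          rw [Function.update_of_ne (by omega), hv3.2 k hk]⟩) fun v4 hv4 => RunsReg.seq
      (runsReg_compareRows hE hn (by rw [hv4.1]; exact h1) (by rw [hv4.2.1]; exact hi))
      fun v5 hv5 => RunsReg.set (x := Nat.count (fun u => u < v 15 ∧ ∀ z < n, E (v 15) z ↔ E u z)
        (i + 1)) (fun s hs => ?_) ⟨?_, ?_, fun k hk => ?_⟩) ?_) fun h =>
      RunsReg.le (RunsReg.skip ⟨hc, ?_, fun k hk => ?_⟩) (by omega)) ?_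
    · simp only [Test.Holds, NatExpr.eval, hs.eval_reg, hc, e15]
      omega
    · simp only [NatExpr.eval, hs.eval_reg, hv5.1, hv5.2 16 (by norm_num), hv4.1, hv4.2.1,
        hv4.2.2 16 (by norm_num), hv2.1, Nat.count_succ, h, true_and]
    · rw [Function.update_of_ne (by norm_num), hv5.2 17 (by norm_num), hv4.2.2 17 (by norm_num), hc]
    · rw [Function.update_of_ne (by norm_num), Function.update_self]
    · rw [Function.update_of_ne (by omega), Function.update_of_ne (by omega), hv5.2 k (by omega),
        hv4.2.2 k (by omega), hv2.2 k hk]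
    · simp only [NatExpr.cost, reg_cost]
      omega
    · rw [Function.update_of_ne (by norm_num), hv2.1, Nat.count_succ]
      simp [h]
    · rw [Function.update_of_ne (by omega), hv2.2 k hk]
    · simp only [NatExpr.cost, Test.cost, reg_cost]
      omega
  · simp only [Test.Holds, NatExpr.eval, hs.eval_reg, hv3.1, hv3.2 3 (by norm_num), IsKept]
    omega
  · simp [h]
  · rw [Function.update_of_ne (by omega), hv3.2 k hk]
  · simp [NatExpr.cost]
  · simp [h]
  · rw [Function.update_of_ne (by omega), hv3.2 k hk]
  · simp [NatExpr.cost]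
  · simp only [NatExpr.cost, Test.cost, reg_cost]
    have : 1 ≤ n ^ 2 := Nat.one_le_pow _ _ hn
    have : n ≤ n ^ 3 := Nat.le_self_pow (by norm_num) n
    have : n ^ 3 = n * n ^ 2 := by ring
    nlinarith

/-- Register `4` becomes the number of kept vertices. -/
def countKept : Prog :=
  .seq (setReg 4 (.lit 0)) (forReg 7 (.seq (setReg 15 (reg 7)) (.seq testKept
    (setReg 4 (.add (reg 4) (reg 16))))))

open Classical in
theorem runsReg_countKept (hE : ∀ i, ¬ E i i) (hn : 1 ≤ n) :
    RunsReg n E countKept v (26000 * n ^ 4) fun v' =>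
      v' 4 = Nat.count (IsKept n E (2 * v 3 + 4)) n ∧ ∀ k < 4, v' k = v k := by
  refine RunsReg.le (RunsReg.seq (Q := fun v' => v' 4 = 0 ∧ ∀ k < 4, v' k = v k)
    (.set (x := 0) (fun _ _ => rfl) ⟨Function.update_self _ _ _, fun k hk =>
      Function.update_of_ne (by omega) _ _⟩) fun v1 hv1 =>
    RunsReg.for (T := 1000 + 24000 * n ^ 3) (I := fun i v' =>
      v' 4 = Nat.count (IsKept n E (2 * v 3 + 4)) i ∧
      ∀ k < 4, v' k = v k) ⟨by simp [hv1.1],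
      fun k hk => by rw [Function.update_of_ne (by omega), hv1.2 k hk]⟩ fun i hi v2 hc hv2 =>
    RunsReg.le (RunsReg.seq (Q := fun v' => v' 15 = i ∧ ∀ k < 15, v' k = v2 k)
      (.set (x := i) (fun s hs => by rw [hs.eval_reg, hc]) ⟨Function.update_self _ _ _,
        fun k hk => Function.update_of_ne (by omega) _ _⟩) fun v3 hv3 => RunsReg.seq
      (runsReg_testKept hE hn (by rw [hv3.1]; exact hi)) fun v4 hv4 =>
      RunsReg.set (x := Nat.count (IsKept n E (2 * v 3 + 4)) (i + 1)) (fun s hs => ?_)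
        ⟨?_, ?_, fun k hk => ?_⟩) ?_) ?_
  · simp only [NatExpr.eval, hs.eval_reg, hv4.1, hv4.2 4 (by norm_num), hv3.1,
      hv3.2 3 (by norm_num), hv3.2 4 (by norm_num), hv2.1, hv2.2 3 (by norm_num), Nat.count_succ]
  · rw [Function.update_of_ne (by norm_num), hv4.2 7 (by norm_num), hv3.2 7 (by norm_num), hc]
  · rw [Function.update_of_ne (by norm_num), Function.update_self]
  · rw [Function.update_of_ne (by omega), Function.update_of_ne (by omega), hv4.2 k (by omega),
      hv3.2 k (by omega), hv2.2 k hk]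
  · simp only [NatExpr.cost, reg_cost]
    omega
  · simp only [NatExpr.cost]
    have : 1 ≤ n ^ 3 := Nat.one_le_pow _ _ hn
    have : n ≤ n ^ 4 := Nat.le_self_pow (by norm_num) n
    have : n ^ 4 = n * n ^ 3 := by ring
    nlinarith

/-- The digits of `x` in base `2` below `t` are given by `f`. -/
def IsCode (f : ℕ → ℕ) (t x : ℕ) : Prop := x < 2 ^ t ∧ ∀ k < t, dig x 2 k = f k

theorem IsCode.succ {f : ℕ → ℕ} {t x : ℕ} (h : IsCode f t x) (hf : f t < 2) :
    IsCode f (t + 1) (x + 2 ^ t * f t) := by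
  obtain ⟨h1, h2, h3⟩ := dig_add_pow_mul (by norm_num) h.1 hf
  refine ⟨h1, fun k hk => ?_⟩
  rcases Nat.lt_succ_iff_lt_or_eq.1 hk with hk | rfl
  exacts [(h2 k hk).trans (h.2 k hk), h3]

open Classical in
/-- The entries of the matrix of the kept vertices, row by row. -/
def keptEntry (n : ℕ) (E : ℕ → ℕ → Prop) (M k : ℕ) : ℕ :=
  if E (Nat.nth (IsKept n E M) (k / Nat.count (IsKept n E M) n))
    (Nat.nth (IsKept n E M) (k % Nat.count (IsKept n E M) n)) then 1 else 0

open Classical in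
theorem keptEntry_eq {M i j : ℕ} (hi : IsKept n E M i) (hj : IsKept n E M j) (hjn : j < n) :
    keptEntry n E M (Nat.count (IsKept n E M) i * Nat.count (IsKept n E M) n +
      Nat.count (IsKept n E M) j) = if E i j then 1 else 0 := by
  have hlt : Nat.count (IsKept n E M) j < Nat.count (IsKept n E M) n :=
    Nat.count_strict_mono hj hjn
  rw [keptEntry, mul_comm, Nat.mul_add_div (by omega), Nat.mul_add_mod, Nat.div_eq_of_lt hlt,
    Nat.mod_eq_of_lt hlt, add_zero, Nat.nth_count hi, Nat.nth_count hj]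

/-- Appends the entry at `(reg 7, reg 8)` to the code in the register `5` of length `log (reg 6)`. -/
def pushEntry : Prog :=
  .seq (setReg 30 (reg 7)) (.seq (setReg 31 (reg 8)) (.seq loadEntry
    (.seq (.ite (.natLe (.lit 1) (reg 32)) (setReg 5 (.add (reg 5) (reg 6))) .skip)
      (setReg 6 (.add (reg 6) (reg 6))))))

/-- The code grows from the lowest digit upwards. Register `6` holds the current place value `2 ^ t`
and is doubled by an addition. -/
theorem runsReg_pushEntry {f : ℕ → ℕ} {t : ℕ} (hE : ∀ i, ¬ E i i) (hn : 1 ≤ n) (h1 : v 7 < n)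
    (h2 : v 8 < n) (hf : f t = by classical exact if E (v 7) (v 8) then 1 else 0)
    (h5 : IsCode f t (v 5)) (h6 : v 6 = 2 ^ t) :
    RunsReg n E pushEntry v (5000 * n) fun v' => IsCode f (t + 1) (v' 5) ∧ v' 6 = 2 ^ (t + 1) ∧
      v' 7 = v 7 ∧ v' 8 = v 8 ∧ ∀ k < 5, v' k = v k := by
  classical
  have h7 : IsCode f (t + 1) (v 5 + 2 ^ t * f t) := h5.succ (by rw [hf]; split_ifs <;> norm_num)
  refine RunsReg.le (RunsReg.seq (Q := fun v' => v' 30 = v 7 ∧ ∀ k < 9, v' k = v k)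
    (.set (x := v 7) (fun s hs => hs.eval_reg 7) ⟨Function.update_self _ _ _,
      fun k hk => Function.update_of_ne (by omega) _ _⟩) fun v1 hv1 => RunsReg.seq
    (Q := fun v' => v' 30 = v 7 ∧ v' 31 = v 8 ∧ ∀ k < 9, v' k = v k)
    (.set (x := v 8) (fun s hs => by rw [hs.eval_reg, hv1.2 8 (by norm_num)])
      ⟨by simp [hv1.1], Function.update_self _ _ _, fun k hk => by
        rw [Function.update_of_ne (by omega), hv1.2 k hk]⟩) fun v2 hv2 => RunsReg.seq
    (runsReg_loadEntry hE hn (by rw [hv2.1]; exact h1) (by rw [hv2.2.1]; exact h2)) fun v3 hv3 =>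
    RunsReg.seq (Q := fun v' => IsCode f (t + 1) (v' 5) ∧ v' 6 = 2 ^ t ∧
      v' 7 = v 7 ∧ v' 8 = v 8 ∧ ∀ k < 5, v' k = v k)
    (RunsReg.ite (c := f t = 1) (T := 200) (fun s hs => ?_) (fun h =>
      RunsReg.le (RunsReg.set (x := v 5 + 2 ^ t) (fun s hs => ?_) ⟨?_, ?_, ?_, ?_, ?_⟩) ?_)
      fun h => RunsReg.le (RunsReg.skip ⟨?_, ?_, ?_, ?_, ?_⟩) (by norm_num)) fun v4 hv4 =>
    RunsReg.set (x := 2 ^ (t + 1)) (fun s hs => ?_) ⟨?_, ?_, ?_, ?_, ?_⟩) ?_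
  · simp only [Test.Holds, NatExpr.eval, hs.eval_reg, hv3.1, hv2.1, hv2.2.1, hf]
    split_ifs <;> simp
  · simp only [NatExpr.eval, hs.eval_reg, hv3.2 5 (by norm_num), hv3.2 6 (by norm_num),
      hv2.2.2 5 (by norm_num), hv2.2.2 6 (by norm_num), h6]
  · rw [Function.update_self]
    simpa [h] using h7
  · rw [Function.update_of_ne (by norm_num), hv3.2 6 (by norm_num), hv2.2.2 6 (by norm_num), h6]
  · rw [Function.update_of_ne (by norm_num), hv3.2 7 (by norm_num), hv2.2.2 7 (by norm_num)]
  · rw [Function.update_of_ne (by norm_num), hv3.2 8 (by norm_num), hv2.2.2 8 (by norm_num)]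
  · intro k hk
    rw [Function.update_of_ne (by omega), hv3.2 k (by omega), hv2.2.2 k (by omega)]
  · simp [NatExpr.cost, reg_cost]
  · have h0 : f t = 0 := by
      rw [hf] at h ⊢
      split_ifs at h ⊢ <;> simp_all
    rw [hv3.2 5 (by norm_num), hv2.2.2 5 (by norm_num)]
    simpa [h0] using h7
  · rw [hv3.2 6 (by norm_num), hv2.2.2 6 (by norm_num), h6]
  · rw [hv3.2 7 (by norm_num), hv2.2.2 7 (by norm_num)]
  · rw [hv3.2 8 (by norm_num), hv2.2.2 8 (by norm_num)]
  · intro k hk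
    rw [hv3.2 k (by omega), hv2.2.2 k (by omega)]
  · simp only [NatExpr.eval, hs.eval_reg, hv4.2.1]
    ring
  · rw [Function.update_of_ne (by norm_num)]
    exact hv4.1
  · rw [Function.update_self]
  · rw [Function.update_of_ne (by norm_num), hv4.2.2.1]
  · rw [Function.update_of_ne (by norm_num), hv4.2.2.2.1]
  · intro k hk
    rw [Function.update_of_ne (by omega), hv4.2.2.2.2 k hk]
  · simp only [NatExpr.cost, Test.cost, reg_cost]
    omega

/-- Appends the row of the vertex in the register `7` to the code. -/
def pushRow : Prog :=
  forReg 8 (.seq (setReg 15 (reg 8)) (.seq testKept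
    (.ite (.natLe (.lit 1) (reg 16)) pushEntry .skip)))

open Classical in
theorem runsReg_pushRow {M : ℕ} (hE : ∀ i, ¬ E i i) (hn : 1 ≤ n) (h1 : v 7 < n)
    (hM : M = 2 * v 3 + 4) (hk : IsKept n E M (v 7))
    (h5 : IsCode (keptEntry n E M) (Nat.count (IsKept n E M) (v 7) * Nat.count (IsKept n E M) n)
      (v 5))
    (h6 : v 6 = 2 ^ (Nat.count (IsKept n E M) (v 7) * Nat.count (IsKept n E M) n)) :
    RunsReg n E pushRow v (40000 * n ^ 4) fun v' =>
      IsCode (keptEntry n E M) ((Nat.count (IsKept n E M) (v 7) + 1) * Nat.count (IsKept n E M) n)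
        (v' 5) ∧
      v' 6 = 2 ^ ((Nat.count (IsKept n E M) (v 7) + 1) * Nat.count (IsKept n E M) n) ∧
      v' 7 = v 7 ∧ ∀ k < 5, v' k = v k := by
  set r := fun i => Nat.count (IsKept n E M) i with hr
  set f := keptEntry n E M with hf
  -- Here `r j` is the number of kept vertices below `j`, so `r (v 7) * r n + r j` is the position
  -- of the next entry in the smaller matrix.
  refine RunsReg.mono (RunsReg.for (T := 1000 + 24000 * n ^ 3 + 5000 * n) (I := fun j v' =>
    IsCode f (r (v 7) * r n + r j) (v' 5) ∧ v' 6 = 2 ^ (r (v 7) * r n + r j) ∧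
      v' 7 = v 7 ∧ ∀ k < 5, v' k = v k) ⟨?_, ?_, ?_, fun k hk => ?_⟩ fun j hj v1 hc hv1 => ?_)
      ?_ fun v' hv' => ?_
  · simpa [hr] using h5
  · simpa [hr] using h6
  · simp
  · rw [Function.update_of_ne (by omega)]
  · refine RunsReg.le (RunsReg.seq (Q := fun v' => v' 15 = j ∧ ∀ k < 15, v' k = v1 k)
      (.set (x := j) (fun s hs => by rw [hs.eval_reg, hc]) ⟨Function.update_self _ _ _,
        fun k hk => Function.update_of_ne (by omega) _ _⟩) fun v2 hv2 => RunsReg.seq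
      (runsReg_testKept hE hn (by rw [hv2.1]; exact hj)) fun v3 hv3 =>
      RunsReg.ite (c := IsKept n E M j) (T := 100 + 5000 * n) (fun s hs => ?_) (fun h =>
        RunsReg.mono (runsReg_pushEntry (f := f) (t := r (v 7) * r n + r j) hE hn ?_ ?_ ?_ ?_ ?_)
          (by omega) fun v4 hv4 => ⟨?_, ?_, ?_, ?_, fun k hk => ?_⟩) fun h =>
        RunsReg.le (RunsReg.skip ⟨?_, ?_, ?_, ?_, fun k hk => ?_⟩) (by omega)) ?_
    · simp only [Test.Holds, NatExpr.eval, hs.eval_reg, hv3.1, hv2.1, hv2.2 3 (by norm_num),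
        hv1.2.2.2 3 (by norm_num), ← hM]
      split_ifs <;> simp_all
    · rw [hv3.2 7 (by norm_num), hv2.2 7 (by norm_num), hv1.2.2.1]
      exact h1
    · rw [hv3.2 8 (by norm_num), hv2.2 8 (by norm_num), hc]
      exact hj
    · rw [hv3.2 7 (by norm_num), hv2.2 7 (by norm_num), hv1.2.2.1, hv3.2 8 (by norm_num),
        hv2.2 8 (by norm_num), hc]
      exact keptEntry_eq hk h hj
    · rw [hv3.2 5 (by norm_num), hv2.2 5 (by norm_num)]
      exact hv1.1
    · rw [hv3.2 6 (by norm_num), hv2.2 6 (by norm_num)]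
      exact hv1.2.1
    · rw [hv4.2.2.2.1, hv3.2 8 (by norm_num), hv2.2 8 (by norm_num), hc]
    · rw [Function.update_of_ne (by norm_num)]
      simpa [hr, Nat.count_succ, h, add_assoc] using hv4.1
    · rw [Function.update_of_ne (by norm_num), hv4.2.1]
      simp [hr, Nat.count_succ, h, add_assoc]
    · rw [Function.update_of_ne (by norm_num), hv4.2.2.1, hv3.2 7 (by norm_num),
        hv2.2 7 (by norm_num), hv1.2.2.1]
    · rw [Function.update_of_ne (by omega), hv4.2.2.2.2 k hk, hv3.2 k (by omega),
        hv2.2 k (by omega), hv1.2.2.2 k hk]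
    · rw [hv3.2 8 (by norm_num), hv2.2 8 (by norm_num), hc]
    · rw [Function.update_of_ne (by norm_num), hv3.2 5 (by norm_num), hv2.2 5 (by norm_num)]
      simpa [hr, Nat.count_succ, h] using hv1.1
    · rw [Function.update_of_ne (by norm_num), hv3.2 6 (by norm_num), hv2.2 6 (by norm_num)]
      simpa [hr, Nat.count_succ, h] using hv1.2.1
    · rw [Function.update_of_ne (by norm_num), hv3.2 7 (by norm_num), hv2.2 7 (by norm_num),
        hv1.2.2.1]
    · rw [Function.update_of_ne (by omega), hv3.2 k (by omega), hv2.2 k (by omega),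
        hv1.2.2.2 k hk]
    · simp only [NatExpr.cost, Test.cost, reg_cost]
      omega
  · have h2 : n ≤ n ^ 3 := Nat.le_self_pow (by norm_num) n
    have h3 : n ≤ n ^ 4 := Nat.le_self_pow (by norm_num) n
    have h4 : n ^ 4 = n * n ^ 3 := by ring
    have h5 : n * n ≤ n * n ^ 3 := Nat.mul_le_mul_left n h2
    nlinarith
  · rw [add_mul, one_mul]
    exact hv'

/-- Register `5` becomes the code of the matrix of the kept vertices. -/
def encodeKept : Prog :=
  .seq (setReg 5 (.lit 0)) (.seq (setReg 6 (.lit 1)) (forReg 7 (.seq (setReg 15 (reg 7))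
    (.seq testKept (.ite (.natLe (.lit 1) (reg 16)) pushRow .skip)))))

open Classical in
theorem runsReg_encodeKept {M : ℕ} (hE : ∀ i, ¬ E i i) (hn : 1 ≤ n) (hM : M = 2 * v 3 + 4) :
    RunsReg n E encodeKept v (70000 * n ^ 5) fun v' =>
      IsCode (keptEntry n E M) (Nat.count (IsKept n E M) n * Nat.count (IsKept n E M) n) (v' 5) ∧
      ∀ k < 5, v' k = v k := by
  set r := fun i => Nat.count (IsKept n E M) i with hr
  set f := keptEntry n E M with hf
  refine RunsReg.le (RunsReg.seq (Q := fun v' => v' 5 = 0 ∧ ∀ k < 5, v' k = v k)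
    (.set (x := 0) (fun _ _ => rfl) ⟨Function.update_self _ _ _, fun k hk =>
      Function.update_of_ne (by omega) _ _⟩) fun v1 hv1 => RunsReg.seq
    (Q := fun v' => v' 5 = 0 ∧ v' 6 = 1 ∧ ∀ k < 5, v' k = v k)
    (.set (x := 1) (fun _ _ => rfl) ⟨by simp [hv1.1], Function.update_self _ _ _, fun k hk => by
      rw [Function.update_of_ne (by omega), hv1.2 k hk]⟩) fun v2 hv2 => RunsReg.mono
    (RunsReg.for (T := 1000 + 24000 * n ^ 3 + 40000 * n ^ 4) (I := fun i v' =>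
      IsCode f (r i * r n) (v' 5) ∧ v' 6 = 2 ^ (r i * r n) ∧ ∀ k < 5, v' k = v k)
      ⟨?_, ?_, fun k hk => ?_⟩ fun i hi v3 hc hv3 => ?_) le_rfl fun v' hv' => ⟨hv'.1, hv'.2.2⟩) ?_
  · simp [hr, hv2, IsCode]
  · simp [hr, hv2]
  · rw [Function.update_of_ne (by omega), hv2.2.2 k hk]
  · refine RunsReg.le (RunsReg.seq (Q := fun v' => v' 15 = i ∧ ∀ k < 15, v' k = v3 k)
      (.set (x := i) (fun s hs => by rw [hs.eval_reg, hc]) ⟨Function.update_self _ _ _,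
        fun k hk => Function.update_of_ne (by omega) _ _⟩) fun v4 hv4 => RunsReg.seq
      (runsReg_testKept hE hn (by rw [hv4.1]; exact hi)) fun v5 hv5 =>
      RunsReg.ite (c := IsKept n E M i) (T := 100 + 40000 * n ^ 4) (fun s hs => ?_) (fun h => ?_)
        fun h => RunsReg.le (RunsReg.skip ⟨?_, ?_, ?_, fun k hk => ?_⟩) (by omega)) ?_
    · simp only [Test.Holds, NatExpr.eval, hs.eval_reg, hv5.1, hv4.1, hv4.2 3 (by norm_num),
        hv3.2.2 3 (by norm_num), ← hM]
      split_ifs <;> simp_all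
    · have e7 : v5 7 = i := by rw [hv5.2 7 (by norm_num), hv4.2 7 (by norm_num), hc]
      have e : ∀ k < 7, v5 k = v3 k := fun k hk => by
        rw [hv5.2 k (by omega), hv4.2 k (by omega)]
      have hsucc : r (i + 1) = r i + 1 := by simp [hr, Nat.count_succ, h]
      refine RunsReg.mono (runsReg_pushRow (M := M) hE hn (by rw [e7]; exact hi) ?_
        (by rw [e7]; exact h) ?_ ?_) (by omega) fun v6 hv6 => ⟨?_, ?_, ?_, fun k hk => ?_⟩
      · rw [e 3 (by norm_num), hv3.2.2 3 (by norm_num)]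
        exact hM
      · rw [e7, e 5 (by norm_num)]
        exact hv3.1
      · rw [e7, e 6 (by norm_num)]
        exact hv3.2.1
      · rw [hv6.2.2.1, e7]
      · rw [Function.update_of_ne (by norm_num), hsucc]
        rw [e7] at hv6
        exact hv6.1
      · rw [Function.update_of_ne (by norm_num), hsucc]
        rw [e7] at hv6
        exact hv6.2.1
      · rw [Function.update_of_ne (by omega), hv6.2.2.2 k hk, e k (by omega), hv3.2.2 k hk]
    · rw [hv5.2 7 (by norm_num), hv4.2 7 (by norm_num), hc]
    · rw [Function.update_of_ne (by norm_num), hv5.2 5 (by norm_num), hv4.2 5 (by norm_num)]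
      simpa [hr, Nat.count_succ, h] using hv3.1
    · rw [Function.update_of_ne (by norm_num), hv5.2 6 (by norm_num), hv4.2 6 (by norm_num)]
      simpa [hr, Nat.count_succ, h] using hv3.2.1
    · rw [Function.update_of_ne (by omega), hv5.2 k (by omega), hv4.2 k (by omega),
        hv3.2.2 k hk]
    · simp only [NatExpr.cost, Test.cost, reg_cost]
      omega
  · simp only [NatExpr.cost]
    have h2 : n ≤ n ^ 5 := Nat.le_self_pow (by norm_num) n
    have h3 : n * n ^ 3 ≤ n ^ 5 := by
      rw [← pow_succ']
      exact Nat.pow_le_pow_right hn (by norm_num)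
    have h4 : n ^ 5 = n * n ^ 4 := by ring
    nlinarith

end RealRAM

/-! ## Computing a bound on the number of stopping points -/

namespace RealRAM

open GraphTour

/-- The search for a bound stops at `h`. -/
def Stops (x y : ℝ) (h : ℕ) : Prop :=
  3 ≤ x + x ∨ (y ≤ h ∧ y + 1 ≤ h * (3 - x - x) ∧ (1 ≤ x ∨ y + 1 ≤ h * (1 - x)))

/-- The search must end for all real inputs, as a computable function is total; for `3 ≤ x + x` it
ends at once. Otherwise `3 - x - x` is positive and a large `h` meets the conditions. -/
theorem exists_stops (x y : ℝ) : ∃ h, Stops x y h := by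
  by_cases hx : 3 ≤ x + x
  · exact ⟨0, .inl hx⟩
  have h3 : 0 < 3 - x - x := by linarith
  obtain ⟨h1, hh1⟩ := exists_nat_ge y
  obtain ⟨h2, hh2⟩ := exists_nat_ge ((y + 1) / (3 - x - x))
  obtain ⟨h4, hh4⟩ := exists_nat_ge ((y + 1) / (1 - x))
  have hle : ∀ k : ℕ, k ≤ h1 + h2 + h4 → (k : ℝ) ≤ (h1 + h2 + h4 : ℕ) :=
    fun k hk => Nat.cast_le.2 hk
  refine ⟨h1 + h2 + h4, .inr ⟨hh1.trans (hle _ (by omega)), ?_, ?_⟩⟩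
  · rw [div_le_iff₀ h3] at hh2
    exact hh2.trans (mul_le_mul_of_nonneg_right (hle _ (by omega)) h3.le)
  · refine (le_or_gt 1 x).imp_right fun hx1 => ?_
    have h5 : 0 < 1 - x := by linarith
    rw [div_le_iff₀ h5] at hh4
    exact hh4.trans (mul_le_mul_of_nonneg_right (hle _ (by omega)) h5.le)

open Classical in
/-- The least number at which the search for a bound stops. -/
def leastBound (x y : ℝ) : ℕ := Nat.find (exists_stops x y)

theorem isBound_leastBound {δ K : ℝ} (hδ : δ < 3 / 2) : IsBound δ K (leastBound δ K) := by
  classical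
  rcases Nat.find_spec (exists_stops δ K) with h | ⟨h1, h2, h3⟩
  · linarith
  · refine ⟨h1, h2.trans_eq ?_, h3⟩
    rw [leastBound]
    ring

/-! ### The search for the bound on the machine. -/

/-- The real number in the cell `i`. -/
def cell (i : ℕ) : RealExpr := .mem (.lit i)

/-- The test whether the search for a bound goes on. -/
def searchTest : Test :=
  .and (.not (.realLe (.lit 3) (.add (cell 0) (cell 0))))
    (.not (.and (.realLe (cell 1) (cell 2)) (.and (.realLe (.add (cell 1) (.lit 1)) (cell 3))
      (.not (.and (.not (.realLe (.lit 1) (cell 0)))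
        (.not (.realLe (.add (cell 1) (.lit 1)) (cell 4))))))))

/-- Register `3` becomes the least bound for the numbers in the first two real cells. -/
def findBound : Prog :=
  .seq (.setReal (.lit 2) (.lit 0)) (.seq (.setReal (.lit 3) (.lit 0))
    (.seq (.setReal (.lit 4) (.lit 0)) (.seq (setReg 3 (.lit 0))
      (.loop searchTest (.seq (.setReal (.lit 2) (.add (cell 2) (.lit 1)))
        (.seq (.setReal (.lit 3) (.add (cell 3) (.sub (.sub (.lit 3) (cell 0)) (cell 0))))
          (.seq (.setReal (.lit 4) (.add (cell 4) (.sub (.lit 1) (cell 0))))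
            (setReg 3 (.add (reg 3) (.lit 1))))))))))

theorem searchTest_holds {s : State} {x y : ℝ} {k : ℕ} (h0 : s.real 0 = x) (h1 : s.real 1 = y)
    (h2 : s.real 2 = k) (h3 : s.real 3 = k * (3 - x - x)) (h4 : s.real 4 = k * (1 - x)) :
    searchTest.Holds s ↔ ¬ Stops x y k := by
  simp only [searchTest, Test.Holds, cell, RealExpr.eval, NatExpr.eval, h0, h1, h2, h3, h4, Stops]
  push_cast
  tauto

variable {n : ℕ} {E : ℕ → ℕ → Prop} {v : ℕ → ℕ} {s : State}

theorem Mem.setReal (h : Mem n E v s) (r : ℕ → ℝ) : Mem n E v { s with real := r } :=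
  ⟨h.size, h.entry, h.reg⟩

/-- The products in the stopping condition are kept up to date by additions: after `k` passes the
real cells `2`, `3`, `4` hold `k`, `k * (3 - x - x)` and `k * (1 - x)`. -/
theorem runs_findBound (hs : Mem n E v s) :
    Runs findBound s (200 * (leastBound (s.real 0) (s.real 1) + 1)) fun s' =>
      Mem n E (Function.update v 3 (leastBound (s.real 0) (s.real 1))) s' ∧
        s'.real 0 = s.real 0 ∧ s'.real 1 = s.real 1 := by
  classical
  set x := s.real 0 with hx
  set y := s.real 1 with hy
  refine (Runs.seq (Runs.setReal (Q := fun s' => Mem n E v s' ∧ s'.real 0 = x ∧ s'.real 1 = y ∧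
    s'.real 2 = 0) ⟨hs.setReal _, ?_, ?_, ?_⟩) fun s1 h1 => Runs.seq (Runs.setReal
    (Q := fun s' => Mem n E v s' ∧ s'.real 0 = x ∧ s'.real 1 = y ∧ s'.real 2 = 0 ∧ s'.real 3 = 0)
    ⟨h1.1.setReal _, ?_, ?_, ?_, ?_⟩) fun s2 h2 => Runs.seq (Runs.setReal
    (Q := fun s' => Mem n E v s' ∧ s'.real 0 = x ∧ s'.real 1 = y ∧ s'.real 2 = 0 ∧ s'.real 3 = 0 ∧
      s'.real 4 = 0) ⟨h2.1.setReal _, ?_, ?_, ?_, ?_, ?_⟩) fun s3 h3 => Runs.seq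
    (RunsReg.set (k := 3) (x := 0) (e := .lit 0) (Q := fun v' => v' = Function.update v 3 0)
      (fun _ _ => rfl) rfl s3 h3.1) fun s4 ⟨hr, v4, h4, hv4⟩ => Runs.loop_const
    (N := leastBound x y) (c := 100) (I := fun k s' => Mem n E (Function.update v 3 k) s' ∧
      s'.real 0 = x ∧ s'.real 1 = y ∧ s'.real 2 = k ∧ s'.real 3 = k * (3 - x - x) ∧
      s'.real 4 = k * (1 - x)) ?_ (fun k hk s5 h5 => ⟨?_, ?_⟩) fun s5 h5 => ?_).mono ?_
      fun s' h => ⟨h.1, h.2.1, h.2.2.1⟩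
  · simp [NatExpr.eval, hx]
  · simp [NatExpr.eval, hy]
  · simp [NatExpr.eval, RealExpr.eval]
  · simp [NatExpr.eval, h1]
  · simp [NatExpr.eval, h1]
  · simp [NatExpr.eval, h1]
  · simp [NatExpr.eval, RealExpr.eval]
  · simp [NatExpr.eval, h2]
  · simp [NatExpr.eval, h2]
  · simp [NatExpr.eval, h2]
  · simp [NatExpr.eval, h2]
  · simp [NatExpr.eval, RealExpr.eval]
  · subst hv4
    simp [hr, h3, h4]
  · rw [searchTest_holds h5.2.1 h5.2.2.1 h5.2.2.2.1 h5.2.2.2.2.1 h5.2.2.2.2.2]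
    exact Nat.find_min (exists_stops x y) hk
  · refine (Runs.seq (Runs.setReal (Q := fun s' => Mem n E (Function.update v 3 k) s' ∧
        s'.real 0 = x ∧ s'.real 1 = y ∧ s'.real 2 = (k + 1 : ℕ) ∧
        s'.real 3 = k * (3 - x - x) ∧ s'.real 4 = k * (1 - x))
        ⟨h5.1.setReal _, ?_, ?_, ?_, ?_, ?_⟩) fun s6 h6 => Runs.seq (Runs.setReal
        (Q := fun s' => Mem n E (Function.update v 3 k) s' ∧
        s'.real 0 = x ∧ s'.real 1 = y ∧ s'.real 2 = (k + 1 : ℕ) ∧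
        s'.real 3 = (k + 1 : ℕ) * (3 - x - x) ∧ s'.real 4 = k * (1 - x))
        ⟨h6.1.setReal _, ?_, ?_, ?_, ?_, ?_⟩) fun s7 h7 => Runs.seq (Runs.setReal
        (Q := fun s' => Mem n E (Function.update v 3 k) s' ∧
        s'.real 0 = x ∧ s'.real 1 = y ∧ s'.real 2 = (k + 1 : ℕ) ∧
        s'.real 3 = (k + 1 : ℕ) * (3 - x - x) ∧ s'.real 4 = (k + 1 : ℕ) * (1 - x))
        ⟨h7.1.setReal _, ?_, ?_, ?_, ?_, ?_⟩) fun s8 h8 =>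
        (RunsReg.set (k := 3) (x := k + 1) (e := .add (reg 3) (.lit 1))
          (Q := fun v' => v' = Function.update v 3 (k + 1)) (fun s hs => ?_) (by simp) s8 h8.1).mono
          le_rfl fun s9 ⟨h9, v9, h10, h11⟩ => ⟨h11 ▸ h10, ?_⟩).mono ?_ fun _ h => h
    · simp [NatExpr.eval, h5]
    · simp [NatExpr.eval, h5]
    · simp [NatExpr.eval, RealExpr.eval, cell, h5]
    · simp [NatExpr.eval, h5]
    · simp [NatExpr.eval, h5]
    · simp [NatExpr.eval, h6]
    · simp [NatExpr.eval, h6]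
    · simp [NatExpr.eval, h6]
    · simp only [NatExpr.eval, RealExpr.eval, cell, h6, Function.update_self]
      push_cast
      ring
    · simp [NatExpr.eval, h6]
    · simp [NatExpr.eval, h7]
    · simp [NatExpr.eval, h7]
    · simp [NatExpr.eval, h7]
    · simp [NatExpr.eval, h7]
    · simp only [NatExpr.eval, RealExpr.eval, cell, h7, Function.update_self]
      push_cast
      ring
    · simp [NatExpr.eval, hs.eval_reg]
    · simp [NatExpr.cost, RealExpr.cost, cell, reg_cost]
    · rw [h9]
      exact h8.2
  · rw [searchTest_holds h5.2.1 h5.2.2.1 h5.2.2.2.1 h5.2.2.2.2.1 h5.2.2.2.2.2, not_not]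
    exact Nat.find_spec (exists_stops x y)
  · simp [NatExpr.cost, RealExpr.cost, cell, Test.cost, searchTest]
    omega

/-- The arguments are first swapped in memory, because `f` takes `K` before `δ`, while the search
expects `δ` in the first cell. -/
theorem computableFun_leastBound {F : ℕ → ℕ} (hF : Primrec F) :
    ComputableFun fun x y => F (leastBound y x) := by
  obtain ⟨T, -, hP⟩ := exists_prog_of_primrec hF
  obtain ⟨P, hP⟩ := hP 4 5 (by norm_num)
  refine ⟨.seq (.setReal (.lit 2) (cell 0)) (.seq (.setReal (.lit 0) (cell 1))
    (.seq (.setReal (.lit 1) (cell 2)) (.seq findBound (.seq P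
      (.setNat (.lit 0) (.mem (.lit 5))))))), fun x y => ?_⟩
  have hfind : ∀ s, (∀ a, s.nat a = 0) ∧ s.real 0 = y ∧ s.real 1 = x → Runs findBound s
      (200 * (leastBound y x + 1)) fun s' => s'.nat 4 = leastBound y x := fun s h => by
    -- The empty memory is regarded as that of a graph with `n = 0`; then register `3` is the cell
    -- `4`.
    have := runs_findBound (n := 0) (E := fun _ _ => False) (v := fun _ => 0) (s := s)
      ⟨h.1 0, by simp, fun k => h.1 _⟩
    rw [h.2.1, h.2.2] at this
    exact this.mono le_rfl fun s' hs' => by simpa using hs'.1.reg 3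
  obtain ⟨t, s', h1, -, h2⟩ := Runs.seq (Runs.setReal (a := .lit 2) (e := cell 0)
    (s := realInput x y) (Q := fun s' => (∀ a, s'.nat a = 0) ∧ s'.real 1 = y ∧ s'.real 2 = x)
    ⟨fun _ => rfl, by simp [NatExpr.eval, realInput],
      by simp [NatExpr.eval, cell, RealExpr.eval, realInput]⟩) fun s1 h1 => Runs.seq
    (Runs.setReal (a := .lit 0) (e := cell 1)
    (Q := fun s' => (∀ a, s'.nat a = 0) ∧ s'.real 0 = y ∧ s'.real 2 = x)
    ⟨h1.1, by simp [NatExpr.eval, cell, RealExpr.eval, h1.2.1], by simp [NatExpr.eval, h1.2.2]⟩)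
    fun s2 h2 => Runs.seq (Runs.setReal (a := .lit 1) (e := cell 2)
    (Q := fun s' => (∀ a, s'.nat a = 0) ∧ s'.real 0 = y ∧ s'.real 1 = x)
    ⟨h2.1, by simp [NatExpr.eval, h2.2.1], by simp [NatExpr.eval, cell, RealExpr.eval, h2.2.2]⟩)
    fun s3 h3 => Runs.seq (hfind s3 h3) fun s4 h4 => Runs.seq (hP s4 (leastBound y x) h4) fun s5 h5 => Runs.setNat (a := .lit 0) (e := .mem (.lit 5))
      (Q := fun s' => s'.nat 0 = F (leastBound y x)) (by simpa [NatExpr.eval] using h5.1)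
  exact ⟨t, s', h1, h2⟩

/-! ## Deciding the kernel -/

/-- The bound on the number of vertices of a kernel. -/
def sizeBound (h : ℕ) : ℕ := (3 * h + 2) + (2 * h + 4) * 2 ^ (3 * h + 2)

/-- The time must depend on `h` alone. Too large a kernel is rejected at once, and for the others
the time is at most the sum of the times over all `N ≤ sizeBound h` and all codes `x < 2 ^ (N * N)`,
which is primitive recursive in `h`. -/
theorem exists_prog_decide_code {φ : ℝ → ℝ → ℕ × ℕ × ℕ → Prop} (hφ : RealDec φ) :
    ∃ (P : Prog) (F : ℕ → ℕ), Primrec F ∧ ∀ (s : State) (h N x : ℕ), s.nat 1 = h → s.nat 2 = N →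
      s.nat 3 = x → x < 2 ^ (N * N) → Runs P s (F h) fun s' =>
        (N ≤ sizeBound h → φ (s.real 0) (s.real 1) (h, N, x) → s'.nat 0 = 1) ∧
        (¬ (N ≤ sizeBound h ∧ φ (s.real 0) (s.real 1) (h, N, x)) → s'.nat 0 = 0) := by
  have hb : Primrec sizeBound := by
    unfold sizeBound
    fun_prop
  obtain ⟨T1, hT1, hP1⟩ := exists_prog_of_primrec hb
  obtain ⟨P1, hP1⟩ := hP1 1 4 (by norm_num)
  obtain ⟨T2, hT2, hP2⟩ := exists_prog_pair
  obtain ⟨P2, hP2⟩ := hP2 5 7 (by norm_num)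
  obtain ⟨T3, hT3, hP3⟩ := hφ
  obtain ⟨P3, hP3⟩ := hP3 7
  let copy (i j : ℕ) : Prog := .setNat (.lit i) (.mem (.lit j))
  let R (h N x : ℕ) : ℕ := T2 N x + T2 h (Nat.pair N x) + T3 (h, N, x)
  refine ⟨.seq P1 (.ite (.natLe (.mem (.lit 2)) (.mem (.lit 4)))
    (.seq (copy 5 2) (.seq (copy 6 3) (.seq P2 (.seq (copy 5 1) (.seq (copy 6 7)
      (.seq P2 (.seq P3 (copy 0 8)))))))) (.setNat (.lit 0) (.lit 0))),
    fun h => T1 h + (100 + ∑ N ∈ Finset.range (sizeBound h + 1),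
      ∑ x ∈ Finset.range (2 ^ (N * N)), R h N x), ?_, ?_⟩
  · have h2 : ∀ {f g : ℕ × ℕ × ℕ → ℕ}, Primrec f → Primrec g → Primrec fun p => T2 (f p) (g p) :=
      fun hf hg => hT2.comp hf hg
    have h3 : Primrec fun p : ℕ × ℕ × ℕ => Nat.pair p.2.1 p.2.2 :=
      Primrec₂.natPair.comp (Primrec.fst.comp .snd) (Primrec.snd.comp .snd)
    have hR : Primrec fun p : ℕ × ℕ × ℕ => R p.1 p.2.1 p.2.2 :=
      Primrec.nat_add.comp (Primrec.nat_add.comp (h2 (by fun_prop) (by fun_prop))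
        (h2 (by fun_prop) h3)) hT3
    have hR' : ∀ {α : Type} [Primcodable α] {f g k : α → ℕ}, Primrec f → Primrec g → Primrec k →
        Primrec fun a => R (f a) (g a) (k a) := fun hf hg hk => hR.comp (hf.pair (hg.pair hk))
    have hS : Primrec fun p : ℕ × ℕ => ∑ x ∈ Finset.range (2 ^ (p.2 * p.2)), R p.1 p.2 x :=
      Primrec.sum_range (by fun_prop) (hR' (by fun_prop) (by fun_prop) (by fun_prop))
    exact Primrec.nat_add.comp hT1 (Primrec.nat_add.comp (.const _)
      (Primrec.sum_range (Primrec.succ.comp hb) hS))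
  intro s h N x h1 h2 h3 hx
  refine (hP1 s h h1).seq fun s1 ⟨h4, h5, h6⟩ => Runs.mono (Runs.ite (T := 90 + R h N x *
    (if N ≤ sizeBound h then 1 else 0)) (fun hb => ?_) fun hb => ?_) ?_ fun _ h => h
  · simp only [Test.Holds, NatExpr.eval, h4, h5 2 (by norm_num), h2] at hb
    have hcopy : ∀ (s0 : State) (i j : ℕ) (Q : State → Prop),
        Q { s0 with nat := Function.update s0.nat i (s0.nat j) } → Runs (copy i j) s0 4 Q :=
      fun s0 i j Q hQ => Runs.setNat hQ
    refine Runs.mono ((hcopy s1 5 2 (fun s' => s'.nat 5 = N ∧ s'.nat 1 = h ∧ s'.nat 3 = x ∧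
      s'.real = s.real) ⟨?_, ?_, ?_, h6⟩).seq fun s2 h7 => (hcopy s2 6 3 (fun s' => s'.nat 5 = N ∧
      s'.nat 6 = x ∧ s'.nat 1 = h ∧ s'.real = s.real) ⟨?_, ?_, ?_, h7.2.2.2⟩).seq fun s3 h8 =>
      (hP2 s3 N x h8.1 h8.2.1).seq fun s4 h9 => (hcopy s4 5 1 (fun s' => s'.nat 5 = h ∧
      s'.nat 7 = Nat.pair N x ∧ s'.real = s.real) ⟨?_, ?_, ?_⟩).seq fun s5 h10 =>
      (hcopy s5 6 7 (fun s' => s'.nat 5 = h ∧ s'.nat 6 = Nat.pair N x ∧ s'.real = s.real)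
      ⟨?_, ?_, h10.2.2⟩).seq fun s6 h11 => (hP2 s6 h (Nat.pair N x) h11.1 h11.2.1).seq
      fun s7 h12 => (hP3 s7 (h, N, x) h12.1).seq fun s8 h13 => hcopy s8 0 8 _ ?_) ?_ fun _ h => h
    · simp [h5 2, h2]
    · simp [h5 1, h1]
    · simp [h5 3, h3]
    · simp [h7]
    · simp [h7]
    · simp [h7]
    · simp [h9.2.1 1, h8]
    · simp [h9.1]
    · simp [h9.2.2, h8]
    · simp [h10]
    · simp [h10]
    · have h14 : s7.real = s.real := h12.2.2.trans h11.2.2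
      rw [h14] at h13
      simp only [Function.update_self, h13.1]
      exact ⟨fun _ h => if_pos h, fun hn => if_neg fun h => hn ⟨hb, h⟩⟩
    · simp only [R, if_pos hb]
      omega
  · simp only [Test.Holds, NatExpr.eval, h4, h5 2 (by norm_num), h2] at hb
    refine Runs.mono (Runs.setNat (a := .lit 0) (e := .lit 0) ⟨fun h => absurd h hb, fun _ => ?_⟩)
      ?_ fun _ h => h
    · simp [NatExpr.cost]
      omega
    · simp [NatExpr.eval]
  · have : R h N x * (if N ≤ sizeBound h then 1 else 0) ≤ ∑ N ∈ Finset.range (sizeBound h + 1),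
        ∑ x ∈ Finset.range (2 ^ (N * N)), R h N x := by
      split_ifs with hb
      · rw [mul_one]
        refine (Finset.single_le_sum (f := fun x => R h N x) (fun _ _ => Nat.zero_le _)
          (Finset.mem_range.2 hx)).trans (Finset.single_le_sum
          (f := fun N => ∑ x ∈ Finset.range (2 ^ (N * N)), R h N x) (fun _ _ => Nat.zero_le _)
          (Finset.mem_range.2 (Nat.lt_succ_of_le hb)))
      · simp
    simp only [Test.cost, NatExpr.cost]
    omega

/-! ## The kernel of a graph and its code -/

variable {G : SimpleGraph (Fin n)} {M : ℕ} {δ K : ℝ}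

/-- The adjacency relation of `G` on numbers. -/
def natAdj (G : SimpleGraph (Fin n)) (i j : ℕ) : Prop := ∃ u v : Fin n, G.Adj u v ∧ i = u ∧ j = v

theorem natAdj_coe {u v : Fin n} : natAdj G u v ↔ G.Adj u v := by
  refine ⟨?_, fun h => ⟨u, v, h, rfl, rfl⟩⟩
  rintro ⟨u', v', h, h1, h2⟩
  rwa [Fin.ext h1, Fin.ext h2]

theorem not_natAdj_self (i : ℕ) : ¬ natAdj G i i := by
  rintro ⟨u, v, h, rfl, h2⟩
  exact h.ne (Fin.ext h2)

/-- All registers start with `0`, since a simple graph has no loops and the cells beyond the matrix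
are empty. -/
theorem mem_graphInput (G : SimpleGraph (Fin n)) (x y : ℝ) :
    Mem n (natAdj G) (fun _ => 0) (graphInput G x y) := by
  refine ⟨by simp [graphInput], fun i hi j hj _ => ?_, fun k => ?_⟩
  · have : (∃ u v : Fin n, 1 + (i * n + j) = 1 + (u * n + v) ∧ G.Adj u v) ↔ natAdj G i j := by
      constructor
      · rintro ⟨u, v, h, huv⟩
        have h1 : j + n * i = v + n * u := by
          rw [mul_comm n, mul_comm n]
          omega
        have h2 := congrArg (· % n) h1
        have h3 := congrArg (· / n) h1
        simp only [Nat.add_mul_mod_self_left, Nat.mod_eq_of_lt hj, Nat.mod_eq_of_lt v.2] at h2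
        simp only [Nat.add_mul_div_left _ _ (Nat.zero_lt_of_lt hj), Nat.div_eq_of_lt hj,
          Nat.div_eq_of_lt v.2, zero_add] at h3
        exact ⟨u, v, huv, h3, h2⟩
      · rintro ⟨u, v, h, rfl, rfl⟩
        exact ⟨u, v, rfl, h⟩
    rw [graphInput]
    dsimp only
    rw [if_neg (by omega)]
    classical exact if_congr this rfl rfl
  · have : ¬ ∃ u v : Fin n, k * (n + 1) + 1 = 1 + (u * n + v) ∧ G.Adj u v := by
      rintro ⟨u, v, h, huv⟩
      have h1 : k + n * k = v + n * u := by
        have : k * (n + 1) = k + n * k := by ring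
        rw [mul_comm n u]
        omega
      have hn : 0 < n := Nat.zero_lt_of_lt v.2
      have hk : k < n := by
        by_contra hk
        push Not at hk
        have h2 : n * n ≤ n * k := Nat.mul_le_mul_left n hk
        have h3 : n * (u + 1) ≤ n * n := Nat.mul_le_mul_left n u.2
        rw [Nat.mul_add] at h3
        have := v.2
        omega
      have h2 := congrArg (· % n) h1
      have h3 := congrArg (· / n) h1
      simp only [Nat.add_mul_mod_self_left, Nat.mod_eq_of_lt hk, Nat.mod_eq_of_lt v.2] at h2
      simp only [Nat.add_mul_div_left _ _ hn, Nat.div_eq_of_lt hk,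
        Nat.div_eq_of_lt v.2, zero_add] at h3
      exact huv.ne (Fin.ext (h3.symm.trans h2))
    simp [graphInput, this]

open Classical in
theorem isKept_coe (w : Fin n) : IsKept n (natAdj G) M w ↔ w ∈ kept G M := by
  rw [IsKept, kept, Finset.mem_filter, Nat.count_eq_card_filter_range]
  simp only [Finset.mem_univ, true_and]
  have htwin : ∀ u : Fin n, (∀ z < n, natAdj G w z ↔ natAdj G u z) ↔ Twin G w u := fun u =>
    ⟨fun h z => by simpa only [natAdj_coe] using h z z.2, fun h z hz => by
      simpa only [natAdj_coe] using (natAdj_coe (v := ⟨z, hz⟩)).trans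
        ((h ⟨z, hz⟩).trans natAdj_coe.symm)⟩
  have hcard : ((Finset.range n).filter fun u => u < (w : ℕ) ∧
      ∀ z < n, natAdj G w z ↔ natAdj G u z).card =
      (Finset.univ.filter fun u => u < w ∧ Twin G w u).card := by
    refine (Finset.card_bij (fun (u : Fin n) _ => (u : ℕ)) (fun u hu => ?_)
      (fun u _ v _ h => Fin.ext h)
      fun x hx => ?_).symm
    · simp only [Finset.mem_filter, Finset.mem_univ, true_and] at hu
      simp only [Finset.mem_filter, Finset.mem_range]
      exact ⟨u.2, hu.1, (htwin u).2 hu.2⟩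
    · simp only [Finset.mem_filter, Finset.mem_range] at hx
      refine ⟨⟨x, hx.1⟩, ?_, rfl⟩
      simp only [Finset.mem_filter, Finset.mem_univ, true_and]
      exact ⟨hx.2.1, (htwin _).1 hx.2.2⟩
  rw [← hcard]

open Classical in
theorem count_isKept : Nat.count (IsKept n (natAdj G) M) n = (kept G M).card := by
  rw [Nat.count_eq_card_filter_range]
  refine (Finset.card_bij (fun (u : Fin n) _ => (u : ℕ)) (fun u hu => ?_)
      (fun u _ v _ h => Fin.ext h)
    fun x hx => ?_).symm
  · simp only [Finset.mem_filter, Finset.mem_range]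
    exact ⟨u.2, (isKept_coe u).2 hu⟩
  · simp only [Finset.mem_filter, Finset.mem_range] at hx
    exact ⟨⟨x, hx.1⟩, (isKept_coe _).1 hx.2, rfl⟩

/-- The kept vertices are renumbered by their rank, with `Nat.count` and `Nat.nth` as mutually
inverse bijections, and a solution is transported along them. -/
theorem sol_bitAdj_iff {x : ℕ} (hn : 1 ≤ n)
    (hx : IsCode (keptEntry n (natAdj G) M) ((kept G M).card * (kept G M).card) x) :
    Sol (bitAdj (kept G M).card x) (Finset.range (kept G M).card) δ K ↔
      Sol G.Adj (kept G M) δ K := by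
  classical
  set p := IsKept n (natAdj G) M with hp
  have hcard : Nat.count p n = (kept G M).card := count_isKept
  have hnth : ∀ k < (kept G M).card, ∃ u ∈ kept G M, Nat.nth p k = u ∧ Nat.count p u = k := by
    intro k hk
    rw [← hcard] at hk
    have h1 : ∀ hf : (Set.ofPred p).Finite, k < hf.toFinset.card :=
      fun hf => hk.trans_le (Nat.count_le_card hf n)
    have h2 := Nat.nth_mem k h1
    exact ⟨⟨Nat.nth p k, Nat.nth_lt_of_lt_count hk⟩, (isKept_coe _).1 h2, rfl, Nat.count_nth h1⟩
  have : Nonempty (Fin n) := ⟨⟨0, hn⟩⟩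
  choose! φ hφ1 hφ2 hφ3 using hnth
  have hlt : ∀ u ∈ kept G M, Nat.count p u < (kept G M).card := fun u hu =>
    (Nat.count_strict_mono ((isKept_coe u).2 hu) u.2).trans_eq hcard
  refine (sol_iff_of_bij (ψ := fun u : Fin n => Nat.count p u) (φ := φ)
    (fun u hu => Finset.mem_range.2 (hlt u hu)) (fun k hk => hφ1 k (Finset.mem_range.1 hk))
    (fun u hu => Fin.ext ?_) (fun k hk => hφ3 k (Finset.mem_range.1 hk))
    fun u hu v hv => ?_).symm
  · rw [← hφ2 _ (hlt u hu)]
    exact Nat.nth_count ((isKept_coe u).2 hu)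
  · have h1 : Nat.count p u * (kept G M).card + Nat.count p v <
        (kept G M).card * (kept G M).card := by
      have := Nat.mul_le_mul_right (kept G M).card (Nat.succ_le_of_lt (hlt u hu))
      rw [Nat.succ_mul] at this
      have := hlt v hv
      omega
    have h2 := keptEntry_eq ((isKept_coe u).2 hu) ((isKept_coe v).2 hv) v.2
    rw [bitAdj, hx.2 _ h1, ← hcard, h2, natAdj_coe]
    simp

theorem sol_iff_kernel {h x : ℕ} (hn : 1 ≤ n) (hδ : δ < 3 / 2) (hK : 0 ≤ K) (hh : IsBound δ K h)
    (hx : IsCode (keptEntry n (natAdj G) (2 * h + 4))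
      ((kept G (2 * h + 4)).card * (kept G (2 * h + 4)).card) x) :
    Sol G.Adj Finset.univ δ K ↔ (kept G (2 * h + 4)).card ≤ sizeBound h ∧
      Sol (bitAdj (kept G (2 * h + 4)).card x) (Finset.range (kept G (2 * h + 4)).card) δ K := by
  rw [sol_bitAdj_iff hn hx, sol_kept_iff hδ hK hh le_rfl]
  exact ⟨fun hs => ⟨card_kept_le hδ hK hh hs, hs⟩, fun hs => hs.2⟩

/-! ## The algorithm -/

/-- Copies the registers `3`, `4` and `5` to the first cells. -/
def copyRegs : Prog :=
  .seq (.setNat (.lit 1) (reg 3)) (.seq (.setNat (.lit 2) (reg 4)) (.setNat (.lit 3) (reg 5)))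

/-- The copies may destroy the matrix, so `Mem` is given up here. The registers remain readable:
their addresses depend on the cell `0` only, and for `n ≥ 1` the registers `3`, `4`, `5` lie above
the overwritten cells. -/
theorem runs_copyRegs (hn : 1 ≤ n) (hs : Mem n E v s) : Runs copyRegs s 100 fun s' =>
    s'.nat 1 = v 3 ∧ s'.nat 2 = v 4 ∧ s'.nat 3 = v 5 ∧ s'.real = s.real := by
  have hreg : ∀ s' : State, s'.nat 0 = n → ∀ k, (reg k).eval s' = s'.nat (k * (n + 1) + 1) := by
    intro s' h0 k
    have : (regAddr k).eval s' = k * (n + 1) + 1 := by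
      induction k with
      | zero => simp [regAddr, NatExpr.eval]
      | succ k ih =>
        simp only [regAddr, NatExpr.eval, ih, h0]
        ring
    rw [reg, NatExpr.eval, this]
  refine (Runs.seq (Runs.setNat (Q := fun s' => s'.nat 0 = n ∧ s'.nat 1 = v 3 ∧
    s'.nat (4 * (n + 1) + 1) = v 4 ∧ s'.nat (5 * (n + 1) + 1) = v 5 ∧ s'.real = s.real)
    ⟨?_, ?_, ?_, ?_, rfl⟩) fun s1 h1 => Runs.seq (Runs.setNat (Q := fun s' => s'.nat 0 = n ∧
    s'.nat 1 = v 3 ∧ s'.nat 2 = v 4 ∧ s'.nat (5 * (n + 1) + 1) = v 5 ∧ s'.real = s.real)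
    ⟨?_, ?_, ?_, ?_, h1.2.2.2.2⟩) fun s2 h2 => Runs.setNat ⟨?_, ?_, ?_, h2.2.2.2.2⟩).mono ?_
    fun _ h => h
  · simp [NatExpr.eval, hs.size]
  · simp [NatExpr.eval, hs.eval_reg]
  · simp [NatExpr.eval, hs.reg]
  · simp [NatExpr.eval, hs.reg]
  · simp [NatExpr.eval, h1.1]
  · simp [NatExpr.eval, h1.2.1]
  · simp [NatExpr.eval, hreg s1 h1.1, h1.2.2.1]
  · have : 5 * (n + 1) + 1 ≠ 2 := by omega
    simp [NatExpr.eval, h1, this]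
  · simp [NatExpr.cost, reg_cost]
  · simp [NatExpr.eval, h2.2.1]
  · simp [NatExpr.eval, h2.2.2.1]
  · simp [NatExpr.eval, hreg s2 h2.1, h2.2.2.2.1]

theorem exists_prog_hasDeltaTour : ∃ (P : Prog) (F : ℕ → ℕ), Primrec F ∧
    ∀ (n : ℕ) (_ : 1 ≤ n) (G : SimpleGraph (Fin n)) (δ K : ℝ), 0 ≤ δ → δ < 3 / 2 → 0 ≤ K →
      DecidesWithin P (graphInput G δ K) (HasDeltaTour G δ K) (F (leastBound δ K) * n ^ 5) := by
  classical
  obtain ⟨φ, hφ, hsol⟩ := exists_realDec_sol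
  obtain ⟨P, F, hF, hP⟩ := exists_prog_decide_code hφ
  refine ⟨.seq findBound (.seq countKept (.seq encodeKept (.seq copyRegs P))),
    fun h => 200 * (h + 1) + (96100 + F h), by fun_prop, fun n hn G δ K hδ hδ' hK => ?_⟩
  set h := leastBound δ K with hh
  have hb : IsBound δ K h := isBound_leastBound hδ'
  have hE : ∀ i, ¬ natAdj G i i := not_natAdj_self
  have hr0 : (graphInput G δ K).real 0 = δ := rfl
  have hr1 : (graphInput G δ K).real 1 = K := rfl
  set N := (kept G (2 * h + 4)).card with hN
  have hcount : Nat.count (IsKept n (natAdj G) (2 * h + 4)) n = N := count_isKept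
  obtain ⟨t, s', h1, h2, h3⟩ := (runs_findBound (mem_graphInput G δ K)).seq fun s1 h1 =>
    (runsReg_countKept hE hn s1 h1.1).seq fun s2 ⟨hr2, v2, hm2, hv2⟩ =>
    (runsReg_encodeKept hE hn rfl s2 hm2).seq fun s3 ⟨hr3, v3, hm3, hv3⟩ =>
    (runs_copyRegs hn hm3).seq fun s4 h4 => (by
      have e3 : v2 3 = h := by
        rw [hv2.2 3 (by norm_num), hr0, hr1]
        simp [hh]
      have e4 : v2 4 = N := by
        rw [hv2.1, hr0, hr1, ← hcount]
        simp [hh]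
      have e0 : s4.real 0 = δ := by rw [h4.2.2.2, hr3, hr2, h1.2.1, hr0]
      have e1 : s4.real 1 = K := by rw [h4.2.2.2, hr3, hr2, h1.2.2, hr1]
      have hx := hv3.1
      rw [e3, hcount] at hx
      have h5 := hP s4 h N (v3 5) (by rw [h4.1, hv3.2 3 (by norm_num), e3])
        (by rw [h4.2.1, hv3.2 4 (by norm_num), e4]) h4.2.2.1 hx.1
      rw [e0, e1, hsol δ K h N _ hb] at h5
      refine h5.mono le_rfl fun s' (h6 : _ ∧ _) => (?_ : (HasDeltaTour G δ K → s'.nat 0 = 1) ∧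
        (¬ HasDeltaTour G δ K → s'.nat 0 = 0))
      rw [hasDeltaTour_iff_sol hδ hK, sol_iff_kernel hn hδ' hK hb hx]
      exact ⟨fun h => h6.1 h.1 h.2, h6.2⟩ : Runs P s4 (F h) fun s' =>
        (HasDeltaTour G δ K → s'.nat 0 = 1) ∧ (¬ HasDeltaTour G δ K → s'.nat 0 = 0))
  refine ⟨t, s', h1, h2.trans ?_, h3.1, h3.2⟩
  rw [hr0, hr1, ← hh]
  have h4 : n ^ 4 ≤ n ^ 5 := Nat.pow_le_pow_right hn (by norm_num)
  have h5 : 1 ≤ n ^ 5 := Nat.one_le_pow _ _ hn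
  have h6 := Nat.le_mul_of_pos_right (200 * (h + 1) + (100 + F h)) h5
  have h7 : (200 * (h + 1) + (96100 + F h)) * n ^ 5 =
    (200 * (h + 1) + (100 + F h)) * n ^ 5 + 96000 * n ^ 5 := by ring
  rw [h7]
  omega

end RealRAM

end

theorem mainTheorem4 :
    ∃ (P : RealRAM.Prog) (f : ℝ → ℝ → ℕ) (c : ℕ), RealRAM.ComputableFun f ∧
      ∀ (n : ℕ) (_ : 0 < n) (G : SimpleGraph (Fin n)) (δ K : ℝ),
        0 < δ → δ < 3 / 2 → 0 ≤ K →
          RealRAM.DecidesWithin P (RealRAM.graphInput G δ K) (GraphTour.HasDeltaTour G δ K)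
            (f K δ * n ^ c) := by
  obtain ⟨P, F, hF, hP⟩ := RealRAM.exists_prog_hasDeltaTour
  exact ⟨P, fun K δ => F (RealRAM.leastBound δ K), 5, RealRAM.computableFun_leastBound hF,
    fun n hn G δ K hδ hδ' hK => hP n hn G δ K hδ.le hδ' hK⟩
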